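/- For a semigroup $S$ and $k\ge 1$ let $S^k$ be the set of all products of $k$ elements of $S$. A semigroup $S$ is nilpotent if $|S^{c+1}|=1$ for some integer $c\ge 0$; the least such $c$ is the class of $S$, and if $S$ is finite and nilpotent of class $c$ then the coclass of $S$ is $|S|-1-c$. Two semigroups are anti-isomorphic if one is isomorphic to the dual (opposite) of the other. Let $n\ge 7$ be an integer. The number of nilpotent semigroups of order $n$ and coclass $2$ (i) counted up to isomorphism or anti-isomorphism equals $$\tfrac18(21n^2+66n-104)-\lceil n/3\rceil \text{ if } n \text{ is even, and}\quad \tfrac18(21n^2+80n-93)-\lceil n/3\rceil \text{ if } n \text{ is odd};$$ (ii) counted up to isomorphism equals $$\tfrac18(27n^2+150n-240)-\lceil n/3\rceil \text{ if } n \text{ is even, and}\quad \tfrac18(27n^2+168n-203)-\lceil n/3\rceil \text{ if } n \text{ is odd}.$$ (iii) The number of commutative nilpotent semigroups of order $n$ and coclass $2$, counted up to isomorphism, equals $$\tfrac18(15n^2-26n-40)-\lceil n/3\rceil \text{ if } n \text{ is even, and}\quad \tfrac18(15n^2-16n-63)-\lceil n/3\rceil \text{ if } n \text{ is odd}.$$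 -/

import Mathlib

open scoped Pointwise

/-- `mulPow S k` is the set `S ^ (k + 1)` of all products of `k + 1` elements of `S`. -/
def mulPow (S : Type*) [Semigroup S] : ℕ → Set S
  | 0 => Set.univ
  | k + 1 => mulPow S k * Set.univ

/-- `S` is nilpotent of class `c`: `c` is the least natural number with `|S ^ (c + 1)| = 1`. -/
def IsNilpotentOfClass (S : Type*) [Semigroup S] (c : ℕ) : Prop :=
  IsLeast {k : ℕ | (mulPow S k).ncard = 1} c

/-- `S` is a finite nilpotent semigroup of coclass `r`, i.e. `r = |S| - 1 - c`, with `c` the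
class of `S` (written without subtraction). -/
def HasCoclass (S : Type*) [Semigroup S] (r : ℕ) : Prop :=
  Finite S ∧ ∃ c : ℕ, IsNilpotentOfClass S c ∧ Nat.card S = r + c + 1

/-- Two semigroups are isomorphic. -/
def AreIso (S T : Type*) [Semigroup S] [Semigroup T] : Prop :=
  Nonempty (S ≃* T)

/-- Two semigroups are anti-isomorphic: one is isomorphic to the dual of the other. -/
def AreAntiIso (S T : Type*) [Semigroup S] [Semigroup T] : Prop :=
  Nonempty (S ≃* Tᵐᵒᵖ)

/-- The nilpotent semigroups of order `n` and coclass `r`. -/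
def NilpotentSemigroups (n r : ℕ) : Type 1 :=
  {S : Semigrp.{0} // Nat.card S = n ∧ HasCoclass S r}

/-- The commutative nilpotent semigroups of order `n` and coclass `r`. -/
def CommNilpotentSemigroups (n r : ℕ) : Type 1 :=
  {S : NilpotentSemigroups n r // ∀ x y : S.1, x * y = y * x}

/-- Isomorphism, as an equivalence relation. -/
def isoSetoid (n r : ℕ) : Setoid (NilpotentSemigroups n r) where
  r S T := AreIso S.1 T.1
  iseqv :=
    { refl := fun S => ⟨MulEquiv.refl S.1⟩
      symm := fun ⟨e⟩ => ⟨e.symm⟩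
      trans := fun ⟨e⟩ ⟨f⟩ => ⟨e.trans f⟩ }

/-- Isomorphism or anti-isomorphism, as an equivalence relation. -/
def isoOrAntiIsoSetoid (n r : ℕ) : Setoid (NilpotentSemigroups n r) where
  r S T := AreIso S.1 T.1 ∨ AreAntiIso S.1 T.1
  iseqv :=
    { refl := fun S => Or.inl ⟨MulEquiv.refl S.1⟩
      symm := by
        rintro S T (⟨⟨e⟩⟩ | ⟨⟨e⟩⟩)
        · exact Or.inl ⟨e.symm⟩
        · exact Or.inr ⟨(MulEquiv.opOp T.1).trans (MulEquiv.op e.symm)⟩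
      trans := by
        rintro S T U (⟨⟨e⟩⟩ | ⟨⟨e⟩⟩) (⟨⟨f⟩⟩ | ⟨⟨f⟩⟩)
        · exact Or.inl ⟨e.trans f⟩
        · exact Or.inr ⟨e.trans f⟩
        · exact Or.inr ⟨e.trans (MulEquiv.op f)⟩
        · exact Or.inl ⟨(e.trans (MulEquiv.op f)).trans (MulEquiv.opOp U.1).symm⟩ }

/-- Isomorphism of commutative nilpotent semigroups, as an equivalence relation. -/
def commIsoSetoid (n r : ℕ) : Setoid (CommNilpotentSemigroups n r) :=
  (isoSetoid n r).comap Subtype.val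

/-- The number of nilpotent semigroups of order `n` and coclass `r` up to isomorphism. -/
noncomputable def numIso (n r : ℕ) : ℕ :=
  Nat.card (Quotient (isoSetoid n r))

/-- The number of nilpotent semigroups of order `n` and coclass `r` up to isomorphism or
anti-isomorphism. -/
noncomputable def numIsoOrAntiIso (n r : ℕ) : ℕ :=
  Nat.card (Quotient (isoOrAntiIsoSetoid n r))

/-- The number of commutative nilpotent semigroups of order `n` and coclass `r` up to
isomorphism. -/
noncomputable def numCommIso (n r : ℕ) : ℕ :=
  Nat.card (Quotient (commIsoSetoid n r))

/-! ### The filtration of a semigroup by the sets of k-fold products. -/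

section Layers

variable {S : Type*} [Semigroup S]

/-! Write n = m + 3, so that the class is m. The layers S^(k+1) \ S^(k+2) with k < m are nonempty
and partition the m + 2 nonzero elements, and once a layer has at most one element so has the next
(`layer_succ_subsingleton`). Hence the layer sizes are 3, 1, 1, ... or 2, 2, 1, ...
(`layer_ncard_of_coclass_two`). Because layers from the third on are singletons, some element a has
powers a, ..., a^m meeting every layer (`exists_spow_mem_layer`). So S consists of three labelled
elements, one of them a, and of the powers a^2, ..., a^(m+1) = 0. Every labelled element acts on
high powers of a like some power of a, whose exponent is its weight.

Three generators: the weights are (1, p, q) after sorting. A product of generators of weights i, j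
is a^(i+j) if i + j < m; otherwise it is a^m or 0, and since longer products do not see the
difference, each choice gives a semigroup. The isomorphism types are therefore Boolean 3 × 3
matrices supported on the free positions, modulo permutations preserving the weights (`tab₁_iso`);
duality is transposition.

Two generators a, b: let β be the weight of b and W the element other than a^2 in the second layer.
At least one of ab, ba, bb is W. Numbers x, y, u encode these three products, 0 meaning W, and one
bit t encodes the choice left in a triple product. Associativity in the seven resulting cases is
exactly `IsCode`. The code is an invariant unless β = 1, where exchanging a and b identifies two
pairs of codes (`tab₂_iso` and the `areIso_swap_*` lemmas); duality exchanges x and y.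

Choosing one canonical code per class turns all three problems into cardinalities of `codes`. For
given weights the number of codes depends only on finitely many comparisons (sums of weights against
m, equalities of weights), so it is evaluated by the kernel. Summing over the weights gives
quadratics that depend on the parity of n through thresholds such as 2q ≥ m; the term ⌈n/3⌉ comes
from the threshold 3β ≥ m beyond which b^3 is free. -/

theorem mem_mulPow_succ {k : ℕ} {x : S} :
    x ∈ mulPow S (k + 1) ↔ ∃ y ∈ mulPow S k, ∃ g : S, y * g = x := by
  simp [mulPow, Set.mem_mul]

theorem mulPow_succ_subset (k : ℕ) : mulPow S (k + 1) ⊆ mulPow S k := by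
  induction k with
  | zero => intro x _; trivial
  | succ k ih =>
    intro x hx
    obtain ⟨y, hy, g, rfl⟩ := mem_mulPow_succ.1 hx
    exact mem_mulPow_succ.2 ⟨y, ih hy, g, rfl⟩

theorem mulPow_antitone : Antitone (mulPow S) := antitone_nat_of_succ_le mulPow_succ_subset

theorem mul_mem_mulPow {i j : ℕ} {x y : S} (hx : x ∈ mulPow S i) (hy : y ∈ mulPow S j) :
    x * y ∈ mulPow S (i + j + 1) := by
  induction j generalizing y with
  | zero => exact mem_mulPow_succ.2 ⟨x, hx, y, rfl⟩
  | succ j ih =>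
    obtain ⟨z, hz, g, rfl⟩ := mem_mulPow_succ.1 hy
    exact mem_mulPow_succ.2 ⟨x * z, ih hz, g, mul_assoc _ _ _⟩

theorem exists_mul_eq_of_mem_mulPow {i j : ℕ} {x : S} (hx : x ∈ mulPow S (i + j + 1)) :
    ∃ y ∈ mulPow S i, ∃ z ∈ mulPow S j, y * z = x := by
  induction j generalizing x with
  | zero =>
    obtain ⟨y, hy, g, h⟩ := mem_mulPow_succ.1 hx
    exact ⟨y, hy, g, trivial, h⟩
  | succ j ih =>
    obtain ⟨y, hy, g, rfl⟩ := mem_mulPow_succ.1 hx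
    obtain ⟨u, hu, v, hv, rfl⟩ := ih hy
    exact ⟨u, hu, v * g, mem_mulPow_succ.2 ⟨v, hv, g, rfl⟩, (mul_assoc _ _ _).symm⟩

/-- The elements that are products of `k + 1` elements but not of `k + 2` elements. -/
def layer (S : Type*) [Semigroup S] (k : ℕ) : Set S := mulPow S k \ mulPow S (k + 1)

/-- A factor lying deeper than required would push the product deeper too. -/
theorem layer_of_mul {i j : ℕ} {x y : S} (hx : x ∈ mulPow S i) (hy : y ∈ mulPow S j)
    (h : x * y ∈ layer S (i + j + 1)) : x ∈ layer S i ∧ y ∈ layer S j := by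
  refine ⟨⟨hx, fun hx' => h.2 ?_⟩, ⟨hy, fun hy' => h.2 ?_⟩⟩
  · have := mul_mem_mulPow hx' hy
    rwa [show i + 1 + j + 1 = i + j + 1 + 1 by omega] at this
  · exact mul_mem_mulPow (i := i) (j := j + 1) hx hy'

theorem exists_mul_eq_of_mem_layer {i j : ℕ} {x : S} (hx : x ∈ layer S (i + j + 1)) :
    ∃ y ∈ layer S i, ∃ z ∈ layer S j, y * z = x := by
  obtain ⟨y, hy, z, hz, rfl⟩ := exists_mul_eq_of_mem_mulPow hx.1
  obtain ⟨h1, h2⟩ := layer_of_mul hy hz hx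
  exact ⟨y, h1, z, h2, rfl⟩

/-- Compare v g with y t g', where v and y t both lie in the singleton layer. Then v = y t, so v g =
y (t g); now t g lies in that same layer, hence equals t g'. When the layer is that of the
generators, both products are the square of the only generator. -/
theorem layer_succ_subsingleton {k : ℕ} (h : (layer S k).Subsingleton) :
    (layer S (k + 1)).Subsingleton := by
  intro u hu u' hu'
  obtain ⟨v, hv, g, hg, rfl⟩ := exists_mul_eq_of_mem_layer (i := k) (j := 0) hu
  cases k with
  | zero =>
    obtain ⟨x, hx, y, hy, rfl⟩ := exists_mul_eq_of_mem_layer (i := 0) (j := 0) hu'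
    rw [h hv hx, h hg hy]
  | succ k =>
    have e : k + 1 + 1 = 0 + (k + 1) + 1 := by omega
    rw [e] at hu'
    obtain ⟨y, hy, s, hs, rfl⟩ := exists_mul_eq_of_mem_layer hu'
    obtain ⟨t, ht, g', hg', rfl⟩ := exists_mul_eq_of_mem_layer (i := k) (j := 0) hs
    have hyt : y * t ∈ layer S (k + 1) := by
      have : (y * t) * g' ∈ layer S ((k + 1) + 0 + 1) := by
        rw [mul_assoc]; rwa [show 0 + (k + 1) + 1 = k + 1 + 0 + 1 by omega] at hu'
      refine (layer_of_mul (j := 0) ?_ trivial this).1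
      have := mul_mem_mulPow hy.1 ht.1
      rwa [show 0 + k + 1 = k + 1 by omega] at this
    have hv' : v = y * t := h hv hyt
    subst hv'
    have htg : t * g ∈ layer S (k + 1) := by
      have : y * (t * g) ∈ layer S (0 + (k + 1) + 1) := by
        rw [← mul_assoc]; rwa [show 0 + (k + 1) + 1 = k + 1 + 1 by omega]
      exact (layer_of_mul hy.1 (mul_mem_mulPow ht.1 (j := 0) trivial) this).2
    rw [mul_assoc, h htg hs]

/-- `spow a k` is the power of `a` with exponent `k + 1`. -/
def spow (a : S) : ℕ → S
  | 0 => a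
  | k + 1 => spow a k * a

theorem spow_mul_spow (a : S) (i j : ℕ) : spow a i * spow a j = spow a (i + j + 1) := by
  induction j with
  | zero => rfl
  | succ j ih => rw [spow, ← mul_assoc, ih]; rfl

theorem spow_mem_mulPow (a : S) (k : ℕ) : spow a k ∈ mulPow S k := by
  induction k with
  | zero => trivial
  | succ k ih => exact mem_mulPow_succ.2 ⟨_, ih, a, rfl⟩

/-- Take x1 x2 x3 x4 in layer 3. All its windows of length three equal the unique element of layer
2, so the window can be shifted to the right repeatedly, which rewrites the product as the fourth
power of x4. -/
theorem exists_spow_mem_layer {c : ℕ} (hc : 4 ≤ c) (hne : ∀ k < c, (layer S k).Nonempty)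
    (hsub : ∀ k, 2 ≤ k → (layer S k).Subsingleton) :
    ∃ a : S, ∀ k < c, spow a k ∈ layer S k := by
  obtain ⟨u, hu⟩ := hne 3 (by omega)
  have h2 := hsub 2 le_rfl
  have key : ∀ {x y : S}, x * y ∈ layer S 3 → y ∈ mulPow S 2 → y ∈ layer S 2 :=
    fun {x y} h hy => (layer_of_mul (i := 0) (j := 2) (x := x) trivial hy h).2
  have m3 : ∀ x y z : S, x * (y * z) ∈ mulPow S 2 := fun x y z =>
    mul_mem_mulPow (i := 0) (j := 1) trivial (mul_mem_mulPow (i := 0) (j := 0) trivial trivial)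
  obtain ⟨v, hv, x4, -, rfl⟩ := exists_mul_eq_of_mem_layer (i := 2) (j := 0) hu
  obtain ⟨w, hw, x3, -, rfl⟩ := exists_mul_eq_of_mem_layer (i := 1) (j := 0) hv
  obtain ⟨x1, -, x2, -, rfl⟩ := exists_mul_eq_of_mem_layer (i := 0) (j := 0) hw
  have e1 : x2 * (x3 * x4) = x1 * x2 * x3 :=
    h2 (key (x := x1) (by simpa only [mul_assoc] using hu) (m3 _ _ _)) hv
  have f1 : x1 * x2 * x3 * x4 = x2 * (x3 * (x4 * x4)) := by rw [← e1]; simp only [mul_assoc]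
  have e2 : x3 * (x4 * x4) = x1 * x2 * x3 := h2 (key (x := x2) (f1 ▸ hu) (m3 _ _ _)) hv
  have f2 : x1 * x2 * x3 * x4 = x3 * (x4 * (x4 * x4)) := by rw [← e2]; simp only [mul_assoc]
  have e3 : x4 * (x4 * x4) = x1 * x2 * x3 := h2 (key (x := x3) (f2 ▸ hu) (m3 _ _ _)) hv
  have h3 : spow x4 3 ∈ layer S 3 := by
    have : spow x4 3 = x1 * x2 * x3 * x4 := by rw [← e3]; simp only [spow, mul_assoc]
    rwa [this]
  have hge : ∀ k, k + 3 < c → spow x4 (k + 3) ∈ layer S (k + 3) := by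
    intro k hk
    induction k with
    | zero => exact h3
    | succ k ih =>
      obtain ⟨y, hy⟩ := hne (k + 1 + 3) hk
      obtain ⟨s, hs, g, -, rfl⟩ := exists_mul_eq_of_mem_layer (i := k + 3) (j := 0) hy
      have hs' := hsub (k + 3) (by omega) hs (ih (by omega))
      subst hs'
      -- Splitting off the last three copies of x4 moves the unknown factor g into layer 3, where
      -- uniqueness replaces it by x4.
      have a1 : spow x4 (k + 3) * g = spow x4 k * (spow x4 2 * g) := by
        rw [← mul_assoc, spow_mul_spow]
      have a2 : spow x4 2 * g ∈ layer S 3 := by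
        rw [a1] at hy
        refine (layer_of_mul (i := k) (j := 3) (spow_mem_mulPow _ _) ?_ hy).2
        exact mul_mem_mulPow (i := 2) (j := 0) (spow_mem_mulPow _ _) trivial
      rw [hsub 3 (by omega) a2 h3, spow_mul_spow] at a1
      rw [a1] at hy
      exact hy
  refine ⟨x4, fun k hk => ?_⟩
  by_cases hk3 : 3 ≤ k
  · have := hge (k - 3) (by omega)
    rwa [Nat.sub_add_cancel hk3] at this
  · have : spow x4 k * spow x4 (2 - k) ∈ layer S (k + (2 - k) + 1) := by
      rw [spow_mul_spow]
      rwa [show k + (2 - k) + 1 = 3 by omega]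
    exact (layer_of_mul (spow_mem_mulPow _ _) (spow_mem_mulPow _ _) this).1

end Layers

/-! ### Layer sizes in coclass two, and elements with as many powers as possible. -/

section Nilpotent

variable {S : Type*} [Semigroup S]

theorem exists_zero_of_isNilpotentOfClass {c : ℕ} (h : IsNilpotentOfClass S c) :
    ∃ z : S, mulPow S c = {z} ∧ ∀ k, c ≤ k → mulPow S k = {z} := by
  obtain ⟨z, hz⟩ := Set.ncard_eq_one.1 h.1
  refine ⟨z, hz, fun k hk => ?_⟩
  refine Set.Subset.antisymm (hz ▸ mulPow_antitone hk) ?_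
  obtain ⟨x, hx⟩ : (mulPow S k).Nonempty := ⟨spow z k, spow_mem_mulPow z k⟩
  have : x = z := by
    have := mulPow_antitone hk hx
    rwa [hz] at this
  rw [← this]; simpa using hx

/-- An empty layer makes the chain of powers constant from there on, so a singleton would be reached
before step c. -/
theorem layer_nonempty {c : ℕ} (h : IsNilpotentOfClass S c) {k : ℕ} (hk : k < c) :
    (layer S k).Nonempty := by
  by_contra hne
  rw [Set.not_nonempty_iff_eq_empty, layer, Set.sdiff_eq_empty] at hne
  have e : mulPow S (k + 1) = mulPow S k := Set.Subset.antisymm (mulPow_succ_subset k) hne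
  have e' : ∀ j, mulPow S (k + j) = mulPow S k := by
    intro j
    induction j with
    | zero => rfl
    | succ j ih =>
      have : mulPow S (k + (j + 1)) = mulPow S (k + j) * Set.univ := rfl
      rw [this, ih]; exact e
  have h1 := h.1
  have := e' (c - k)
  rw [Nat.add_sub_cancel' hk.le] at this
  rw [Set.mem_ofPred_eq, this] at h1
  exact absurd (h.2 h1) (by omega)

theorem sum_ncard_layer [Finite S] (k : ℕ) :
    ∑ i ∈ Finset.range k, (layer S i).ncard + (mulPow S k).ncard = Nat.card S := by
  induction k with
  | zero => simp [mulPow, Set.ncard_univ]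
  | succ k ih =>
    rw [Finset.sum_range_succ, ← ih, add_assoc]
    congr 1
    exact Set.ncard_sdiff_add_ncard_of_subset (mulPow_succ_subset k)

theorem layer_subsingleton_of_le {k l : ℕ} (hkl : k ≤ l) (h : (layer S k).Subsingleton) :
    (layer S l).Subsingleton := by
  induction l, hkl using Nat.le_induction with
  | base => exact h
  | succ l _ ih => exact layer_succ_subsingleton ih

/-- The c nonempty layers contain c + 2 elements, a surplus of two. Two elements in layer 2 would
force two in layers 0 and 1 as well, a surplus of three. -/
theorem layer_ncard_of_coclass_two [Finite S] {c : ℕ} (hc : 4 ≤ c) (h : IsNilpotentOfClass S c)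
    (hcard : Nat.card S = c + 3) :
    (∀ k, 2 ≤ k → (layer S k).Subsingleton) ∧
    ((layer S 0).ncard = 3 ∧ (layer S 1).ncard = 1 ∨
      (layer S 0).ncard = 2 ∧ (layer S 1).ncard = 2) := by
  have hsum := sum_ncard_layer (S := S) c
  rw [h.1, hcard] at hsum
  have hpos : ∀ k < c, 1 ≤ (layer S k).ncard := fun k hk =>
    (Set.ncard_pos (Set.toFinite _)).2 (layer_nonempty h hk)
  have hle : ∀ k, (layer S k).ncard ≤ 1 → ∀ l, k ≤ l → (layer S l).ncard ≤ 1 := by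
    intro k hk l hkl
    rw [Set.ncard_le_one_iff_subsingleton] at hk ⊢
    exact layer_subsingleton_of_le hkl hk
  obtain ⟨d, rfl⟩ : ∃ d, c = d + 2 := ⟨c - 2, by omega⟩
  rw [Finset.sum_range_succ', Finset.sum_range_succ'] at hsum
  simp only [zero_add] at hsum
  have hge : d ≤ ∑ i ∈ Finset.range d, (layer S (i + 1 + 1)).ncard := by
    calc d = ∑ i ∈ Finset.range d, 1 := by simp
      _ ≤ _ := Finset.sum_le_sum fun i hi => hpos _ (by simp at hi; omega)
  have hup : ∀ k ≤ 2, (layer S k).ncard ≤ 1 →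
      ∑ i ∈ Finset.range d, (layer S (i + 1 + 1)).ncard ≤ d := by
    intro k hk2 hk
    calc _ ≤ ∑ i ∈ Finset.range d, 1 := Finset.sum_le_sum fun i hi => hle k hk _ (by omega)
      _ = d := by simp
  have h0 := hpos 0 (by omega)
  have h1 := hpos 1 (by omega)
  have h2 : (layer S 2).ncard ≤ 1 := by
    by_contra h2
    by_cases h1' : (layer S 1).ncard ≤ 1
    · exact h2 (hle 1 h1' 2 (by omega))
    · have h0' : ¬ (layer S 0).ncard ≤ 1 := fun h0' => h1' (hle 0 h0' 1 (by omega))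
      have hlt : ∑ i ∈ Finset.range d, 1 < ∑ i ∈ Finset.range d, (layer S (i + 1 + 1)).ncard :=
        Finset.sum_lt_sum (fun i hi => hpos _ (by simp at hi; omega))
          ⟨0, by simp; omega, by change 1 < (layer S 2).ncard; omega⟩
      rw [Finset.sum_const, Finset.card_range, smul_eq_mul, mul_one] at hlt
      omega
  have := hup 2 le_rfl h2
  refine ⟨fun k hk => by
    rw [← Set.ncard_le_one_iff_subsingleton]; exact hle 2 h2 k hk, ?_⟩
  have h00 : (layer S 0).ncard ≤ 1 → (layer S 1).ncard ≤ 1 := fun h => hle 0 h 1 (by omega)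
  omega

/-- Powers of `a`, indexed by their exponent. -/
def epow (a : S) (k : ℕ) : S := spow a (k - 1)

theorem epow_mul (a : S) {i j : ℕ} (hi : 1 ≤ i) (hj : 1 ≤ j) :
    epow a i * epow a j = epow a (i + j) := by
  rw [epow, epow, spow_mul_spow, epow]; congr 1; omega

theorem epow_one (a : S) : epow a 1 = a := rfl

theorem epow_two (a : S) : epow a 2 = a * a := rfl

/-- `a` is an element of a finite nilpotent semigroup of class `m` with as many powers as
possible. -/
structure IsUniserial (a : S) (m : ℕ) : Prop where
  mem : ∀ k < m, spow a k ∈ layer S k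
  out : ∀ k, m ≤ k → mulPow S k = {epow a (m + 1)}

/-- The first m powers lie in different layers and all later ones are zero. Exponent 0 is excluded
because `epow a 0` is a itself. -/
theorem IsUniserial.epow_eq_iff {a : S} {m : ℕ} (h : IsUniserial a m) {i j : ℕ} (hi : 1 ≤ i)
    (hj : 1 ≤ j) : epow a i = epow a j ↔ i = j ∨ (m < i ∧ m < j) := by
  have hz : ∀ k, m < k → epow a k = epow a (m + 1) := fun k hk => by
    have := spow_mem_mulPow a (k - 1)
    rw [h.out (k - 1) (by omega)] at this
    exact this
  have key : ∀ i j, 1 ≤ i → i < j → i ≤ m → epow a i ≠ epow a j := by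
    intro i j hi hij him e
    have h1 := h.mem (i - 1) (by omega)
    have h2 := spow_mem_mulPow a (j - 1)
    apply h1.2
    change epow a i ∈ _
    rw [e]
    exact mulPow_antitone (by omega) h2
  constructor
  · intro e
    by_contra hne
    rcases lt_trichotomy i j with hij | hij | hij
    · exact key i j hi hij (by omega) e
    · omega
    · exact key j i hj hij (by omega) e.symm
  · rintro (rfl | ⟨h1, h2⟩)
    · rfl
    · rw [hz i h1, hz j h2]

theorem IsUniserial.mem_mulPow {a : S} {m : ℕ} (h : IsUniserial a m) {k : ℕ}
    (hsub : ∀ l, k ≤ l → (layer S l).Subsingleton) {x : S} (hx : x ∈ mulPow S k) :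
    ∃ j, k + 1 ≤ j ∧ x = epow a j := by
  -- Depth m + k is used instead of m so that the exponent m + k + 1 naming the zero also satisfies
  -- the required lower bound.
  by_cases hxm : x ∈ mulPow S (m + k)
  · rw [h.out _ (by omega)] at hxm
    refine ⟨m + k + 1, by omega, ?_⟩
    rw [Set.mem_singleton_iff.1 hxm, h.epow_eq_iff (by omega) (by omega)]
    omega
  · classical
    have hex : ∃ l, x ∉ mulPow S l := ⟨_, hxm⟩
    have hl := Nat.find_spec hex
    have hmin := fun l => Nat.find_min (m := l) hex
    set l := Nat.find hex
    have hkl : k < l := by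
      by_contra hlt
      exact hl (mulPow_antitone (by omega) hx)
    have hx' : x ∈ layer S (l - 1) := by
      refine ⟨not_not.1 (hmin (l - 1) (by omega)), ?_⟩
      rwa [show l - 1 + 1 = l by omega]
    have hlm : l - 1 < m := by
      by_contra hlm
      apply hl
      have h1 := hx'.1
      rw [h.out _ (by omega)] at h1 ⊢
      exact h1
    exact ⟨l, by omega, hsub (l - 1) (by omega) hx' (h.mem _ hlm)⟩

theorem exists_isUniserial {c : ℕ} (hc : 4 ≤ c) (h : IsNilpotentOfClass S c)
    (hsub : ∀ k, 2 ≤ k → (layer S k).Subsingleton) : ∃ a : S, IsUniserial a c := by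
  obtain ⟨a, ha⟩ := exists_spow_mem_layer hc (fun k hk => layer_nonempty h hk) hsub
  obtain ⟨z, -, hz⟩ := exists_zero_of_isNilpotentOfClass h
  refine ⟨a, ha, fun k hk => ?_⟩
  have : epow a (c + 1) ∈ mulPow S c := spow_mem_mulPow a c
  rw [hz c le_rfl] at this
  rw [hz k hk, Set.mem_singleton_iff.1 this]

end Nilpotent

/-! ### Semigroups given by multiplication tables on labels and capped exponents. -/

section Table

/-- Two exponents agree if they are equal or if both exceed `m`. -/
def CapEq (m i j : ℕ) : Prop := i = j ∨ (m < i ∧ m < j)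

/-- Agreement of formal products, each of which is a label or an exponent. -/
def Agree (m : ℕ) : Fin 3 ⊕ ℕ → Fin 3 ⊕ ℕ → Prop
  | .inl x, .inl y => x = y
  | .inr i, .inr j => CapEq m i j
  | _, _ => False

/-- Multiplication table of a semigroup consisting of three labelled elements and of powers with
exponents between `2` and `m + 1`, the last one being the zero. -/
structure Tab (m : ℕ) where
  hm : 4 ≤ m
  mu : Fin 3 → Fin 3 → Fin 3 ⊕ ℕ
  l : Fin 3 → ℕ
  r : Fin 3 → ℕ
  two_le : ∀ x y k, mu x y = .inr k → 2 ≤ k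
  assoc : ∀ x y z, Agree m ((mu x y).elim (fun c => mu c z) (fun k => .inr (k + l z)))
    ((mu y z).elim (fun c => mu x c) (fun k => .inr (r x + k)))
  mul_l : ∀ x y, CapEq m (2 + (mu x y).elim l id) (2 + (l x + l y))
  mul_r : ∀ x y, CapEq m ((mu x y).elim r id + 2) (r x + r y + 2)
  lr : ∀ x, CapEq m (l x + 4) (r x + 4)

variable {m : ℕ}

/-- The semigroup with a given multiplication table. -/
def Tab.Mod (_ : Tab m) : Type := Fin 3 ⊕ Fin m

namespace Tab

variable (T : Tab m)

/-- The labelled elements. -/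
def gen (x : Fin 3) : T.Mod := .inl x

/-- The powers. -/
def pw (k : ℕ) : T.Mod := .inr ⟨min (k - 2) (m - 1), by have := T.hm; omega⟩

/-- Evaluation of formal products. -/
def ev (s : Fin 3 ⊕ ℕ) : T.Mod := s.elim T.gen T.pw

instance : Mul T.Mod where
  mul s t := Sum.elim
    (fun x => Sum.elim (fun y => T.ev (T.mu x y)) (fun j => T.pw (T.r x + (j.1 + 2))) t)
    (fun i => Sum.elim (fun y => T.pw (i.1 + 2 + T.l y)) (fun j => T.pw (i.1 + 2 + (j.1 + 2))) t) s

theorem pw_eq_iff {i j : ℕ} (hi : 2 ≤ i) (hj : 2 ≤ j) : T.pw i = T.pw j ↔ CapEq m i j := by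
  have := T.hm
  have e : T.pw i = T.pw j ↔ min (i - 2) (m - 1) = min (j - 2) (m - 1) :=
    ⟨fun h => Fin.mk.inj (Sum.inr.inj h), fun h => by simp only [pw, h]; rfl⟩
  rw [e]
  unfold CapEq
  omega

theorem pw_congr {i j : ℕ} (h : CapEq m i j) : T.pw i = T.pw j := by
  have e : min (i - 2) (m - 1) = min (j - 2) (m - 1) := by
    unfold CapEq at h
    omega
  simp only [pw, e]
  rfl

theorem gen_ne_pw (x : Fin 3) (k : ℕ) : T.gen x ≠ T.pw k := Sum.inl_ne_inr

theorem gen_injective : Function.Injective T.gen := fun _ _ h => Sum.inl.inj h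

theorem gen_mul_gen (x y : Fin 3) : T.gen x * T.gen y = T.ev (T.mu x y) := rfl

theorem pw_mul_gen {k : ℕ} (hk : 2 ≤ k) (x : Fin 3) : T.pw k * T.gen x = T.pw (k + T.l x) := by
  have := T.hm
  change T.pw (min (k - 2) (m - 1) + 2 + T.l x) = _
  apply T.pw_congr
  unfold CapEq
  omega

theorem gen_mul_pw {k : ℕ} (hk : 2 ≤ k) (x : Fin 3) : T.gen x * T.pw k = T.pw (T.r x + k) := by
  have := T.hm
  change T.pw (T.r x + (min (k - 2) (m - 1) + 2)) = _
  apply T.pw_congr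
  unfold CapEq
  omega

theorem pw_mul_pw {k j : ℕ} (hk : 2 ≤ k) (hj : 2 ≤ j) : T.pw k * T.pw j = T.pw (k + j) := by
  have := T.hm
  change T.pw (min (k - 2) (m - 1) + 2 + (min (j - 2) (m - 1) + 2)) = _
  apply T.pw_congr
  unfold CapEq
  omega

theorem cases (s : T.Mod) : (∃ x, s = T.gen x) ∨ ∃ k, 2 ≤ k ∧ k ≤ m + 1 ∧ s = T.pw k := by
  have := T.hm
  rcases s with x | i
  · exact .inl ⟨x, rfl⟩
  · refine .inr ⟨i.1 + 2, by omega, by omega, ?_⟩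
    unfold pw
    congr 1
    ext
    change i.1 = min (i.1 + 2 - 2) (m - 1)
    omega

theorem ev_agree {s t : Fin 3 ⊕ ℕ} (h : Agree m s t) : T.ev s = T.ev t := by
  rcases s with x | i <;> rcases t with y | j <;> simp only [Agree] at h
  · rw [h]
  · exact T.pw_congr h

/-- `mul_l` and `mul_r` handle two labels next to a power, `lr` a label between two powers. It is
enough to impose them at exponent 2, since `CapEq` survives adding a constant to both sides. -/
theorem mul_assoc' (s t u : T.Mod) : s * t * u = s * (t * u) := by
  rcases T.cases s with ⟨x, rfl⟩ | ⟨i, hi, -, rfl⟩ <;>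
  rcases T.cases t with ⟨y, rfl⟩ | ⟨j, hj, -, rfl⟩ <;>
  rcases T.cases u with ⟨z, rfl⟩ | ⟨k, hk, -, rfl⟩
  · rw [gen_mul_gen, gen_mul_gen]
    have h := T.ev_agree (T.assoc x y z)
    have h1 := T.two_le x y
    have h2 := T.two_le y z
    revert h
    generalize T.mu x y = a at h1 ⊢
    generalize T.mu y z = b at h2 ⊢
    intro h
    have ha : T.ev a * T.gen z = T.ev (a.elim (fun c => T.mu c z) (fun k => .inr (k + T.l z))) := by
      rcases a with c | k
      · exact T.gen_mul_gen c z
      · exact T.pw_mul_gen (h1 k rfl) z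
    have hb : T.gen x * T.ev b = T.ev (b.elim (fun c => T.mu x c) (fun k => .inr (T.r x + k))) := by
      rcases b with c | k
      · exact T.gen_mul_gen x c
      · exact T.gen_mul_pw (h2 k rfl) x
    rw [ha, hb, h]
  · rw [gen_mul_gen, T.gen_mul_pw hk, T.gen_mul_pw (by omega)]
    have h := T.mul_r x y
    have h1 := T.two_le x y
    rcases e : T.mu x y with c | k'
    · rw [e] at h
      change T.gen c * _ = _
      rw [T.gen_mul_pw hk]
      apply T.pw_congr
      unfold CapEq at *
      simp at h
      omega
    · rw [e] at h
      change T.pw k' * _ = _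
      rw [T.pw_mul_pw (h1 k' e) hk]
      apply T.pw_congr
      unfold CapEq at *
      simp at h
      omega
  · rw [T.gen_mul_pw hj, T.pw_mul_gen (by omega), T.pw_mul_gen hj, T.gen_mul_pw (by omega), add_assoc]
  · rw [T.gen_mul_pw hj, T.pw_mul_pw (by omega) hk, T.pw_mul_pw hj hk, T.gen_mul_pw (by omega),
      add_assoc]
  · rw [gen_mul_gen, T.pw_mul_gen hi, T.pw_mul_gen (by omega)]
    have h := T.mul_l y z
    have h1 := T.two_le y z
    rcases e : T.mu y z with c | k'
    · rw [e] at h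
      change _ = _ * T.gen c
      rw [T.pw_mul_gen hi]
      apply T.pw_congr
      unfold CapEq at *
      simp at h
      omega
    · rw [e] at h
      change _ = _ * T.pw k'
      rw [T.pw_mul_pw hi (h1 k' e)]
      apply T.pw_congr
      unfold CapEq at *
      simp at h
      omega
  · rw [T.pw_mul_gen hi, T.pw_mul_pw (by omega) hk, T.gen_mul_pw hk, T.pw_mul_pw hi (by omega)]
    have h := T.lr y
    apply T.pw_congr
    unfold CapEq at *
    omega
  · rw [T.pw_mul_pw hi hj, T.pw_mul_gen (by omega), T.pw_mul_gen hj, T.pw_mul_pw hi (by omega),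
      add_assoc]
  · rw [T.pw_mul_pw hi hj, T.pw_mul_pw (by omega) hk, T.pw_mul_pw hj hk, T.pw_mul_pw hi (by omega),
      add_assoc]

instance : Semigroup T.Mod where
  mul_assoc := T.mul_assoc'

instance : Finite T.Mod := inferInstanceAs (Finite (Fin 3 ⊕ Fin m))

theorem card_mod : Nat.card T.Mod = m + 3 := by
  change Nat.card (Fin 3 ⊕ Fin m) = _
  simp [add_comm]

/-- Here d is the depth of a label: 1 for a generator, 2 for an extra product. Each further factor
increases the depth by at least one. -/
theorem mulPow_subset (d : Fin 3 → ℕ) (hd : ∀ x, 1 ≤ d x ∧ d x ≤ 2)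
    (hmu : ∀ x y, d x + 1 ≤ (T.mu x y).elim d id) (hl : ∀ x, 1 ≤ T.l x) (hr : ∀ x, 1 ≤ T.r x)
    (k : ℕ) : ∀ s ∈ mulPow T.Mod k, (∃ x, s = T.gen x ∧ k + 1 ≤ d x) ∨
      ∃ j, 2 ≤ j ∧ k + 1 ≤ j ∧ s = T.pw j := by
  induction k with
  | zero =>
    intro s _
    rcases T.cases s with ⟨x, rfl⟩ | ⟨j, hj, -, rfl⟩
    · exact .inl ⟨x, rfl, (hd x).1⟩
    · exact .inr ⟨j, hj, by omega, rfl⟩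
  | succ k ih =>
    intro s hs
    obtain ⟨y, hy, g, rfl⟩ := mem_mulPow_succ.1 hs
    rcases ih y hy with ⟨x, rfl, hx⟩ | ⟨j, hj, hkj, rfl⟩ <;>
    rcases T.cases g with ⟨z, rfl⟩ | ⟨i, hi, -, rfl⟩
    · rw [gen_mul_gen]
      have h := hmu x z
      have h2 := T.two_le x z
      rcases e : T.mu x z with c | i
      · rw [e] at h
        simp at h
        exact .inl ⟨c, rfl, by omega⟩
      · rw [e] at h
        simp at h
        exact .inr ⟨i, h2 i e, by omega, rfl⟩
    · rw [T.gen_mul_pw hi]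
      have := hr x
      have := hd x
      exact .inr ⟨_, by omega, by omega, rfl⟩
    · rw [T.pw_mul_gen hj]
      have := hl z
      exact .inr ⟨_, by omega, by omega, rfl⟩
    · rw [T.pw_mul_pw hj hi]
      exact .inr ⟨_, by omega, by omega, rfl⟩

theorem pw_mem_mulPow {i : Fin 3} (hi : T.mu i i = .inr 2) (hli : T.l i = 1) (k : ℕ) :
    T.pw (k + 2) ∈ mulPow T.Mod (k + 1) := by
  induction k with
  | zero =>
    have : T.pw 2 = T.gen i * T.gen i := by rw [gen_mul_gen, hi]; rfl
    rw [this]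
    exact mul_mem_mulPow (i := 0) (j := 0) trivial trivial
  | succ k ih =>
    refine mem_mulPow_succ.2 ⟨_, ih, T.gen i, ?_⟩
    rw [T.pw_mul_gen (by omega), hli]

/-- The depth bound leaves only the zero among products of m + 1 elements, while the powers of the
generator i reach exponent m, which is not yet zero; so the class is m. -/
theorem hasCoclass (d : Fin 3 → ℕ) (hd : ∀ x, 1 ≤ d x ∧ d x ≤ 2)
    (hmu : ∀ x y, d x + 1 ≤ (T.mu x y).elim d id) (hl : ∀ x, 1 ≤ T.l x) (hr : ∀ x, 1 ≤ T.r x)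
    {i : Fin 3} (hi : T.mu i i = .inr 2) (hli : T.l i = 1) : HasCoclass T.Mod 2 := by
  have hm := T.hm
  refine ⟨inferInstance, m, ⟨?_, ?_⟩, by rw [T.card_mod]; omega⟩
  · have : mulPow T.Mod m = {T.pw (m + 1)} := by
      refine Set.Subset.antisymm ?_ ?_
      · intro s hs
        rcases T.mulPow_subset d hd hmu hl hr m s hs with ⟨x, -, hx⟩ | ⟨j, hj, hkj, rfl⟩
        · have := hd x; omega
        · exact (T.pw_eq_iff (by omega) (by omega)).2 (.inr ⟨by omega, by omega⟩)
      · have := T.pw_mem_mulPow hi hli (m - 1)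
        rw [show m - 1 + 2 = m + 1 by omega, show m - 1 + 1 = m by omega] at this
        simpa using this
    rw [Set.mem_ofPred_eq, this, Set.ncard_singleton]
  · intro k hk
    by_contra hkm
    obtain ⟨z, hz⟩ := Set.ncard_eq_one.1 hk
    have h1 := mulPow_antitone (show k ≤ m - 2 + 1 by omega) (T.pw_mem_mulPow hi hli (m - 2))
    have h2 := mulPow_antitone (show k ≤ m - 1 + 1 by omega) (T.pw_mem_mulPow hi hli (m - 1))
    rw [hz] at h1 h2
    have := h1.trans h2.symm
    rw [T.pw_eq_iff (by omega) (by omega)] at this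
    unfold CapEq at this
    omega

/-- Equal cardinalities turn surjectivity into bijectivity, so no injectivity check is needed. The
family E need not be the images of powers chosen in advance, which allows `E 2` to be a labelled
element of the target. -/
theorem equivOf {S : Type*} [Semigroup S] (hcard : Nat.card S = m + 3)
    (θ : Fin 3 → S) (E : ℕ → S)
    (hE : ∀ i j, 2 ≤ i → 2 ≤ j → E i * E j = E (i + j))
    (hcap : ∀ i j, CapEq m i j → E i = E j)
    (hmu : ∀ x y, θ x * θ y = (T.mu x y).elim θ E)
    (hl : ∀ k x, 2 ≤ k → E k * θ x = E (k + T.l x))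
    (hr : ∀ k x, 2 ≤ k → θ x * E k = E (T.r x + k))
    (hsurj : ∀ s, (∃ x, s = θ x) ∨ ∃ k, 2 ≤ k ∧ s = E k) : Nonempty (T.Mod ≃* S) := by
  have hm := T.hm
  let f : T.Mod → S := fun s => Sum.elim θ (fun i => E (i.1 + 2)) s
  have fgen : ∀ x, f (T.gen x) = θ x := fun _ => rfl
  have fpw : ∀ k, 2 ≤ k → f (T.pw k) = E k := by
    intro k hk
    change E (min (k - 2) (m - 1) + 2) = _
    apply hcap
    unfold CapEq
    omega
  have fev : ∀ x y, f (T.ev (T.mu x y)) = (T.mu x y).elim θ E := by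
    intro x y
    have h2 := T.two_le x y
    rcases e : T.mu x y with c | k
    · rfl
    · exact fpw k (h2 k e)
  have fsurj : Function.Surjective f := by
    intro s
    rcases hsurj s with ⟨x, rfl⟩ | ⟨k, hk, rfl⟩
    · exact ⟨_, fgen x⟩
    · exact ⟨_, fpw k hk⟩
  have : Finite S := Finite.of_surjective f fsurj
  have fbij : Function.Bijective f :=
    (Nat.bijective_iff_surjective_and_card f).2 ⟨fsurj, by rw [card_mod, hcard]⟩
  refine ⟨MulEquiv.ofBijective (⟨f, ?_⟩ : T.Mod →ₙ* S) fbij⟩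
  intro s t
  rcases T.cases s with ⟨x, rfl⟩ | ⟨i, hi, -, rfl⟩ <;>
  rcases T.cases t with ⟨y, rfl⟩ | ⟨j, hj, -, rfl⟩
  · rw [gen_mul_gen, fev, fgen, fgen, hmu]
  · rw [T.gen_mul_pw hj, fgen, fpw _ hj, fpw _ (by omega), hr _ _ hj]
  · rw [T.pw_mul_gen hi, fgen, fpw _ hi, fpw _ (by omega), hl _ _ hi]
  · rw [T.pw_mul_pw hi hj, fpw _ hi, fpw _ hj, fpw _ (by omega), hE _ _ hi hj]

/-- The description starts at cubes because the square of the image generator may be a labelled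
element instead of a power. -/
theorem map_pw {T T' : Tab m} (φ : T.Mod ≃* T'.Mod) {i j : Fin 3} (hi : T.mu i i = .inr 2)
    (hli : T.l i = 1) (h : φ (T.gen i) = T'.gen j) {g : ℕ} (hg : 2 ≤ g)
    (hj : T'.gen j * T'.gen j * T'.gen j = T'.pw g) (k : ℕ) (hk : 3 ≤ k) :
    φ (T.pw k) = T'.pw (g + (k - 3) * T'.l j) := by
  induction k, hk using Nat.le_induction with
  | base =>
    have e : T.pw 3 = T.gen i * T.gen i * T.gen i := by
      rw [gen_mul_gen, hi]
      change _ = T.pw 2 * _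
      rw [T.pw_mul_gen le_rfl, hli]
    rw [e, map_mul, map_mul, h, hj]
    simp
  | succ k hk ih =>
    have e : T.pw (k + 1) = T.pw k * T.gen i := by rw [T.pw_mul_gen (by omega), hli]
    rw [e, map_mul, ih, h, T'.pw_mul_gen (by omega)]
    congr 1
    rw [show k + 1 - 3 = (k - 3) + 1 by omega]
    ring

/-- The powers with exponents m and m + 1 are distinct, so the image of the former cannot be zero.
This is what forces the image of a generator of weight 1 to have small weight. -/
theorem map_pw_bound {T T' : Tab m} (φ : T.Mod ≃* T'.Mod) {i j : Fin 3} (hi : T.mu i i = .inr 2)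
    (hli : T.l i = 1) (h : φ (T.gen i) = T'.gen j) {g : ℕ} (hg : 2 ≤ g)
    (hj : T'.gen j * T'.gen j * T'.gen j = T'.pw g) : g + (m - 3) * T'.l j ≤ m := by
  have hm := T.hm
  by_contra hlt
  have h1 := map_pw φ hi hli h hg hj m (by omega)
  have h2 := map_pw φ hi hli h hg hj (m + 1) (by omega)
  have h3 : (m - 3) * T'.l j ≤ (m + 1 - 3) * T'.l j := Nat.mul_le_mul_right _ (by omega)
  have := h1.trans (((T'.pw_eq_iff (by omega) (by omega)).2
    (.inr ⟨by omega, by omega⟩)).trans h2.symm)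
  have := φ.injective this
  rw [T.pw_eq_iff (by omega) (by omega)] at this
  unfold CapEq at this
  omega

end Tab

end Table

/-! ### Models with three generators and their isomorphisms. -/

section ThreeGenerators

namespace Tab

theorem pw_eq_mul {m : ℕ} (T : Tab m) {i : Fin 3} (hi : T.mu i i = .inr 2) (hli : T.l i = 1)
    {k : ℕ} (hk : 2 ≤ k) : ∃ s t, s * t = T.pw k := by
  induction k, hk using Nat.le_induction with
  | base => exact ⟨T.gen i, T.gen i, by rw [gen_mul_gen, hi]; rfl⟩
  | succ k hk _ => exact ⟨T.pw k, T.gen i, by rw [T.pw_mul_gen hk, hli]⟩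

end Tab

/-- The exponent of the product of two generators of weights `i` and `j`; if `m ≤ i + j`, the
product may be `m` or `m + 1`, as chosen by `e`. -/
def expo (m i j : ℕ) (e : Bool) : ℕ := if i + j < m then i + j else if e then m + 1 else m

theorem expo_cases (m i j : ℕ) (e : Bool) :
    (i + j < m ∧ expo m i j e = i + j) ∨ (m ≤ i + j ∧ e = true ∧ expo m i j e = m + 1) ∨
      (m ≤ i + j ∧ e = false ∧ expo m i j e = m) := by
  unfold expo
  cases e <;> simp <;> omega

/-- The semigroup with three generators whose weights are given by `w`. -/
def tab₁ {m : ℕ} (hm : 4 ≤ m) (w : Fin 3 → ℕ) (hw : ∀ x, 1 ≤ w x) (e : Fin 3 → Fin 3 → Bool) :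
    Tab m where
  hm := hm
  mu x y := .inr (expo m (w x) (w y) (e x y))
  l := w
  r := w
  two_le x y k h := by
    have := Sum.inr.inj h
    have := hw x
    have := hw y
    have := expo_cases m (w x) (w y) (e x y)
    omega
  assoc x y z := by
    have := hw x
    have := hw y
    have := hw z
    have := expo_cases m (w x) (w y) (e x y)
    have := expo_cases m (w y) (w z) (e y z)
    simp only [Sum.elim_inr, Agree, CapEq]
    omega
  mul_l x y := by
    have := hw x
    have := hw y
    have := expo_cases m (w x) (w y) (e x y)
    simp only [Sum.elim_inr, CapEq, id]
    omega
  mul_r x y := by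
    have := hw x
    have := hw y
    have := expo_cases m (w x) (w y) (e x y)
    simp only [Sum.elim_inr, CapEq, id]
    omega
  lr x := .inl rfl

variable {m : ℕ} (hm : 4 ≤ m)

theorem tab₁_mu_self {w : Fin 3 → ℕ} (hw : ∀ x, 1 ≤ w x) (e : Fin 3 → Fin 3 → Bool) {i : Fin 3}
    (hi : w i = 1) : (tab₁ hm w hw e).mu i i = .inr 2 := by
  have := expo_cases m (w i) (w i) (e i i)
  change Sum.inr _ = _
  congr 1
  omega

theorem hasCoclass_tab₁ {w : Fin 3 → ℕ} (hw : ∀ x, 1 ≤ w x) (e : Fin 3 → Fin 3 → Bool) {i : Fin 3}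
    (hi : w i = 1) : HasCoclass (tab₁ hm w hw e).Mod 2 := by
  refine (tab₁ hm w hw e).hasCoclass (fun _ => 1) (fun _ => by omega) (fun x y => ?_) hw hw
    (tab₁_mu_self hm hw e hi) hi
  have := expo_cases m (w x) (w y) (e x y)
  have := hw x
  have := hw y
  change 1 + 1 ≤ expo m (w x) (w y) (e x y)
  omega

theorem tab₁_perm (w : Fin 3 → ℕ) (hw : ∀ x, 1 ≤ w x) (e : Fin 3 → Fin 3 → Bool)
    (σ : Equiv.Perm (Fin 3)) :
    AreIso (tab₁ hm (w ∘ σ) (fun x => hw (σ x)) (fun x y => e (σ x) (σ y))).Mod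
      (tab₁ hm w hw e).Mod := by
  set T := tab₁ hm w hw e
  refine Tab.equivOf _ T.card_mod (fun x => T.gen (σ x)) T.pw
    (fun i j hi hj => T.pw_mul_pw hi hj) (fun i j h => T.pw_congr h) (fun x y => ?_)
    (fun k x hk => T.pw_mul_gen hk _) (fun k x hk => T.gen_mul_pw hk _) (fun s => ?_)
  · rw [T.gen_mul_gen]
    rfl
  · rcases T.cases s with ⟨x, rfl⟩ | ⟨k, hk, -, rfl⟩
    · exact .inl ⟨σ.symm x, by simp⟩
    · exact .inr ⟨k, hk, rfl⟩

theorem tab₁_op (w : Fin 3 → ℕ) (hw : ∀ x, 1 ≤ w x) (e : Fin 3 → Fin 3 → Bool) :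
    AreAntiIso (tab₁ hm w hw (fun x y => e y x)).Mod (tab₁ hm w hw e).Mod := by
  set T := tab₁ hm w hw e
  refine Tab.equivOf _ ?_ (fun x => MulOpposite.op (T.gen x)) (fun k => MulOpposite.op (T.pw k))
    (fun i j hi hj => ?_) (fun i j h => by simp only [T.pw_congr h]) (fun x y => ?_)
    (fun k x hk => ?_) (fun k x hk => ?_) (fun s => ?_)
  · rw [← Nat.card_congr MulOpposite.opEquiv, T.card_mod]
  · rw [← MulOpposite.op_mul, T.pw_mul_pw hj hi, add_comm]
  · rw [← MulOpposite.op_mul, T.gen_mul_gen]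
    change MulOpposite.op (T.pw _) = MulOpposite.op (T.pw _)
    simp only [expo, add_comm]
  · rw [← MulOpposite.op_mul, T.gen_mul_pw hk, add_comm]
    rfl
  · rw [← MulOpposite.op_mul, T.pw_mul_gen hk, add_comm]
    rfl
  · rcases T.cases s.unop with ⟨x, hx⟩ | ⟨k, hk, -, hx⟩
    · exact .inl ⟨x, by rw [← hx, MulOpposite.op_unop]⟩
    · exact .inr ⟨k, hk, by rw [← hx, MulOpposite.op_unop]⟩

theorem tab₁_mul_comm_iff (w : Fin 3 → ℕ) (hw : ∀ x, 1 ≤ w x) (e : Fin 3 → Fin 3 → Bool) :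
    (∀ s t : (tab₁ hm w hw e).Mod, s * t = t * s) ↔
      ∀ x y, m ≤ w x + w y → e x y = e y x := by
  set T := tab₁ hm w hw e
  have key : ∀ x y, T.gen x * T.gen y = T.gen y * T.gen x ↔ (m ≤ w x + w y → e x y = e y x) := by
    intro x y
    rw [T.gen_mul_gen, T.gen_mul_gen]
    change T.pw (expo m (w x) (w y) (e x y)) = T.pw (expo m (w y) (w x) (e y x)) ↔ _
    have := hw x
    have := hw y
    have h1 := expo_cases m (w x) (w y) (e x y)
    have h2 := expo_cases m (w y) (w x) (e y x)
    constructor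
    · intro h hxy
      rw [T.pw_eq_iff (by omega) (by omega)] at h
      unfold CapEq at h
      rcases h1 with h1 | h1 | h1 <;> rcases h2 with h2 | h2 | h2 <;>
        first | omega | rw [h1.2.1, h2.2.1]
    · intro h
      by_cases hxy : m ≤ w x + w y
      · rw [h hxy, expo, expo, add_comm]
      · apply T.pw_congr
        unfold CapEq
        omega
  refine ⟨fun h x y => (key x y).1 (h _ _), fun h s t => ?_⟩
  rcases T.cases s with ⟨x, rfl⟩ | ⟨i, hi, -, rfl⟩ <;>
  rcases T.cases t with ⟨y, rfl⟩ | ⟨j, hj, -, rfl⟩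
  · exact (key x y).2 (h x y)
  · rw [T.gen_mul_pw hj, T.pw_mul_gen hj, add_comm]; rfl
  · rw [T.gen_mul_pw hi, T.pw_mul_gen hi, add_comm]; rfl
  · rw [T.pw_mul_pw hi hj, T.pw_mul_pw hj hi, add_comm]

theorem tab₁_gen_ne_mul (w : Fin 3 → ℕ) (hw : ∀ x, 1 ≤ w x) (e : Fin 3 → Fin 3 → Bool) (x : Fin 3) :
    ∀ s t : (tab₁ hm w hw e).Mod, s * t ≠ (tab₁ hm w hw e).gen x := by
  set T := tab₁ hm w hw e
  intro s t
  rcases T.cases s with ⟨x, rfl⟩ | ⟨i, hi, -, rfl⟩ <;>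
  rcases T.cases t with ⟨y, rfl⟩ | ⟨j, hj, -, rfl⟩
  · exact (T.gen_ne_pw _ _).symm
  · rw [T.gen_mul_pw hj]; exact (T.gen_ne_pw _ _).symm
  · rw [T.pw_mul_gen hi]; exact (T.gen_ne_pw _ _).symm
  · rw [T.pw_mul_pw hi hj]; exact (T.gen_ne_pw _ _).symm

/-- The generators are the non-products, hence are permuted. By `map_pw_bound` the image of a
generator of weight 1 has weight 1, so every power is fixed; the action on a^2 then recovers the
weights, provided they are below m, and the products of generators recover the free bits. -/
theorem tab₁_iso {w w' : Fin 3 → ℕ} {hw : ∀ x, 1 ≤ w x} {hw' : ∀ x, 1 ≤ w' x}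
    {e e' : Fin 3 → Fin 3 → Bool} (hwm : ∀ x, w x < m) (hwm' : ∀ x, w' x < m) {i i' : Fin 3}
    (hi : w i = 1) (hi' : w' i' = 1)
    (h : AreIso (tab₁ hm w hw e).Mod (tab₁ hm w' hw' e').Mod) :
    ∃ σ : Equiv.Perm (Fin 3), (∀ x, w' (σ x) = w x) ∧
      ∀ x y, m ≤ w x + w y → e x y = e' (σ x) (σ y) := by
  obtain ⟨φ⟩ := h
  set T := tab₁ hm w hw e
  set T' := tab₁ hm w' hw' e'
  have hgen : ∀ x, ∃ y, φ (T.gen x) = T'.gen y := by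
    intro x
    rcases T'.cases (φ (T.gen x)) with h | ⟨k, hk, -, hx⟩
    · exact h
    · obtain ⟨s, t, hst⟩ := T'.pw_eq_mul (tab₁_mu_self hm hw' e' hi') hi' hk
      exfalso
      apply tab₁_gen_ne_mul hm w hw e x (φ.symm s) (φ.symm t)
      rw [← map_mul, hst, ← hx, φ.symm_apply_apply]
  choose f hf using hgen
  have finj : Function.Injective f := fun x y h => by
    apply T.gen_injective
    apply φ.injective
    rw [hf, hf, h]
  let σ := Equiv.ofBijective f (Finite.injective_iff_bijective.1 finj)
  have hσ : ∀ x, φ (T.gen x) = T'.gen (σ x) := hf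
  have ex := expo_cases m (w' (σ i)) (w' (σ i)) (e' (σ i) (σ i))
  have hwi := hw' (σ i)
  have cube : T'.gen (σ i) * T'.gen (σ i) * T'.gen (σ i) =
      T'.pw (expo m (w' (σ i)) (w' (σ i)) (e' (σ i) (σ i)) + w' (σ i)) := by
    rw [T'.gen_mul_gen]
    exact T'.pw_mul_gen (by omega) _
  have hb := Tab.map_pw_bound φ (tab₁_mu_self hm hw e hi) hi (hσ i) (by omega) cube
  change _ + (m - 3) * w' (σ i) ≤ m at hb
  have h1 : w' (σ i) = 1 := by
    by_contra hne
    have : (m - 3) * 2 ≤ (m - 3) * w' (σ i) := Nat.mul_le_mul_left _ (by omega)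
    omega
  have p2 : φ (T.pw 2) = T'.pw 2 := by
    have e1 : T.pw 2 = T.gen i * T.gen i := by
      rw [T.gen_mul_gen, tab₁_mu_self hm hw e hi]; rfl
    have e2 : T'.pw 2 = T'.gen (σ i) * T'.gen (σ i) := by
      rw [T'.gen_mul_gen, tab₁_mu_self hm hw' e' h1]; rfl
    rw [e1, map_mul, hσ, e2]
  have pk : ∀ k, 2 ≤ k → φ (T.pw k) = T'.pw k := by
    intro k hk
    by_cases hk2 : k = 2
    · rw [hk2, p2]
    · have := Tab.map_pw φ (tab₁_mu_self hm hw e hi) hi (hσ i) (by omega) cube k (by omega)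
      rw [this]
      congr 1
      change _ + (k - 3) * w' (σ i) = k
      have ex' := expo_cases m 1 1 (e' (σ i) (σ i))
      rw [h1, mul_one]
      omega
  have hww : ∀ x, w' (σ x) = w x := by
    intro x
    have a1 : φ (T.pw 2 * T.gen x) = T'.pw 2 * T'.gen (σ x) := by rw [map_mul, p2, hσ]
    rw [T.pw_mul_gen le_rfl, T'.pw_mul_gen le_rfl, pk _ (by omega),
      T'.pw_eq_iff (by omega) (by omega)] at a1
    change CapEq m (2 + w x) (2 + w' (σ x)) at a1
    have := hwm x
    have := hwm' (σ x)
    unfold CapEq at a1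
    omega
  refine ⟨σ, hww, fun x y hxy => ?_⟩
  have a1 : φ (T.gen x * T.gen y) = T'.gen (σ x) * T'.gen (σ y) := by rw [map_mul, hσ, hσ]
  rw [T.gen_mul_gen, T'.gen_mul_gen] at a1
  change φ (T.pw (expo m (w x) (w y) (e x y))) =
    T'.pw (expo m (w' (σ x)) (w' (σ y)) (e' (σ x) (σ y))) at a1
  rw [hww, hww] at a1
  have h1 := expo_cases m (w x) (w y) (e x y)
  have h2 := expo_cases m (w x) (w y) (e' (σ x) (σ y))
  have := hw x
  have := hw y
  rw [pk _ (by omega), T'.pw_eq_iff (by omega) (by omega)] at a1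
  unfold CapEq at a1
  rcases h1 with h1 | h1 | h1 <;> rcases h2 with h2 | h2 | h2 <;>
    first | omega | rw [h1.2.1, h2.2.1]

end ThreeGenerators

/-! ### Every semigroup with three generators is one of the models. -/

section ThreeGeneratorsExtraction

variable {S : Type*} [Semigroup S] {m : ℕ}

/-- Computing a x a in two ways shows that ax and xa agree after one more multiplication by a, so
left and right action on a^2 and beyond have a common weight. -/
theorem IsUniserial.exists_weight {a : S} (h : IsUniserial a m) (hm : 4 ≤ m)
    (hsub : ∀ l, 1 ≤ l → (layer S l).Subsingleton) (x : S) :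
    ∃ w, 1 ≤ w ∧ w < m ∧ (∀ k, 2 ≤ k → epow a k * x = epow a (k + w)) ∧
      (∀ k, 2 ≤ k → x * epow a k = epow a (w + k)) ∧
      ∃ i, 2 ≤ i ∧ a * x = epow a i ∧ CapEq m (i + 1) (2 + w) := by
  have hprod : ∀ s t : S, ∃ j, 2 ≤ j ∧ s * t = epow a j := fun s t =>
    h.mem_mulPow hsub (mul_mem_mulPow (i := 0) (j := 0) trivial trivial)
  obtain ⟨i, hi, hax⟩ := hprod a x
  obtain ⟨j, hj, hxa⟩ := hprod x a
  have e1 : epow a (i + 1) = epow a (1 + j) := by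
    rw [← epow_mul a (by omega) le_rfl, ← epow_mul a le_rfl (by omega), ← hax, ← hxa, epow_one,
      mul_assoc]
  rw [h.epow_eq_iff (by omega) (by omega)] at e1
  -- The cap at m merges ax = a^m with ax = 0: both kill a after one more multiplication, so both
  -- get weight m - 1.
  refine ⟨min i m - 1, by omega, by omega, fun k hk => ?_, fun k hk => ?_, i, hi, hax, ?_⟩
  · rw [show k = (k - 1) + 1 by omega, ← epow_mul a (by omega) le_rfl, mul_assoc, epow_one, hax,
      epow_mul a (by omega) (by omega), h.epow_eq_iff (by omega) (by omega)]
    omega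
  · rw [show k = 1 + (k - 1) by omega, ← epow_mul a le_rfl (by omega), ← mul_assoc, epow_one, hxa,
      epow_mul a (by omega) (by omega), h.epow_eq_iff (by omega) (by omega)]
    omega
  · unfold CapEq
    omega

theorem IsUniserial.exists_tab₁ {a : S} (h : IsUniserial a m) (hm : 4 ≤ m)
    (hcard : Nat.card S = m + 3)
    (hsub : ∀ l, 1 ≤ l → (layer S l).Subsingleton) (h0 : (layer S 0).ncard = 3) :
    ∃ (w : Fin 3 → ℕ) (hw : ∀ x, 1 ≤ w x) (e : Fin 3 → Fin 3 → Bool), (∀ x, w x < m) ∧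
      (∃ i, w i = 1) ∧ AreIso (tab₁ hm w hw e).Mod S := by
  classical
  obtain ⟨b1, b2, b3, -, -, -, hb⟩ := Set.ncard_eq_three.1 h0
  have hprod : ∀ s t : S, ∃ j, 2 ≤ j ∧ s * t = epow a j := fun s t =>
    h.mem_mulPow hsub (mul_mem_mulPow (i := 0) (j := 0) trivial trivial)
  let θ : Fin 3 → S := ![b1, b2, b3]
  have hθ : ∀ s ∈ layer S 0, ∃ x, s = θ x := by
    intro s hs
    rw [hb] at hs
    rcases hs with rfl | rfl | rfl
    exacts [⟨0, rfl⟩, ⟨1, rfl⟩, ⟨2, rfl⟩]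
  choose w hw1 hwm hwl hwr hwi using fun x => h.exists_weight hm hsub (θ x)
  obtain ⟨i, hi⟩ := hθ a (h.mem 0 (by omega))
  have hwi1 : w i = 1 := by
    have := hwl i 2 le_rfl
    rw [← hi, ← epow_one a, epow_one a] at this
    have e3 : epow a 2 * a = epow a 3 := epow_mul a (j := 1) (by omega) le_rfl
    rw [e3, h.epow_eq_iff (by omega) (by omega)] at this
    omega
  refine ⟨w, hw1, fun x y => decide (θ x * θ y = epow a (m + 1)), hwm, ⟨i, hwi1⟩, ?_⟩
  refine Tab.equivOf _ hcard θ (epow a) (fun i j hi hj => epow_mul a (by omega) (by omega))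
    (fun i j hij => ?_) (fun x y => ?_) (fun k x hk => hwl x k hk) (fun k x hk => hwr x k hk)
    (fun s => ?_)
  · by_cases hi0 : 1 ≤ i ∧ 1 ≤ j
    · exact (h.epow_eq_iff hi0.1 hi0.2).2 hij
    · unfold CapEq at hij
      obtain rfl : i = j := by omega
      rfl
  · obtain ⟨l, hl, hxy⟩ := hprod (θ x) (θ y)
    obtain ⟨j, hj, hax, hjw⟩ := hwi x
    change θ x * θ y = epow a (expo m (w x) (w y) _)
    -- Multiplying the product on the left by a gives an exponent known from the weights; the
    -- product itself is thereby known, except that a^m and 0 cannot be told apart. The Boolean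
    -- records which occurs.
    have e1 : epow a (1 + l) = epow a (j + w y) := by
      rw [← epow_mul a le_rfl (by omega), ← hxy, epow_one, ← mul_assoc, hax, hwl y j hj]
    rw [h.epow_eq_iff (by omega) (by omega)] at e1
    have h1 := hw1 x
    have h2 := hw1 y
    have h3 := hwm x
    have h4 := hwm y
    have hex := expo_cases m (w x) (w y) (decide (θ x * θ y = epow a (m + 1)))
    unfold CapEq at hjw
    rcases hex with hex | hex | hex
    · rw [hex.2, hxy, h.epow_eq_iff (by omega) (by omega)]
      omega
    · rw [hex.2.2]
      exact of_decide_eq_true hex.2.1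
    · rw [hex.2.2]
      have hne := of_decide_eq_false hex.2.1
      rw [hxy, h.epow_eq_iff (by omega) (by omega)] at hne ⊢
      omega
  · by_cases hs : s ∈ layer S 0
    · exact .inl (hθ s hs)
    · right
      have : s ∈ mulPow S 1 := by
        by_contra h1
        exact hs ⟨trivial, h1⟩
      exact h.mem_mulPow hsub this

end ThreeGeneratorsExtraction

/-! ### Codes for two generators, and associativity of their tables. -/

section TwoGenerators

/-- The exponent described by `x ≥ 1` for a product of two generators of total weight `s`. -/
def pairExp (m s x : ℕ) : ℕ := min s (m - 1) + x - 1

/-- The product of two generators of total weight `s`: the extra element if `x = 0`, and a power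
otherwise. -/
def pairVal (m s x : ℕ) : Fin 3 ⊕ ℕ := if x = 0 then .inl 2 else .inr (pairExp m s x)

/-- The exponent of the product of the extra element with the generator of weight `1`. -/
def extraExp (m β x y t : ℕ) : ℕ :=
  if x = 0 then min (2 + β) m + t
  else if y = 0 then pairExp m (1 + β) x + 1 else pairExp m (1 + β) x + β

/-- The exponent of the product of the extra element with the generator of weight `β`. -/
def extraExp' (m β x y u t : ℕ) : ℕ :=
  if u = 0 then
    if x = 0 then if y = 0 then min (2 + β) m + t else pairExp m (1 + β) y + β
    else if y = 0 then pairExp m (1 + β) x + β else min (3 * β) m + t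
  else pairExp m (2 * β) u + 1

/-- The exponent of the product of the square of the generator of weight `1` with the other
generator. -/
def sqExp (m β x t : ℕ) : ℕ := if x = 0 then min (2 + β) m + t else pairExp m (1 + β) x + 1

/-- The codes of semigroups with two generators, of weights `1` and `β`. -/
structure IsCode (m β x y u t : ℕ) : Prop where
  hx : x ≤ 3
  hy : y ≤ 3
  hu : u ≤ 3
  ht : t ≤ 1
  one_le : 1 ≤ β
  le : β + 2 ≤ m
  exists_extra : x = 0 ∨ y = 0 ∨ u = 0
  hx2 : 2 ≤ x → β + 2 = m
  hy2 : 2 ≤ y → β + 2 = m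
  hu2 : 2 ≤ u → m ≤ 2 * β + 1
  eq_one : β = 1 → t = 0
  xy : x ≠ 0 → y ≠ 0 → (x = 1 ↔ y = 1) ∧ (t = 1 → m ≤ 3 * β)
  xu : x = 0 → y ≠ 0 → u ≠ 0 → (2 * β < m → u = 1) ∧ (m ≤ 2 * β → 2 ≤ u) ∧ (t = 1 → β + 2 = m)
  yu : y = 0 → x ≠ 0 → u ≠ 0 → (2 * β < m → u = 1) ∧ (m ≤ 2 * β → 2 ≤ u) ∧ (t = 1 → β + 2 = m)
  xx : x = 0 → y = 0 → t = 1 → β + 2 = m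
  xxu : x = 0 → y = 0 → u = 0 → 2 ≤ β → β + 2 = m
  yx : x = 0 → y ≠ 0 → u = 0 → 2 ≤ β → β + 2 = m ∧ 2 ≤ y ∧ t = 1
  xy' : y = 0 → x ≠ 0 → u = 0 → 2 ≤ β → β + 2 = m ∧ 2 ≤ x ∧ t = 1

variable {m β x y u t : ℕ}

theorem IsCode.symm (h : IsCode m β x y u t) : IsCode m β y x u t where
  hx := h.hy
  hy := h.hx
  hu := h.hu
  ht := h.ht
  one_le := h.one_le
  le := h.le
  exists_extra := by have := h.exists_extra; omega
  hx2 := h.hy2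
  hy2 := h.hx2
  hu2 := h.hu2
  eq_one := h.eq_one
  xy h1 h2 := ⟨(h.xy h2 h1).1.symm, (h.xy h2 h1).2⟩
  xu := h.yu
  yu := h.xu
  xx h1 h2 := h.xx h2 h1
  xxu h1 h2 := h.xxu h2 h1
  yx := h.xy'
  xy' := h.yx

/-- The cases are the nonempty subsets of {ab, ba, bb} whose members equal the extra element. -/
theorem IsCode.cases (h : IsCode m β x y u t) :
    (x ≠ 0 ∧ y ≠ 0 ∧ u = 0) ∨ (x = 0 ∧ y ≠ 0 ∧ u ≠ 0) ∨ (x ≠ 0 ∧ y = 0 ∧ u ≠ 0) ∨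
      (x = 0 ∧ y = 0 ∧ u ≠ 0) ∨ (x = 0 ∧ y ≠ 0 ∧ u = 0) ∨ (x ≠ 0 ∧ y = 0 ∧ u = 0) ∨
      (x = 0 ∧ y = 0 ∧ u = 0) := by
  have := h.exists_extra
  omega

theorem pairVal_zero (m s : ℕ) : pairVal m s 0 = .inl 2 := rfl

theorem pairVal_of_ne {m s x : ℕ} (h : x ≠ 0) : pairVal m s x = .inr (pairExp m s x) := if_neg h

/-- The table of a semigroup generated by the first two of three labelled elements. -/
def mu₂ (A B C : Fin 3 ⊕ ℕ) (p q g v : ℕ) : Fin 3 → Fin 3 → Fin 3 ⊕ ℕ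
  | 0, 0 => .inr 2
  | 0, 1 => A
  | 0, 2 => .inr p
  | 1, 0 => B
  | 1, 1 => C
  | 1, 2 => .inr g
  | 2, 0 => .inr q
  | 2, 1 => .inr g
  | 2, 2 => .inr v

/-- The weights of labelled elements, the first of them being `1`. -/
def wt₂ (b c : ℕ) : Fin 3 → ℕ
  | 0 => 1
  | 1 => b
  | 2 => c

/-- The table with a given code. -/
def codeMu (m β x y u t : ℕ) : Fin 3 → Fin 3 → Fin 3 ⊕ ℕ :=
  mu₂ (pairVal m (1 + β) x) (pairVal m (1 + β) y) (pairVal m (2 * β) u) (extraExp m β x y t)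
    (extraExp m β y x t) (extraExp' m β x y u t) (if x ≠ 0 ∧ y ≠ 0 then 4 * β else 2 + 2 * β)

/-- The left weights belonging to a given code. -/
def codeWt (m β x y t : ℕ) : Fin 3 → ℕ := wt₂ (sqExp m β x t - 2) (extraExp m β x y t - 1)

/-- The conditions under which a table defines a semigroup. -/
def TabEq (m : ℕ) (mu : Fin 3 → Fin 3 → Fin 3 ⊕ ℕ) (l r : Fin 3 → ℕ) : Prop :=
  (∀ x y z, Agree m ((mu x y).elim (fun c => mu c z) (fun k => .inr (k + l z)))
    ((mu y z).elim (fun c => mu x c) (fun k => .inr (r x + k)))) ∧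
  (∀ x y, CapEq m (2 + (mu x y).elim l id) (2 + (l x + l y))) ∧
  (∀ x y, CapEq m ((mu x y).elim r id + 2) (r x + r y + 2)) ∧
  ∀ x, CapEq m (l x + 4) (r x + 4)

theorem forall_fin_three {P : Fin 3 → Prop} (h0 : P 0) (h1 : P 1) (h2 : P 2) : ∀ i, P i := by
  intro i; fin_cases i <;> assumption

/-- Here bb is the extra element, and X, Y, T are the exponents of ab, ba and b^3. In this and the
next six lemmas the exponents are free variables with just the constraints that associativity needs,
so that each of the 48 entries is linear arithmetic. -/
theorem tabEq_square_extra (X Y T : ℕ) (hm : 4 ≤ m) (h1 : 1 ≤ β) (h2 : β + 2 ≤ m)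
    (hY : Y = 1 + β ∨ β + 2 = m ∧ m ≤ Y + 1)
    (hXY : X = Y ∨ m ≤ X ∧ m ≤ Y) (hT : T = 3 * β ∨ m ≤ 3 * β ∧ m ≤ T) :
    TabEq m (mu₂ (.inr X) (.inr Y) (.inl 2) (X + β) (Y + β) T (4 * β))
      (wt₂ (X + 1 - 2) (X + β - 1)) (wt₂ (Y + 1 - 2) (Y + β - 1)) := by
  refine ⟨forall_fin_three
    (forall_fin_three (forall_fin_three ?_ ?_ ?_) (forall_fin_three ?_ ?_ ?_)
      (forall_fin_three ?_ ?_ ?_))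
    (forall_fin_three (forall_fin_three ?_ ?_ ?_) (forall_fin_three ?_ ?_ ?_)
      (forall_fin_three ?_ ?_ ?_))
    (forall_fin_three (forall_fin_three ?_ ?_ ?_) (forall_fin_three ?_ ?_ ?_)
      (forall_fin_three ?_ ?_ ?_)),
    forall_fin_three (forall_fin_three ?_ ?_ ?_) (forall_fin_three ?_ ?_ ?_)
      (forall_fin_three ?_ ?_ ?_),
    forall_fin_three (forall_fin_three ?_ ?_ ?_) (forall_fin_three ?_ ?_ ?_)
      (forall_fin_three ?_ ?_ ?_), forall_fin_three ?_ ?_ ?_⟩ <;>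
  simp only [mu₂, wt₂, Sum.elim_inl, Sum.elim_inr, id, Agree, CapEq, true_or] <;> omega

theorem tabEq_left_extra (Y U T : ℕ) (hm : 4 ≤ m) (h1 : 1 ≤ β) (h2 : β + 2 ≤ m)
    (hY : Y = 1 + β ∨ β + 2 = m ∧ m ≤ Y + 1) (hU : U = 2 * β ∨ m ≤ 2 * β + 1 ∧ m ≤ U + 1)
    (hYU : U + 1 = Y + β ∨ m ≤ U ∧ m < Y + β) (hT : T = 2 + β ∨ β + 2 = m ∧ m ≤ T) :
    TabEq m (mu₂ (.inl 2) (.inr Y) (.inr U) T (Y + 1) (U + 1) (2 + 2 * β))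
      (wt₂ (T - 2) (T - 1)) (wt₂ (Y + 1 - 2) (Y + 1 - 1)) := by
  refine ⟨forall_fin_three
    (forall_fin_three (forall_fin_three ?_ ?_ ?_) (forall_fin_three ?_ ?_ ?_)
      (forall_fin_three ?_ ?_ ?_))
    (forall_fin_three (forall_fin_three ?_ ?_ ?_) (forall_fin_three ?_ ?_ ?_)
      (forall_fin_three ?_ ?_ ?_))
    (forall_fin_three (forall_fin_three ?_ ?_ ?_) (forall_fin_three ?_ ?_ ?_)
      (forall_fin_three ?_ ?_ ?_)),
    forall_fin_three (forall_fin_three ?_ ?_ ?_) (forall_fin_three ?_ ?_ ?_)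
      (forall_fin_three ?_ ?_ ?_),
    forall_fin_three (forall_fin_three ?_ ?_ ?_) (forall_fin_three ?_ ?_ ?_)
      (forall_fin_three ?_ ?_ ?_), forall_fin_three ?_ ?_ ?_⟩ <;>
  simp only [mu₂, wt₂, Sum.elim_inl, Sum.elim_inr, id, Agree, CapEq, true_or] <;> omega

theorem tabEq_right_extra (X U T : ℕ) (hm : 4 ≤ m) (h1 : 1 ≤ β) (h2 : β + 2 ≤ m)
    (hX : X = 1 + β ∨ β + 2 = m ∧ m ≤ X + 1) (hU : U = 2 * β ∨ m ≤ 2 * β + 1 ∧ m ≤ U + 1)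
    (hXU : U + 1 = X + β ∨ m ≤ U ∧ m < X + β) (hT : T = 2 + β ∨ β + 2 = m ∧ m ≤ T) :
    TabEq m (mu₂ (.inr X) (.inl 2) (.inr U) (X + 1) T (U + 1) (2 + 2 * β))
      (wt₂ (X + 1 - 2) (X + 1 - 1)) (wt₂ (T - 2) (T - 1)) := by
  refine ⟨forall_fin_three
    (forall_fin_three (forall_fin_three ?_ ?_ ?_) (forall_fin_three ?_ ?_ ?_)
      (forall_fin_three ?_ ?_ ?_))
    (forall_fin_three (forall_fin_three ?_ ?_ ?_) (forall_fin_three ?_ ?_ ?_)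
      (forall_fin_three ?_ ?_ ?_))
    (forall_fin_three (forall_fin_three ?_ ?_ ?_) (forall_fin_three ?_ ?_ ?_)
      (forall_fin_three ?_ ?_ ?_)),
    forall_fin_three (forall_fin_three ?_ ?_ ?_) (forall_fin_three ?_ ?_ ?_)
      (forall_fin_three ?_ ?_ ?_),
    forall_fin_three (forall_fin_three ?_ ?_ ?_) (forall_fin_three ?_ ?_ ?_)
      (forall_fin_three ?_ ?_ ?_), forall_fin_three ?_ ?_ ?_⟩ <;>
  simp only [mu₂, wt₂, Sum.elim_inl, Sum.elim_inr, id, Agree, CapEq, true_or] <;> omega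

theorem tabEq_commuting_extra (U T : ℕ) (hm : 4 ≤ m) (h1 : 1 ≤ β)
    (hU : U = 2 * β ∨ m ≤ 2 * β + 1 ∧ m ≤ U + 1) (hT : T = 2 + β ∨ β + 2 = m ∧ m ≤ T) :
    TabEq m (mu₂ (.inl 2) (.inl 2) (.inr U) T T (U + 1) (2 + 2 * β))
      (wt₂ (T - 2) (T - 1)) (wt₂ (T - 2) (T - 1)) := by
  refine ⟨forall_fin_three
    (forall_fin_three (forall_fin_three ?_ ?_ ?_) (forall_fin_three ?_ ?_ ?_)
      (forall_fin_three ?_ ?_ ?_))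
    (forall_fin_three (forall_fin_three ?_ ?_ ?_) (forall_fin_three ?_ ?_ ?_)
      (forall_fin_three ?_ ?_ ?_))
    (forall_fin_three (forall_fin_three ?_ ?_ ?_) (forall_fin_three ?_ ?_ ?_)
      (forall_fin_three ?_ ?_ ?_)),
    forall_fin_three (forall_fin_three ?_ ?_ ?_) (forall_fin_three ?_ ?_ ?_)
      (forall_fin_three ?_ ?_ ?_),
    forall_fin_three (forall_fin_three ?_ ?_ ?_) (forall_fin_three ?_ ?_ ?_)
      (forall_fin_three ?_ ?_ ?_), forall_fin_three ?_ ?_ ?_⟩ <;>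
  simp only [mu₂, wt₂, Sum.elim_inl, Sum.elim_inr, id, Agree, CapEq, true_or] <;> omega

theorem tabEq_left_square_extra (Y T : ℕ) (hm : 4 ≤ m) (h1 : 1 ≤ β)
    (hY : Y = 2 ∧ β = 1 ∧ T = 3 ∨ m ≤ Y ∧ β + 2 = m ∧ m < T) :
    TabEq m (mu₂ (.inl 2) (.inr Y) (.inl 2) T (Y + 1) (Y + β) (2 + 2 * β))
      (wt₂ (T - 2) (T - 1)) (wt₂ (Y + 1 - 2) (Y + 1 - 1)) := by
  refine ⟨forall_fin_three
    (forall_fin_three (forall_fin_three ?_ ?_ ?_) (forall_fin_three ?_ ?_ ?_)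
      (forall_fin_three ?_ ?_ ?_))
    (forall_fin_three (forall_fin_three ?_ ?_ ?_) (forall_fin_three ?_ ?_ ?_)
      (forall_fin_three ?_ ?_ ?_))
    (forall_fin_three (forall_fin_three ?_ ?_ ?_) (forall_fin_three ?_ ?_ ?_)
      (forall_fin_three ?_ ?_ ?_)),
    forall_fin_three (forall_fin_three ?_ ?_ ?_) (forall_fin_three ?_ ?_ ?_)
      (forall_fin_three ?_ ?_ ?_),
    forall_fin_three (forall_fin_three ?_ ?_ ?_) (forall_fin_three ?_ ?_ ?_)
      (forall_fin_three ?_ ?_ ?_), forall_fin_three ?_ ?_ ?_⟩ <;>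
  simp only [mu₂, wt₂, Sum.elim_inl, Sum.elim_inr, id, Agree, CapEq, true_or] <;> omega

theorem tabEq_right_square_extra (X T : ℕ) (hm : 4 ≤ m) (h1 : 1 ≤ β)
    (hX : X = 2 ∧ β = 1 ∧ T = 3 ∨ m ≤ X ∧ β + 2 = m ∧ m < T) :
    TabEq m (mu₂ (.inr X) (.inl 2) (.inl 2) (X + 1) T (X + β) (2 + 2 * β))
      (wt₂ (X + 1 - 2) (X + 1 - 1)) (wt₂ (T - 2) (T - 1)) := by
  refine ⟨forall_fin_three
    (forall_fin_three (forall_fin_three ?_ ?_ ?_) (forall_fin_three ?_ ?_ ?_)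
      (forall_fin_three ?_ ?_ ?_))
    (forall_fin_three (forall_fin_three ?_ ?_ ?_) (forall_fin_three ?_ ?_ ?_)
      (forall_fin_three ?_ ?_ ?_))
    (forall_fin_three (forall_fin_three ?_ ?_ ?_) (forall_fin_three ?_ ?_ ?_)
      (forall_fin_three ?_ ?_ ?_)),
    forall_fin_three (forall_fin_three ?_ ?_ ?_) (forall_fin_three ?_ ?_ ?_)
      (forall_fin_three ?_ ?_ ?_),
    forall_fin_three (forall_fin_three ?_ ?_ ?_) (forall_fin_three ?_ ?_ ?_)
      (forall_fin_three ?_ ?_ ?_), forall_fin_three ?_ ?_ ?_⟩ <;>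
  simp only [mu₂, wt₂, Sum.elim_inl, Sum.elim_inr, id, Agree, CapEq, true_or] <;> omega

theorem tabEq_all_extra (T : ℕ) (hm : 4 ≤ m) (h1 : 1 ≤ β)
    (hT : T = 3 ∧ β = 1 ∨ β + 2 = m ∧ m ≤ T) :
    TabEq m (mu₂ (.inl 2) (.inl 2) (.inl 2) T T T (2 + 2 * β))
      (wt₂ (T - 2) (T - 1)) (wt₂ (T - 2) (T - 1)) := by
  refine ⟨forall_fin_three
    (forall_fin_three (forall_fin_three ?_ ?_ ?_) (forall_fin_three ?_ ?_ ?_)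
      (forall_fin_three ?_ ?_ ?_))
    (forall_fin_three (forall_fin_three ?_ ?_ ?_) (forall_fin_three ?_ ?_ ?_)
      (forall_fin_three ?_ ?_ ?_))
    (forall_fin_three (forall_fin_three ?_ ?_ ?_) (forall_fin_three ?_ ?_ ?_)
      (forall_fin_three ?_ ?_ ?_)),
    forall_fin_three (forall_fin_three ?_ ?_ ?_) (forall_fin_three ?_ ?_ ?_)
      (forall_fin_three ?_ ?_ ?_),
    forall_fin_three (forall_fin_three ?_ ?_ ?_) (forall_fin_three ?_ ?_ ?_)
      (forall_fin_three ?_ ?_ ?_), forall_fin_three ?_ ?_ ?_⟩ <;>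
  simp only [mu₂, wt₂, Sum.elim_inl, Sum.elim_inr, id, Agree, CapEq, true_or] <;> omega

end TwoGenerators

/-! ### Models with two generators and their isomorphisms. -/

section TwoGeneratorsModels

variable {m β x y u t : ℕ}

theorem IsCode.tabEq (hm : 4 ≤ m) (h : IsCode m β x y u t) :
    TabEq m (codeMu m β x y u t) (codeWt m β x y t) (codeWt m β y x t) := by
  have hc := h.cases
  obtain ⟨hx, hy, hu, ht, h1, h2, h3, h4, h5, h6, h7, h8, h9, h10, h11, h12, h13, h14⟩ := h
  rcases hc with ⟨hx0, hy0, hu0⟩ | ⟨hx0, hy0, hu0⟩ | ⟨hx0, hy0, hu0⟩ | ⟨hx0, hy0, hu0⟩ |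
    ⟨hx0, hy0, hu0⟩ | ⟨hx0, hy0, hu0⟩ | ⟨hx0, hy0, hu0⟩ <;>
  simp only [hx0, hy0, hu0, ne_eq, not_true_eq_false, not_false_eq_true, true_implies,
    or_true, or_false, IsEmpty.forall_iff] at h3 h4 h5 h6 h7 h8 h9 h10 h11 h12 h13 h14 <;>
  simp only [hx0, hy0, hu0, codeMu, codeWt, pairVal, extraExp, extraExp', sqExp, ne_eq,
    not_true_eq_false, not_false_eq_true, if_true, if_false, and_self, and_true, and_false]
  · exact tabEq_square_extra _ _ _ hm h1 h2 (by unfold pairExp; omega) (by unfold pairExp; omega)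
      (by omega)
  · exact tabEq_left_extra _ _ _ hm h1 h2 (by unfold pairExp; omega) (by unfold pairExp; omega)
      (by unfold pairExp; omega) (by omega)
  · exact tabEq_right_extra _ _ _ hm h1 h2 (by unfold pairExp; omega) (by unfold pairExp; omega)
      (by unfold pairExp; omega) (by omega)
  · exact tabEq_commuting_extra _ _ hm h1 (by unfold pairExp; omega) (by omega)
  · exact tabEq_left_square_extra _ _ hm h1 (by unfold pairExp; omega)
  · exact tabEq_right_square_extra _ _ hm h1 (by unfold pairExp; omega)
  · exact tabEq_all_extra _ hm h1 (by omega)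

theorem two_le_pairExp {m s x : ℕ} (hm : 4 ≤ m) (hs : 2 ≤ s) (hx : x ≠ 0) : 2 ≤ pairExp m s x := by
  unfold pairExp
  omega

theorem three_le_extraExp (hm : 4 ≤ m) (h1 : 1 ≤ β) : 3 ≤ extraExp m β x y t := by
  have := two_le_pairExp (x := x) hm (show 2 ≤ 1 + β by omega)
  unfold extraExp
  split_ifs <;> omega

theorem three_le_extraExp' (hm : 4 ≤ m) (h1 : 1 ≤ β) : 3 ≤ extraExp' m β x y u t := by
  have := two_le_pairExp (x := x) hm (show 2 ≤ 1 + β by omega)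
  have := two_le_pairExp (x := y) hm (show 2 ≤ 1 + β by omega)
  have := two_le_pairExp (x := u) hm (show 2 ≤ 2 * β by omega)
  unfold extraExp'
  split_ifs <;> omega

theorem three_le_sqExp (hm : 4 ≤ m) (h1 : 1 ≤ β) : 3 ≤ sqExp m β x t := by
  have := two_le_pairExp (x := x) hm (show 2 ≤ 1 + β by omega)
  unfold sqExp
  split_ifs <;> omega

theorem pairVal_cases {m s x : ℕ} (hm : 4 ≤ m) (hs : 2 ≤ s) :
    pairVal m s x = .inl 2 ∨ ∃ k, 2 ≤ k ∧ pairVal m s x = .inr k := by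
  by_cases hx : x = 0
  · exact .inl (if_pos hx)
  · exact .inr ⟨_, two_le_pairExp hm hs hx, if_neg hx⟩

/-- A product involving the extra element is a product of at least three generators, hence a power
with exponent at least 3; this gives the depth condition in `hasCoclass`. -/
theorem codeMu_cases (hm : 4 ≤ m) (h1 : 1 ≤ β) : ∀ i j,
    (codeMu m β x y u t i j = .inl 2 ∧ i ≠ 2 ∧ j ≠ 2) ∨
      ∃ k, 2 ≤ k ∧ (i = 2 ∨ j = 2 → 3 ≤ k) ∧ codeMu m β x y u t i j = .inr k := by
  have key : ∀ i j : Fin 3, i ≠ 2 → j ≠ 2 → ∀ a : Fin 3 ⊕ ℕ, (a = .inl 2 ∨ ∃ k, 2 ≤ k ∧ a = .inr k) →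
      (a = .inl 2 ∧ i ≠ 2 ∧ j ≠ 2) ∨ ∃ k, 2 ≤ k ∧ (i = 2 ∨ j = 2 → 3 ≤ k) ∧ a = .inr k := by
    rintro i j hi hj a (h | ⟨k, hk, h⟩)
    · exact .inl ⟨h, hi, hj⟩
    · exact .inr ⟨k, hk, by tauto, h⟩
  refine forall_fin_three (forall_fin_three ?_ ?_ ?_) (forall_fin_three ?_ ?_ ?_)
    (forall_fin_three ?_ ?_ ?_)
  · exact key _ _ (by decide) (by decide) _ (.inr ⟨2, le_rfl, rfl⟩)
  · exact key _ _ (by decide) (by decide) _ (pairVal_cases hm (by omega))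
  · exact .inr ⟨_, (by omega : 2 ≤ 3).trans (three_le_extraExp hm h1),
      fun _ => three_le_extraExp hm h1, rfl⟩
  · exact key _ _ (by decide) (by decide) _ (pairVal_cases hm (by omega))
  · exact key _ _ (by decide) (by decide) _ (pairVal_cases hm (by omega))
  · exact .inr ⟨_, (by omega : 2 ≤ 3).trans (three_le_extraExp' hm h1),
      fun _ => three_le_extraExp' hm h1, rfl⟩
  · exact .inr ⟨_, (by omega : 2 ≤ 3).trans (three_le_extraExp hm h1),
      fun _ => three_le_extraExp hm h1, rfl⟩
  · exact .inr ⟨_, (by omega : 2 ≤ 3).trans (three_le_extraExp' hm h1),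
      fun _ => three_le_extraExp' hm h1, rfl⟩
  · refine .inr ⟨_, ?_, fun _ => ?_, rfl⟩ <;> split_ifs <;> omega

/-- The semigroup with a given code. -/
def tab₂ (hm : 4 ≤ m) (h : IsCode m β x y u t) : Tab m where
  hm := hm
  mu := codeMu m β x y u t
  l := codeWt m β x y t
  r := codeWt m β y x t
  two_le i j k hk := by
    rcases codeMu_cases (x := x) (y := y) (u := u) (t := t) hm h.one_le i j with
      ⟨h, -⟩ | ⟨k', hk', -, h⟩
    · rw [h] at hk; cases hk
    · rw [h] at hk
      rwa [← Sum.inr.inj hk]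
  assoc := (h.tabEq hm).1
  mul_l := (h.tabEq hm).2.1
  mul_r := (h.tabEq hm).2.2.1
  lr := (h.tabEq hm).2.2.2

theorem one_le_codeWt (hm : 4 ≤ m) (h1 : 1 ≤ β) : ∀ i, 1 ≤ codeWt m β x y t i := by
  have a1 := three_le_sqExp (x := x) (t := t) hm h1
  have a2 := three_le_extraExp (x := x) (y := y) (t := t) hm h1
  refine forall_fin_three le_rfl ?_ ?_ <;> simp only [codeWt, wt₂] <;> omega

variable (hm : 4 ≤ m)

theorem hasCoclass_tab₂ (h : IsCode m β x y u t) : HasCoclass (tab₂ hm h).Mod 2 := by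
  refine (tab₂ hm h).hasCoclass (fun i => if i = 2 then 2 else 1) (fun i => by split_ifs <;> omega)
    (fun i j => ?_) (one_le_codeWt hm h.one_le) (one_le_codeWt hm h.one_le) (i := 0) rfl rfl
  change _ ≤ (codeMu m β x y u t i j).elim _ _
  rcases codeMu_cases (x := x) (y := y) (u := u) (t := t) hm h.one_le i j with
    ⟨h, hi, hj⟩ | ⟨k', hk', h3, h⟩
  · rw [h, if_neg hi]; simp
  · rw [h]
    simp only [Sum.elim_inr, id]
    split_ifs with hi
    · exact h3 (.inl hi)
    · exact hk'

theorem tab₂_gen_ne_mul (h : IsCode m β x y u t) {i : Fin 3} (hi : i ≠ 2) :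
    ∀ s t : (tab₂ hm h).Mod, s * t ≠ (tab₂ hm h).gen i := by
  set T := tab₂ hm h with hT
  intro s t'
  rcases T.cases s with ⟨x', rfl⟩ | ⟨i, hi', -, rfl⟩ <;>
  rcases T.cases t' with ⟨y', rfl⟩ | ⟨j, hj, -, rfl⟩
  · rw [T.gen_mul_gen]
    rcases codeMu_cases (x := x) (y := y) (u := u) (t := t) hm h.one_le x' y' with
      ⟨h, -⟩ | ⟨k', hk', h3, h⟩
    · have : T.mu x' y' = .inl 2 := h
      rw [this]
      exact fun h => hi (T.gen_injective h).symm
    · have : T.mu x' y' = .inr k' := h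
      rw [this]
      exact (T.gen_ne_pw _ _).symm
  · rw [T.gen_mul_pw hj]; exact (T.gen_ne_pw _ _).symm
  · rw [T.pw_mul_gen hi']; exact (T.gen_ne_pw _ _).symm
  · rw [T.pw_mul_pw hi' hj]; exact (T.gen_ne_pw _ _).symm

theorem tab₂_gen_two_eq_mul (h : IsCode m β x y u t) :
    ∃ s t, s * t = (tab₂ hm h).gen 2 := by
  set T := tab₂ hm h with hT
  rcases h.exists_extra with h0 | h0 | h0
  · refine ⟨T.gen 0, T.gen 1, ?_⟩
    rw [T.gen_mul_gen]
    exact congrArg T.ev (show pairVal m (1 + β) x = _ from if_pos h0)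
  · refine ⟨T.gen 1, T.gen 0, ?_⟩
    rw [T.gen_mul_gen]
    exact congrArg T.ev (show pairVal m (1 + β) y = _ from if_pos h0)
  · refine ⟨T.gen 1, T.gen 1, ?_⟩
    rw [T.gen_mul_gen]
    exact congrArg T.ev (show pairVal m (2 * β) u = _ from if_pos h0)

/-- Three elements of the first semigroup are not products, but only two of the second. -/
theorem not_areIso_tab₁_tab₂ {w : Fin 3 → ℕ} (hw : ∀ x, 1 ≤ w x) (e : Fin 3 → Fin 3 → Bool)
    (h : IsCode m β x y u t) :
    ¬ AreIso (tab₁ hm w hw e).Mod (tab₂ hm h).Mod := by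
  rintro ⟨φ⟩
  have hne : ∀ s, (∃ a b, a * b = s) → ∀ z, φ.symm s ≠ (tab₁ hm w hw e).gen z := by
    rintro s ⟨a, b, rfl⟩ z hz
    rw [map_mul] at hz
    exact tab₁_gen_ne_mul hm w hw e z _ _ hz
  have hgen : ∀ z, ∃ j : Fin 3, j ≠ 2 ∧ φ ((tab₁ hm w hw e).gen z) = (tab₂ hm h).gen j := by
    intro z
    rcases (tab₂ hm h).cases (φ ((tab₁ hm w hw e).gen z)) with ⟨j, hj⟩ | ⟨k, hk, -, hj⟩
    · refine ⟨j, ?_, hj⟩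
      rintro rfl
      refine hne _ (tab₂_gen_two_eq_mul hm h) z ?_
      rw [← hj, φ.symm_apply_apply]
    · exfalso
      refine hne _ ((tab₂ hm h).pw_eq_mul (i := 0) rfl rfl hk) z ?_
      rw [← hj, φ.symm_apply_apply]
  choose f hf2 hf using hgen
  have finj : Function.Injective f := fun a b hab => by
    apply (tab₁ hm w hw e).gen_injective
    apply φ.injective
    rw [hf, hf, hab]
  obtain ⟨z, hz⟩ := Finite.injective_iff_surjective.1 finj 2
  exact hf2 z hz

theorem tab₂_op (h : IsCode m β x y u t) :
    AreAntiIso (tab₂ hm h.symm).Mod (tab₂ hm h).Mod := by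
  set T := tab₂ hm h with hT
  refine Tab.equivOf _ ?_ (fun x => MulOpposite.op (T.gen x)) (fun k => MulOpposite.op (T.pw k))
    (fun i j hi hj => ?_) (fun i j h => by simp only [T.pw_congr h]) (fun i j => ?_)
    (fun k x hk => ?_) (fun k x hk => ?_) (fun s => ?_)
  · rw [← Nat.card_congr MulOpposite.opEquiv, T.card_mod]
  · rw [← MulOpposite.op_mul, T.pw_mul_pw hj hi, add_comm]
  · rw [← MulOpposite.op_mul, T.gen_mul_gen]
    have hg : extraExp' m β y x u t = extraExp' m β x y u t := by
      unfold extraExp'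
      have := h.exists_extra
      split_ifs <;> rfl
    have key : (tab₂ hm h.symm).mu i j = T.mu j i := by
      change codeMu m β y x u t i j = codeMu m β x y u t j i
      unfold codeMu
      rw [hg]
      have hc : (y ≠ 0 ∧ x ≠ 0) ↔ (x ≠ 0 ∧ y ≠ 0) := and_comm
      simp only [hc]
      revert i j
      exact forall_fin_three (forall_fin_three rfl rfl rfl) (forall_fin_three rfl rfl rfl)
        (forall_fin_three rfl rfl rfl)
    rw [key]
    cases T.mu j i <;> rfl
  · rw [← MulOpposite.op_mul, T.gen_mul_pw hk, add_comm]
    rfl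
  · rw [← MulOpposite.op_mul, T.pw_mul_gen hk, add_comm]
    rfl
  · rcases T.cases s.unop with ⟨x, hx⟩ | ⟨k, hk, -, hx⟩
    · exact .inl ⟨x, by rw [← hx, MulOpposite.op_unop]⟩
    · exact .inr ⟨k, hk, by rw [← hx, MulOpposite.op_unop]⟩

/-- Codes at most 3 give exponents at most (m - 1) + 2 = m + 1, so no two of them are merged by the
cap. -/
theorem ev_pairVal_inj (T : Tab m) {s x x' : ℕ} (hs : 2 ≤ s) (hx : x ≤ 3) (hx' : x' ≤ 3)
    (h : T.ev (pairVal m s x) = T.ev (pairVal m s x')) : x = x' := by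
  have hm := T.hm
  by_cases h0 : x = 0 <;> by_cases h0' : x' = 0
  · rw [h0, h0']
  · rw [h0, pairVal_zero, pairVal_of_ne h0'] at h
    exact absurd h (T.gen_ne_pw _ _)
  · rw [h0', pairVal_zero, pairVal_of_ne h0] at h
    exact absurd h.symm (T.gen_ne_pw _ _)
  · rw [pairVal_of_ne h0, pairVal_of_ne h0'] at h
    have := (T.pw_eq_iff (two_le_pairExp hm hs h0) (two_le_pairExp hm hs h0')).1 h
    unfold CapEq pairExp at this
    omega

theorem ev_pairVal_one_iff (T : Tab m) {x : ℕ} (hx : x ≤ 1) :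
    T.ev (pairVal m 2 x) = T.pw 2 ↔ x = 1 := by
  have hm := T.hm
  have : T.pw 2 = T.ev (pairVal m 2 1) := by
    rw [pairVal_of_ne one_ne_zero]
    change _ = T.pw _
    congr 1
    unfold pairExp
    omega
  rw [this]
  exact ⟨fun h => ev_pairVal_inj T le_rfl (by omega) (by omega) h, fun h => by rw [h]⟩

theorem tab₂_mul_comm_iff (h : IsCode m β x y u t) :
    (∀ s t : (tab₂ hm h).Mod, s * t = t * s) ↔ x = y := by
  set T := tab₂ hm h with hT
  have h1 := h.one_le
  constructor
  · intro hc
    have := hc (T.gen 0) (T.gen 1)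
    rw [T.gen_mul_gen, T.gen_mul_gen] at this
    exact ev_pairVal_inj T (show 2 ≤ 1 + β by omega) h.hx h.hy this
  · rintro rfl s t'
    rcases T.cases s with ⟨x', rfl⟩ | ⟨i, hi, -, rfl⟩ <;>
    rcases T.cases t' with ⟨y', rfl⟩ | ⟨j, hj, -, rfl⟩
    · rw [T.gen_mul_gen, T.gen_mul_gen]
      congr 1
      revert x' y'
      exact forall_fin_three (forall_fin_three rfl rfl rfl) (forall_fin_three rfl rfl rfl)
        (forall_fin_three rfl rfl rfl)
    · rw [T.gen_mul_pw hj, T.pw_mul_gen hj, add_comm]; rfl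
    · rw [T.gen_mul_pw hi, T.pw_mul_gen hi, add_comm]; rfl
    · rw [T.pw_mul_pw hi hj, T.pw_mul_pw hj hi, add_comm]

theorem tab₂_map_gen {β' x' y' u' t' : ℕ} {h : IsCode m β x y u t} {h' : IsCode m β' x' y' u' t'}
    (φ : (tab₂ hm h).Mod ≃* (tab₂ hm h').Mod) {i : Fin 3} (hi : i ≠ 2) :
    φ ((tab₂ hm h).gen i) = (tab₂ hm h').gen 0 ∨ φ ((tab₂ hm h).gen i) = (tab₂ hm h').gen 1 := by
  have hne : ∀ s, (∃ a b, a * b = s) → φ.symm s ≠ (tab₂ hm h).gen i := by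
    rintro s ⟨a, b, rfl⟩ hz
    rw [map_mul] at hz
    exact tab₂_gen_ne_mul hm h hi _ _ hz
  rcases (tab₂ hm h').cases (φ ((tab₂ hm h).gen i)) with ⟨j, hj⟩ | ⟨k, hk, -, hj⟩
  · rw [hj]
    revert j
    refine forall_fin_three (fun _ => .inl rfl) (fun _ => .inr rfl) (fun hj => ?_)
    refine absurd ?_ (hne _ (tab₂_gen_two_eq_mul hm h'))
    rw [← hj, φ.symm_apply_apply]
  · refine absurd ?_ (hne _ ((tab₂ hm h').pw_eq_mul (i := 0) rfl rfl hk))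
    rw [← hj, φ.symm_apply_apply]

/-- A second generator of weight at least 2 has a cube of exponent at least 4, whereas
`map_pw_bound` allows at most 3 for the image of the first generator. -/
theorem tab₂_eq_one_of_map {β' x' y' u' t' : ℕ} {h : IsCode m β x y u t}
    {h' : IsCode m β' x' y' u' t'} (φ : (tab₂ hm h).Mod ≃* (tab₂ hm h').Mod)
    (h01 : φ ((tab₂ hm h).gen 0) = (tab₂ hm h').gen 1) : β' = 1 := by
  revert φ
  set T' := tab₂ hm h' with hT'
  intro φ h01
  by_contra hne
  have h1 := h'.one_le
  have hl : 1 ≤ T'.l 1 := one_le_codeWt (x := x') (y := y') (t := t') hm h'.one_le 1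
  have hcube : ∃ g, 4 ≤ g ∧ T'.gen 1 * T'.gen 1 * T'.gen 1 = T'.pw g := by
    by_cases hu : u' = 0
    · refine ⟨extraExp' m β' x' y' u' t', ?_, ?_⟩
      · have h2 := h'.xxu
        unfold extraExp' pairExp
        split_ifs <;> omega
      · have : T'.gen 1 * T'.gen 1 = T'.gen 2 := by
          rw [T'.gen_mul_gen]
          exact congrArg T'.ev (show pairVal m (2 * β') u' = _ from if_pos hu)
        rw [this, T'.gen_mul_gen]
        rfl
    · refine ⟨pairExp m (2 * β') u' + T'.l 1, ?_, ?_⟩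
      · unfold pairExp
        omega
      · have : T'.gen 1 * T'.gen 1 = T'.pw (pairExp m (2 * β') u') := by
          rw [T'.gen_mul_gen]
          exact congrArg T'.ev (show pairVal m (2 * β') u' = _ from if_neg hu)
        rw [this, T'.pw_mul_gen (two_le_pairExp hm (by omega) hu)]
  obtain ⟨g, hg, hcube⟩ := hcube
  have := Tab.map_pw_bound φ (i := 0) rfl rfl h01 (by omega) hcube
  have : (m - 3) * 1 ≤ (m - 3) * T'.l 1 := Nat.mul_le_mul_left _ hl
  omega

/-- The exponent of a^2 b can deviate from 2 + β only at the largest weight β = m - 2, so β can be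
recovered from the action on powers. -/
theorem sqExp_cases (h : IsCode m β x y u t) :
    sqExp m β x t = 2 + β ∨ β + 2 = m ∧ m ≤ sqExp m β x t := by
  have h1 := h.le
  have ht := h.ht
  unfold sqExp
  split_ifs with hx
  · have key : t = 1 → β + 2 = m := by
      intro ht
      have hβ : β ≠ 1 := fun hβ => by have := h.eq_one hβ; omega
      have := h.one_le
      by_cases hy : y = 0
      · exact h.xx hx hy ht
      · by_cases hu : u = 0
        · exact (h.yx hx hy hu (by omega)).1
        · exact (h.xu hx hy hu).2.2 ht
    omega
  · have := h.hx2
    unfold pairExp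
    omega

/-- Powers correspond to powers, so by elimination W corresponds to W. Then a^3 b yields β, the
products ab, ba, bb yield x, y, u, and t is read from aW, Wa or bW according to which of x, y, u
vanishes. -/
theorem code_eq_of_map {β' x' y' u' t' : ℕ} {h : IsCode m β x y u t}
    {h' : IsCode m β' x' y' u' t'} (φ : (tab₂ hm h).Mod ≃* (tab₂ hm h').Mod)
    (h0 : φ ((tab₂ hm h).gen 0) = (tab₂ hm h').gen 0)
    (h1 : φ ((tab₂ hm h).gen 1) = (tab₂ hm h').gen 1) :
    β = β' ∧ x = x' ∧ y = y' ∧ u = u' ∧ t = t' := by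
  revert φ
  set T := tab₂ hm h with hT
  set T' := tab₂ hm h' with hT'
  intro φ h0 h1
  have hb := h.one_le
  have hb' := h'.one_le
  have cube : T'.gen 0 * T'.gen 0 * T'.gen 0 = T'.pw 3 := by
    rw [T'.gen_mul_gen]
    exact T'.pw_mul_gen le_rfl _
  have p2 : φ (T.pw 2) = T'.pw 2 := by
    have e1 : T.pw 2 = T.gen 0 * T.gen 0 := rfl
    have e2 : T'.pw 2 = T'.gen 0 * T'.gen 0 := rfl
    rw [e1, map_mul, h0, e2]
  have pk : ∀ k, 2 ≤ k → φ (T.pw k) = T'.pw k := by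
    intro k hk
    by_cases hk2 : k = 2
    · rw [hk2, p2]
    · have := Tab.map_pw φ (i := 0) rfl rfl h0 (by omega) cube k (by omega)
      rw [this]
      congr 1
      change 3 + (k - 3) * 1 = k
      omega
  have hW : φ (T.gen 2) = T'.gen 2 := by
    rcases T'.cases (φ (T.gen 2)) with ⟨j, hj⟩ | ⟨k, hk, -, hj⟩
    · rw [hj]
      revert j
      refine forall_fin_three (fun hj => ?_) (fun hj => ?_) (fun _ => rfl)
      · rw [← h0] at hj
        exact absurd (T.gen_injective (φ.injective hj)) (by decide)
      · rw [← h1] at hj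
        exact absurd (T.gen_injective (φ.injective hj)) (by decide)
    · rw [← pk k hk] at hj
      exact absurd (φ.injective hj) (T.gen_ne_pw _ _)
  have hev : ∀ {s z}, 2 ≤ s → φ (T.ev (pairVal m s z)) = T'.ev (pairVal m s z) := by
    intro s z hs
    by_cases hz : z = 0
    · rw [hz]; exact hW
    · rw [pairVal_of_ne hz]
      exact pk _ (two_le_pairExp hm hs hz)
  have hββ : β = β' := by
    have a1 : φ (T.pw 3 * T.gen 1) = T'.pw 3 * T'.gen 1 := by rw [map_mul, pk 3 (by omega), h1]
    rw [T.pw_mul_gen (by omega), T'.pw_mul_gen (by omega), pk _ (by omega),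
      T'.pw_eq_iff (by omega) (by omega)] at a1
    change CapEq m (3 + (sqExp m β x t - 2)) (3 + (sqExp m β' x' t' - 2)) at a1
    have := sqExp_cases h
    have := sqExp_cases h'
    have := h.le
    have := h'.le
    unfold CapEq at a1
    omega
  subst hββ
  have hx : x = x' := by
    have a1 : φ (T.gen 0 * T.gen 1) = T'.gen 0 * T'.gen 1 := by rw [map_mul, h0, h1]
    rw [T.gen_mul_gen, T'.gen_mul_gen] at a1
    exact ev_pairVal_inj T' (show 2 ≤ 1 + β by omega) h.hx h'.hx ((hev (by omega)).symm.trans a1)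
  have hy : y = y' := by
    have a1 : φ (T.gen 1 * T.gen 0) = T'.gen 1 * T'.gen 0 := by rw [map_mul, h0, h1]
    rw [T.gen_mul_gen, T'.gen_mul_gen] at a1
    exact ev_pairVal_inj T' (show 2 ≤ 1 + β by omega) h.hy h'.hy ((hev (by omega)).symm.trans a1)
  have hu : u = u' := by
    have a1 : φ (T.gen 1 * T.gen 1) = T'.gen 1 * T'.gen 1 := by rw [map_mul, h1]
    rw [T.gen_mul_gen, T'.gen_mul_gen] at a1
    exact ev_pairVal_inj T' (show 2 ≤ 2 * β by omega) h.hu h'.hu ((hev (by omega)).symm.trans a1)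
  subst hx hy hu
  refine ⟨rfl, rfl, rfl, rfl, ?_⟩
  have a1 : φ (T.gen 0 * T.gen 2) = T'.gen 0 * T'.gen 2 := by rw [map_mul, h0, hW]
  have a2 : φ (T.gen 2 * T.gen 0) = T'.gen 2 * T'.gen 0 := by rw [map_mul, h0, hW]
  have a3 : φ (T.gen 1 * T.gen 2) = T'.gen 1 * T'.gen 2 := by rw [map_mul, h1, hW]
  rw [T.gen_mul_gen, T'.gen_mul_gen] at a1 a2 a3
  replace a1 : φ (T.pw (extraExp m β x y t)) = T'.pw (extraExp m β x y t') := a1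
  replace a2 : φ (T.pw (extraExp m β y x t)) = T'.pw (extraExp m β y x t') := a2
  replace a3 : φ (T.pw (extraExp' m β x y u t)) = T'.pw (extraExp' m β x y u t') := a3
  have b1 := three_le_extraExp (x := x) (y := y) (t := t) hm hb
  have b1' := three_le_extraExp (x := x) (y := y) (t := t') hm hb
  have b2 := three_le_extraExp (x := y) (y := x) (t := t) hm hb
  have b2' := three_le_extraExp (x := y) (y := x) (t := t') hm hb
  have b3 := three_le_extraExp' (x := x) (y := y) (u := u) (t := t) hm hb
  have b3' := three_le_extraExp' (x := x) (y := y) (u := u) (t := t') hm hb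
  rw [pk _ (by omega), T'.pw_eq_iff (by omega) (by omega)] at a1 a2 a3
  have ht := h.ht
  have ht' := h'.ht
  have hex := h.exists_extra
  unfold CapEq at a1 a2 a3
  unfold extraExp at a1 a2
  unfold extraExp' at a3
  by_cases hx0 : x = 0
  · rw [if_pos hx0, if_pos hx0] at a1
    omega
  · by_cases hy0 : y = 0
    · rw [if_pos hy0, if_pos hy0] at a2
      omega
    · have hu0 : u = 0 := by omega
      simp only [hx0, hy0, hu0, if_true, if_false] at a3
      omega

/-- If a and b are exchanged, both weights are 1 and the codes can be compared only through
coincidences with a square: ab = a^2 becomes b'a' = b'b', and similarly for ba and bb. -/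
theorem tab₂_iso {β' x' y' u' t' : ℕ} {h : IsCode m β x y u t} {h' : IsCode m β' x' y' u' t'}
    (hiso : AreIso (tab₂ hm h).Mod (tab₂ hm h').Mod) :
    (β = β' ∧ x = x' ∧ y = y' ∧ u = u' ∧ t = t') ∨
      (β = 1 ∧ β' = 1 ∧ (x = 1 ↔ y' = u') ∧ (y = 1 ↔ x' = u') ∧ (u = 1 ↔ u' = 1)) := by
  revert hiso
  set T := tab₂ hm h with hT
  set T' := tab₂ hm h' with hT'
  rintro ⟨φ⟩
  have hne : φ (T.gen 0) ≠ φ (T.gen 1) := fun e =>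
    absurd (T.gen_injective (φ.injective e)) (by decide)
  rcases tab₂_map_gen hm φ (i := 0) (by decide) with h0 | h0 <;>
  rcases tab₂_map_gen hm φ (i := 1) (by decide) with h1 | h1
  · exact absurd (h0.trans h1.symm) hne
  · exact .inl (code_eq_of_map hm φ h0 h1)
  · right
    have hb' : β' = 1 := tab₂_eq_one_of_map hm φ h0
    have hb : β = 1 := by
      refine tab₂_eq_one_of_map hm φ.symm ?_
      rw [← h1, φ.symm_apply_apply]
    subst hb hb'
    have := h.hx2; have := h.hy2; have := h.hu2
    have := h'.hx2; have := h'.hy2; have := h'.hu2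
    have e : ∀ i j k l, T.ev (T.mu i j) = T.ev (T.mu k l) ↔ φ (T.gen i) * φ (T.gen j) =
        φ (T.gen k) * φ (T.gen l) := by
      intro i j k l
      rw [← map_mul, ← map_mul, T.gen_mul_gen, T.gen_mul_gen, φ.injective.eq_iff]
    have e01 := e 0 1 0 0
    have e10 := e 1 0 0 0
    have e11 := e 1 1 0 0
    rw [h0, h1] at e01 e10 e11
    rw [T'.gen_mul_gen, T'.gen_mul_gen] at e01 e10 e11
    have hinj : ∀ {z z'}, z ≤ 1 → z' ≤ 1 →
        (T'.ev (pairVal m 2 z) = T'.ev (pairVal m 2 z') ↔ z = z') := fun hz hz' =>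
      ⟨ev_pairVal_inj T' le_rfl (by omega) (by omega), fun h => by rw [h]⟩
    refine ⟨rfl, rfl, ?_, ?_, ?_⟩
    · exact (ev_pairVal_one_iff T (by omega)).symm.trans (e01.trans (hinj (by omega) (by omega)))
    · exact (ev_pairVal_one_iff T (by omega)).symm.trans (e10.trans (hinj (by omega) (by omega)))
    · refine (ev_pairVal_one_iff T (by omega)).symm.trans (e11.trans ?_)
      rw [eq_comm]
      exact ev_pairVal_one_iff T' (by omega)
  · exact absurd (h0.trans h1.symm) hne

end TwoGeneratorsModels

/-! ### Reading the code off a semigroup with two generators. -/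

section TwoGeneratorsExtraction

variable {S : Type*} [Semigroup S] {m β x y u t : ℕ}

/-- The action of b on all powers follows from a^2 b and b a^2, that of W from aW and Wa, so besides
the labelled products only these two need to be known. -/
theorem IsUniserial.areIso_tab₂ {a b W : S} (h : IsUniserial a m) (hm : 4 ≤ m)
    (hcard : Nat.card S = m + 3) (hc : IsCode m β x y u t)
    (hab : a * b = (pairVal m (1 + β) x).elim ![a, b, W] (epow a))
    (hba : b * a = (pairVal m (1 + β) y).elim ![a, b, W] (epow a))
    (hbb : b * b = (pairVal m (2 * β) u).elim ![a, b, W] (epow a))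
    (haW : a * W = epow a (extraExp m β x y t)) (hWa : W * a = epow a (extraExp m β y x t))
    (hbW : b * W = epow a (extraExp' m β x y u t)) (hWb : W * b = epow a (extraExp' m β x y u t))
    (hWW : W * W = epow a (if x ≠ 0 ∧ y ≠ 0 then 4 * β else 2 + 2 * β))
    (hsq : epow a 2 * b = epow a (sqExp m β x t)) (hsq' : b * epow a 2 = epow a (sqExp m β y t))
    (hsurj : ∀ s, (s = a ∨ s = b ∨ s = W) ∨ ∃ k, 2 ≤ k ∧ s = epow a k) :
    AreIso (tab₂ hm hc).Mod S := by
  have h1 := hc.one_le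
  refine Tab.equivOf _ hcard ![a, b, W] (epow a) (fun i j hi hj => epow_mul a (by omega) (by omega))
    (fun i j hij => ?_) ?_ (fun k x hk => ?_) (fun k x hk => ?_) (fun s => ?_)
  · by_cases hi0 : 1 ≤ i ∧ 1 ≤ j
    · exact (h.epow_eq_iff hi0.1 hi0.2).2 hij
    · unfold CapEq at hij
      obtain rfl : i = j := by omega
      rfl
  · exact forall_fin_three (forall_fin_three rfl hab haW) (forall_fin_three hba hbb hbW)
      (forall_fin_three hWa hWb hWW)
  · revert x
    refine forall_fin_three (epow_mul a (j := 1) (by omega) le_rfl) ?_ ?_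
    · have h3 := three_le_sqExp (x := x) (t := t) hm h1
      change epow a k * b = epow a (k + (sqExp m β x t - 2))
      rcases hk.eq_or_lt with rfl | hk
      · rw [hsq]; congr 1; omega
      · rw [show k = (k - 2) + 2 by omega, ← epow_mul a (by omega) (by omega), mul_assoc, hsq,
          epow_mul a (by omega) (by omega)]
        congr 1; omega
    · have h3 := three_le_extraExp (x := x) (y := y) (t := t) hm h1
      change epow a k * W = epow a (k + (extraExp m β x y t - 1))
      rw [show k = (k - 1) + 1 by omega, ← epow_mul a (by omega) le_rfl, mul_assoc, epow_one, haW,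
        epow_mul a (by omega) (by omega)]
      congr 1; omega
  · revert x
    refine forall_fin_three (epow_mul a (i := 1) le_rfl (by omega)) ?_ ?_
    · have h3 := three_le_sqExp (x := y) (t := t) hm h1
      change b * epow a k = epow a ((sqExp m β y t - 2) + k)
      rcases hk.eq_or_lt with rfl | hk
      · rw [hsq']; congr 1; omega
      · rw [show k = 2 + (k - 2) by omega, ← epow_mul a (by omega) (by omega), ← mul_assoc, hsq',
          epow_mul a (by omega) (by omega)]
        congr 1; omega
    · have h3 := three_le_extraExp (x := y) (y := x) (t := t) hm h1
      change W * epow a k = epow a ((extraExp m β y x t - 1) + k)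
      rw [show k = 1 + (k - 1) by omega, ← epow_mul a le_rfl (by omega), ← mul_assoc, epow_one, hWa,
        epow_mul a (by omega) (by omega)]
      congr 1; omega
  · rcases hsurj s with (h | h | h) | h
    · exact .inl ⟨0, h⟩
    · exact .inl ⟨1, h⟩
    · exact .inl ⟨2, h⟩
    · exact .inr h

/-- The number encoding the exponent `l` of a product of two generators of total weight `s`. -/
def pairCode (m s l : ℕ) : ℕ := min l (m + 1) + 1 - min s (m - 1)

/-- Code 1 stands for the exponent min s (m - 1); once s ≥ m - 1, codes 2 and 3 stand for m and for
the zero. -/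
theorem pairExp_pairCode {m s l : ℕ} (hl : l = s ∨ m ≤ s + 1 ∧ m ≤ l + 1) :
    pairExp m s (pairCode m s l) = min l (m + 1) := by
  unfold pairExp pairCode
  omega

theorem pairCode_spec {m s l : ℕ} (hm : 4 ≤ m) (hl : l = s ∨ m ≤ s + 1 ∧ m ≤ l + 1) :
    pairCode m s l ≠ 0 ∧ pairCode m s l ≤ 3 ∧ (2 ≤ pairCode m s l → m ≤ s + 1) ∧
    (2 ≤ pairCode m s l ↔ m ≤ l ∧ m ≤ s + 1) := by
  unfold pairCode
  omega

/-- The number encoding the exponent `l` of a product of three generators of total weight `s`. -/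
def tripleCode (m s l : ℕ) : ℕ := min l (m + 1) - min s m

/-- For a triple product only the alternative between a^m and 0 can remain open, so one bit
suffices. -/
theorem tripleCode_spec {m s l : ℕ} (hl : l = s ∨ m ≤ s ∧ m ≤ l) :
    min s m + tripleCode m s l = min l (m + 1) ∧ tripleCode m s l ≤ 1 ∧
      (tripleCode m s l = 1 ↔ m < l ∧ m ≤ s) := by
  unfold tripleCode
  omega

/-- Data extracted from a semigroup with two generators. -/
structure Extraction (a b W : S) (m β i j : ℕ) : Prop where
  uni : IsUniserial a m
  hm : 4 ≤ m
  card : Nat.card S = m + 3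
  one_le : 1 ≤ β
  le : β + 2 ≤ m
  hi : i = 2 + β ∨ β + 2 = m ∧ m ≤ i
  hj : j = 2 + β ∨ β + 2 = m ∧ m ≤ j
  sq_mul : epow a 2 * b = epow a i
  mul_sq : b * epow a 2 = epow a j
  surj : ∀ s, (s = a ∨ s = b ∨ s = W) ∨ ∃ k, 2 ≤ k ∧ s = epow a k

namespace Extraction

variable {a b W : S} {i j : ℕ}

theorem epow_eq_iff (D : Extraction a b W m β i j) {k l : ℕ} (hk : 1 ≤ k) (hl : 1 ≤ l) :
    epow a k = epow a l ↔ k = l ∨ m < k ∧ m < l := D.uni.epow_eq_iff hk hl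

/-- The ambiguity of a^2 b at β = m - 2 disappears from a^3 on, where either value leads to zero.
For β = 1 there is none, since then β + 2 < m. -/
theorem epow_mul_gen (D : Extraction a b W m β i j) {k : ℕ} (hk : 3 ≤ k ∨ k = 2 ∧ β = 1) :
    epow a k * b = epow a (k + β) := by
  have := D.hm; have := D.one_le; have := D.hi
  rcases hk with hk | ⟨rfl, rfl⟩
  · rw [show k = (k - 2) + 2 by omega, ← epow_mul a (by omega) (by omega), mul_assoc, D.sq_mul,
      epow_mul a (by omega) (by omega), D.epow_eq_iff (by omega) (by omega)]
    omega
  · rw [D.sq_mul, D.epow_eq_iff (by omega) (by omega)]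
    omega

theorem gen_mul_epow (D : Extraction a b W m β i j) {k : ℕ} (hk : 3 ≤ k ∨ k = 2 ∧ β = 1) :
    b * epow a k = epow a (k + β) := by
  have := D.hm; have := D.one_le; have := D.hj
  rcases hk with hk | ⟨rfl, rfl⟩
  · rw [show k = 2 + (k - 2) by omega, ← epow_mul a (by omega) (by omega), ← mul_assoc, D.mul_sq,
      epow_mul a (by omega) (by omega), D.epow_eq_iff (by omega) (by omega)]
    omega
  · rw [D.mul_sq, D.epow_eq_iff (by omega) (by omega)]
    omega

theorem mul_epow (a : S) {k : ℕ} (hk : 1 ≤ k) : a * epow a k = epow a (k + 1) := by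
  rw [add_comm]; exact epow_mul a (i := 1) le_rfl hk

theorem epow_mul_self (a : S) {k : ℕ} (hk : 1 ≤ k) : epow a k * a = epow a (k + 1) :=
  epow_mul a (j := 1) hk le_rfl

/-- Multiplication by a gives a^2 b, whose exponent is known up to the cap; cancelling a loses one
more step. The bounds for ba and bb below arise in the same way from b a^2 and a^2 b b. -/
theorem exponent_left (D : Extraction a b W m β i j) {l : ℕ} (hl : 2 ≤ l) (h : a * b = epow a l) :
    l = 1 + β ∨ m ≤ 1 + β + 1 ∧ m ≤ l + 1 := by
  have hi := D.hi; have := D.le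
  have : epow a 2 * b = epow a (l + 1) := by rw [epow_two, mul_assoc, h, mul_epow a (by omega)]
  rw [D.sq_mul, D.epow_eq_iff (by omega) (by omega)] at this
  omega

theorem exponent_right (D : Extraction a b W m β i j) {l : ℕ} (hl : 2 ≤ l) (h : b * a = epow a l) :
    l = 1 + β ∨ m ≤ 1 + β + 1 ∧ m ≤ l + 1 := by
  have hj := D.hj; have := D.le
  have : b * epow a 2 = epow a (l + 1) := by
    rw [epow_two, ← mul_assoc, h, epow_mul_self a (by omega)]
  rw [D.mul_sq, D.epow_eq_iff (by omega) (by omega)] at this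
  omega

theorem exponent_sq (D : Extraction a b W m β i j) {l : ℕ} (hl : 2 ≤ l) (h : b * b = epow a l) :
    l = 2 * β ∨ m ≤ 2 * β + 1 ∧ m ≤ l + 1 := by
  have hi := D.hi; have := D.le; have := D.one_le
  have : epow a 2 * b * b = epow a (2 + l) := by
    rw [mul_assoc, h, epow_mul a (by omega) (by omega)]
  rw [D.sq_mul, D.epow_mul_gen (by omega), D.epow_eq_iff (by omega) (by omega)] at this
  omega

theorem elim_pairCode (D : Extraction a b W m β i j) {s l : ℕ} (hl2 : 2 ≤ l)
    (hl : l = s ∨ m ≤ s + 1 ∧ m ≤ l + 1) :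
    epow a l = (pairVal m s (pairCode m s l)).elim ![a, b, W] (epow a) := by
  have hm := D.hm
  rw [pairVal_of_ne (pairCode_spec hm hl).1]
  change _ = epow a _
  rw [pairExp_pairCode hl, D.epow_eq_iff (by omega) (by omega)]
  omega

/-- The conclusion of the case distinction on products of two generators. -/
def HasCode (S : Type*) [Semigroup S] {m : ℕ} (hm : 4 ≤ m) : Prop :=
  ∃ (β x y u t : ℕ) (hc : IsCode m β x y u t), AreIso (tab₂ hm hc).Mod S

-- Evaluating aba in two ways ties the exponents of ab and ba together; evaluating a b^3 determines
-- the exponent of b^3 unless 3β ≥ m, and then t records the choice.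
set_option maxHeartbeats 400000 in
theorem hasCode_square_extra (D : Extraction a b W m β i j) {l l' g : ℕ} (hl : 2 ≤ l) (hl' : 2 ≤ l')
    (hg : 3 ≤ g) (hab : a * b = epow a l) (hba : b * a = epow a l') (hbb : b * b = W)
    (hbbb : b * W = epow a g) : HasCode S D.hm := by
  have hm := D.hm; have h1 := D.one_le; have h2 := D.le; have hi := D.hi; have hj := D.hj
  have fl := D.exponent_left hl hab
  have fl' := D.exponent_right hl' hba
  have hWb : W * b = epow a g := by rw [← hbbb, ← hbb, mul_assoc]
  have e1 : epow a (l + 1) = epow a (l' + 1) := by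
    rw [← epow_mul_self a (by omega), ← hab, mul_assoc, hba, mul_epow a (by omega)]
  rw [D.epow_eq_iff (by omega) (by omega)] at e1
  have e2 : epow a (g + 1) = epow a (l + β + β) := by
    rw [← mul_epow a (by omega), ← hbbb, ← hbb, ← mul_assoc, ← mul_assoc, hab,
      D.epow_mul_gen (by omega), D.epow_mul_gen (by omega)]
  rw [D.epow_eq_iff (by omega) (by omega)] at e2
  have fg : g = 3 * β ∨ m ≤ 3 * β ∧ m ≤ g := by omega
  obtain ⟨x0, x3, x2, x2'⟩ := pairCode_spec hm fl
  obtain ⟨y0, y3, y2, y2'⟩ := pairCode_spec hm fl'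
  obtain ⟨t1, t2, t3⟩ := tripleCode_spec fg
  have hx := D.elim_pairCode hl fl
  have hy := D.elim_pairCode hl' fl'
  have px := pairExp_pairCode fl
  have py := pairExp_pairCode fl'
  set x := pairCode m (1 + β) l
  set y := pairCode m (1 + β) l'
  set t := tripleCode m (3 * β) g
  have hc : IsCode m β x y 0 t := by constructor <;> omega
  refine ⟨β, x, y, 0, t, hc, D.uni.areIso_tab₂ D.hm D.card hc (hab.trans hx) (hba.trans hy) hbb
    ?_ ?_ ?_ ?_ ?_ ?_ ?_ D.surj⟩
  · simp only [extraExp, x0, y0, if_false, px]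
    rw [← hbb, ← mul_assoc, hab, D.epow_mul_gen (by omega), D.epow_eq_iff (by omega) (by omega)]
    omega
  · simp only [extraExp, x0, y0, if_false, py]
    rw [← hbb, mul_assoc, hba, D.gen_mul_epow (by omega), D.epow_eq_iff (by omega) (by omega)]
    omega
  · simp only [extraExp', x0, y0, if_false, if_true, t1]
    rw [hbbb, D.epow_eq_iff (by omega) (by omega)]
    omega
  · simp only [extraExp', x0, y0, if_false, if_true, t1]
    rw [hWb, D.epow_eq_iff (by omega) (by omega)]
    omega
  · rw [if_pos ⟨x0, y0⟩]
    nth_rw 2 [← hbb]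
    rw [← mul_assoc, hWb, D.epow_mul_gen (by omega), D.epow_eq_iff (by omega) (by omega)]
    omega
  · simp only [sqExp, x0, if_false, px]
    rw [epow_two, mul_assoc, hab, mul_epow a (by omega), D.epow_eq_iff (by omega) (by omega)]
    omega
  · simp only [sqExp, y0, if_false, py]
    rw [epow_two, ← mul_assoc, hba, epow_mul_self a (by omega), D.epow_eq_iff (by omega) (by omega)]
    omega

/-- Evaluating bba as (bb)a and as b(ba) couples the exponents of bb and ba. It forces u = 1 when 2β
< m and u ≥ 2 otherwise, and also makes bW = bab equal to Wb = abb. -/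
theorem hasCode_left_extra (D : Extraction a b W m β i j) {l k : ℕ} (hl : 2 ≤ l) (hk : 2 ≤ k)
    (hab : a * b = W) (hba : b * a = epow a l) (hbb : b * b = epow a k) : HasCode S D.hm := by
  have hm := D.hm; have h1 := D.one_le; have h2 := D.le; have hi := D.hi; have hj := D.hj
  have fl := D.exponent_right hl hba
  have fk := D.exponent_sq hk hbb
  have haW : a * W = epow a i := by rw [← hab, ← mul_assoc, ← epow_two, D.sq_mul]
  have hWa : W * a = epow a (l + 1) := by rw [← hab, mul_assoc, hba, mul_epow a (by omega)]
  have hWb : W * b = epow a (k + 1) := by rw [← hab, mul_assoc, hbb, mul_epow a (by omega)]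
  have hbW : b * W = epow a (l + β) := by rw [← hab, ← mul_assoc, hba, D.epow_mul_gen (by omega)]
  have e1 : epow a (k + 1) = epow a (l + β) := by
    rw [← epow_mul_self a (by omega), ← hbb, mul_assoc, hba, D.gen_mul_epow (by omega)]
  have e2 := e1
  rw [D.epow_eq_iff (by omega) (by omega)] at e1
  obtain ⟨u0, u3, u2, u2'⟩ := pairCode_spec hm fk
  obtain ⟨y0, y3, y2, y2'⟩ := pairCode_spec hm fl
  obtain ⟨t1, t2, t3⟩ := tripleCode_spec (m := m) (s := 2 + β) (l := i) (by omega)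
  have hu := D.elim_pairCode hk fk
  have hy := D.elim_pairCode hl fl
  have pu := pairExp_pairCode fk
  have py := pairExp_pairCode fl
  set u := pairCode m (2 * β) k
  set y := pairCode m (1 + β) l
  set t := tripleCode m (2 + β) i
  have hc : IsCode m β 0 y u t := by constructor <;> omega
  refine ⟨β, 0, y, u, t, hc, D.uni.areIso_tab₂ D.hm D.card hc hab (hba.trans hy) (hbb.trans hu)
    ?_ ?_ ?_ ?_ ?_ ?_ ?_ D.surj⟩
  · simp only [extraExp, if_true, t1]
    rw [haW, D.epow_eq_iff (by omega) (by omega)]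
    omega
  · simp only [extraExp, y0, if_true, if_false, py]
    rw [hWa, D.epow_eq_iff (by omega) (by omega)]
    omega
  · simp only [extraExp', u0, if_false, pu]
    rw [hbW, ← e2, D.epow_eq_iff (by omega) (by omega)]
    omega
  · simp only [extraExp', u0, if_false, pu]
    rw [hWb, D.epow_eq_iff (by omega) (by omega)]
    omega
  · rw [if_neg (by simp)]
    nth_rw 2 [← hab]
    rw [← mul_assoc, hWa, D.epow_mul_gen (by omega), D.epow_eq_iff (by omega) (by omega)]
    omega
  · simp only [sqExp, if_true, t1]
    rw [D.sq_mul, D.epow_eq_iff (by omega) (by omega)]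
    omega
  · simp only [sqExp, y0, if_false, py]
    rw [epow_two, ← mul_assoc, hba, epow_mul_self a (by omega), D.epow_eq_iff (by omega) (by omega)]
    omega

theorem hasCode_right_extra (D : Extraction a b W m β i j) {l k : ℕ} (hl : 2 ≤ l) (hk : 2 ≤ k)
    (hab : a * b = epow a l) (hba : b * a = W) (hbb : b * b = epow a k) : HasCode S D.hm := by
  have hm := D.hm; have h1 := D.one_le; have h2 := D.le; have hi := D.hi; have hj := D.hj
  have fl := D.exponent_left hl hab
  have fk := D.exponent_sq hk hbb
  have hWa : W * a = epow a j := by rw [← hba, mul_assoc, ← epow_two, D.mul_sq]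
  have haW : a * W = epow a (l + 1) := by rw [← hba, ← mul_assoc, hab, epow_mul_self a (by omega)]
  have hbW : b * W = epow a (k + 1) := by rw [← hba, ← mul_assoc, hbb, epow_mul_self a (by omega)]
  have hWb : W * b = epow a (l + β) := by rw [← hba, mul_assoc, hab, D.gen_mul_epow (by omega)]
  have e1 : epow a (k + 1) = epow a (l + β) := by
    rw [← mul_epow a (by omega), ← hbb, ← mul_assoc, hab, D.epow_mul_gen (by omega)]
  have e2 := e1
  rw [D.epow_eq_iff (by omega) (by omega)] at e1
  obtain ⟨u0, u3, u2, u2'⟩ := pairCode_spec hm fk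
  obtain ⟨x0, x3, x2, x2'⟩ := pairCode_spec hm fl
  obtain ⟨t1, t2, t3⟩ := tripleCode_spec (m := m) (s := 2 + β) (l := j) (by omega)
  have hu := D.elim_pairCode hk fk
  have hx := D.elim_pairCode hl fl
  have pu := pairExp_pairCode fk
  have px := pairExp_pairCode fl
  set u := pairCode m (2 * β) k
  set x := pairCode m (1 + β) l
  set t := tripleCode m (2 + β) j
  have hc : IsCode m β x 0 u t := by constructor <;> omega
  refine ⟨β, x, 0, u, t, hc, D.uni.areIso_tab₂ D.hm D.card hc (hab.trans hx) hba (hbb.trans hu)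
    ?_ ?_ ?_ ?_ ?_ ?_ ?_ D.surj⟩
  · simp only [extraExp, x0, if_true, if_false, px]
    rw [haW, D.epow_eq_iff (by omega) (by omega)]
    omega
  · simp only [extraExp, if_true, t1]
    rw [hWa, D.epow_eq_iff (by omega) (by omega)]
    omega
  · simp only [extraExp', u0, if_false, pu]
    rw [hbW, D.epow_eq_iff (by omega) (by omega)]
    omega
  · simp only [extraExp', u0, if_false, pu]
    rw [hWb, ← e2, D.epow_eq_iff (by omega) (by omega)]
    omega
  · rw [if_neg (by simp)]
    nth_rw 1 [← hba]
    rw [mul_assoc, haW, D.gen_mul_epow (by omega), D.epow_eq_iff (by omega) (by omega)]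
    omega
  · simp only [sqExp, x0, if_false, px]
    rw [epow_two, mul_assoc, hab, mul_epow a (by omega), D.epow_eq_iff (by omega) (by omega)]
    omega
  · simp only [sqExp, if_true, t1]
    rw [D.mul_sq, D.epow_eq_iff (by omega) (by omega)]
    omega

/-- With ab = ba = W, the exponent of bb is constrained only by `exponent_sq`, so u keeps all three
nonzero values once m ≤ 2β + 1. -/
theorem hasCode_commuting_extra (D : Extraction a b W m β i j) {k : ℕ} (hk : 2 ≤ k)
    (hab : a * b = W) (hba : b * a = W) (hbb : b * b = epow a k) : HasCode S D.hm := by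
  have hm := D.hm; have h1 := D.one_le; have h2 := D.le; have hi := D.hi; have hj := D.hj
  have fk := D.exponent_sq hk hbb
  have haW : a * W = epow a i := by rw [← hab, ← mul_assoc, ← epow_two, D.sq_mul]
  have hWa : W * a = epow a i := by rw [← haW, ← hab, mul_assoc, hba, hab]
  have hWb : W * b = epow a (k + 1) := by rw [← hab, mul_assoc, hbb, mul_epow a (by omega)]
  have hbW : b * W = epow a (k + 1) := by rw [← hba, ← mul_assoc, hbb, epow_mul_self a (by omega)]
  have hji : b * epow a 2 = epow a i := by rw [epow_two, ← mul_assoc, hba, hWa]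
  obtain ⟨u0, u3, u2, u2'⟩ := pairCode_spec hm fk
  obtain ⟨t1, t2, t3⟩ := tripleCode_spec (m := m) (s := 2 + β) (l := i) (by omega)
  have hu := D.elim_pairCode hk fk
  have pu := pairExp_pairCode fk
  set u := pairCode m (2 * β) k
  set t := tripleCode m (2 + β) i
  have hc : IsCode m β 0 0 u t := by constructor <;> omega
  refine ⟨β, 0, 0, u, t, hc, D.uni.areIso_tab₂ D.hm D.card hc hab hba (hbb.trans hu)
    ?_ ?_ ?_ ?_ ?_ ?_ ?_ D.surj⟩
  · simp only [extraExp, if_true, t1]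
    rw [haW, D.epow_eq_iff (by omega) (by omega)]
    omega
  · simp only [extraExp, if_true, t1]
    rw [hWa, D.epow_eq_iff (by omega) (by omega)]
    omega
  · simp only [extraExp', u0, if_false, pu]
    rw [hbW, D.epow_eq_iff (by omega) (by omega)]
    omega
  · simp only [extraExp', u0, if_false, pu]
    rw [hWb, D.epow_eq_iff (by omega) (by omega)]
    omega
  · rw [if_neg (by simp)]
    nth_rw 2 [← hab]
    rw [← mul_assoc, hWa, D.epow_mul_gen (by omega), D.epow_eq_iff (by omega) (by omega)]
    omega
  · simp only [sqExp, if_true, t1]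
    rw [D.sq_mul, D.epow_eq_iff (by omega) (by omega)]
    omega
  · simp only [sqExp, if_true, t1]
    rw [hji, D.epow_eq_iff (by omega) (by omega)]
    omega

/-- Since W is both ab and bb, one gets aW = Wb and Wa = b(ba). These force β = 1, or else β = m - 2
with a^2 b = 0 and ba in {a^m, 0}. -/
theorem hasCode_left_square_extra (D : Extraction a b W m β i j) {l : ℕ} (hl : 2 ≤ l)
    (hab : a * b = W) (hba : b * a = epow a l) (hbb : b * b = W) : HasCode S D.hm := by
  have hm := D.hm; have h1 := D.one_le; have h2 := D.le; have hi := D.hi; have hj := D.hj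
  have fl := D.exponent_right hl hba
  have haW : a * W = epow a i := by rw [← hab, ← mul_assoc, ← epow_two, D.sq_mul]
  have hWa : W * a = epow a (l + 1) := by rw [← hab, mul_assoc, hba, mul_epow a (by omega)]
  have hbW : b * W = epow a (l + β) := by rw [← hab, ← mul_assoc, hba, D.epow_mul_gen (by omega)]
  have hWb : W * b = epow a (l + β) := by rw [← hbW, ← hbb, mul_assoc]
  have e1 : epow a i = epow a (l + β) := by rw [← haW, ← hWb, ← hbb, ← mul_assoc, hab, hbb]
  have e2 : epow a (l + 1) = epow a (l + β) := by
    rw [← hWa, ← hbb, mul_assoc, hba, D.gen_mul_epow (by omega)]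
  rw [D.epow_eq_iff (by omega) (by omega)] at e1 e2
  obtain ⟨y0, y3, y2, y2'⟩ := pairCode_spec hm fl
  obtain ⟨t1, t2, t3⟩ := tripleCode_spec (m := m) (s := 2 + β) (l := i) (by omega)
  have hy := D.elim_pairCode hl fl
  have py := pairExp_pairCode fl
  set y := pairCode m (1 + β) l
  set t := tripleCode m (2 + β) i
  have hc : IsCode m β 0 y 0 t := by constructor <;> omega
  refine ⟨β, 0, y, 0, t, hc, D.uni.areIso_tab₂ D.hm D.card hc hab (hba.trans hy) hbb
    ?_ ?_ ?_ ?_ ?_ ?_ ?_ D.surj⟩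
  · simp only [extraExp, if_true, t1]
    rw [haW, D.epow_eq_iff (by omega) (by omega)]
    omega
  · simp only [extraExp, y0, if_true, if_false, py]
    rw [hWa, D.epow_eq_iff (by omega) (by omega)]
    omega
  · simp only [extraExp', y0, if_true, if_false, py]
    rw [hbW, D.epow_eq_iff (by omega) (by omega)]
    omega
  · simp only [extraExp', y0, if_true, if_false, py]
    rw [hWb, D.epow_eq_iff (by omega) (by omega)]
    omega
  · rw [if_neg (by simp)]
    nth_rw 2 [← hab]
    rw [← mul_assoc, hWa, D.epow_mul_gen (by omega), D.epow_eq_iff (by omega) (by omega)]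
    omega
  · simp only [sqExp, if_true, t1]
    rw [D.sq_mul, D.epow_eq_iff (by omega) (by omega)]
    omega
  · simp only [sqExp, y0, if_false, py]
    rw [epow_two, ← mul_assoc, hba, epow_mul_self a (by omega), D.epow_eq_iff (by omega) (by omega)]
    omega

theorem hasCode_right_square_extra (D : Extraction a b W m β i j) {l : ℕ} (hl : 2 ≤ l)
    (hab : a * b = epow a l) (hba : b * a = W) (hbb : b * b = W) : HasCode S D.hm := by
  have hm := D.hm; have h1 := D.one_le; have h2 := D.le; have hi := D.hi; have hj := D.hj
  have fl := D.exponent_left hl hab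
  have hWa : W * a = epow a j := by rw [← hba, mul_assoc, ← epow_two, D.mul_sq]
  have haW : a * W = epow a (l + 1) := by rw [← hba, ← mul_assoc, hab, epow_mul_self a (by omega)]
  have hWb : W * b = epow a (l + β) := by rw [← hba, mul_assoc, hab, D.gen_mul_epow (by omega)]
  have hbW : b * W = epow a (l + β) := by rw [← hWb, ← hbb, mul_assoc]
  have e1 : epow a j = epow a (l + β) := by rw [← hWa, ← hbW, ← hbb, mul_assoc, hba, hbb]
  have e2 : epow a (l + 1) = epow a (l + β) := by
    rw [← haW, ← hbb, ← mul_assoc, hab, D.epow_mul_gen (by omega)]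
  rw [D.epow_eq_iff (by omega) (by omega)] at e1 e2
  obtain ⟨x0, x3, x2, x2'⟩ := pairCode_spec hm fl
  obtain ⟨t1, t2, t3⟩ := tripleCode_spec (m := m) (s := 2 + β) (l := j) (by omega)
  have hx := D.elim_pairCode hl fl
  have px := pairExp_pairCode fl
  set x := pairCode m (1 + β) l
  set t := tripleCode m (2 + β) j
  have hc : IsCode m β x 0 0 t := by constructor <;> omega
  refine ⟨β, x, 0, 0, t, hc, D.uni.areIso_tab₂ D.hm D.card hc (hab.trans hx) hba hbb
    ?_ ?_ ?_ ?_ ?_ ?_ ?_ D.surj⟩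
  · simp only [extraExp, x0, if_true, if_false, px]
    rw [haW, D.epow_eq_iff (by omega) (by omega)]
    omega
  · simp only [extraExp, if_true, t1]
    rw [hWa, D.epow_eq_iff (by omega) (by omega)]
    omega
  · simp only [extraExp', x0, if_true, if_false, px]
    rw [hbW, D.epow_eq_iff (by omega) (by omega)]
    omega
  · simp only [extraExp', x0, if_true, if_false, px]
    rw [hWb, D.epow_eq_iff (by omega) (by omega)]
    omega
  · rw [if_neg (by simp)]
    nth_rw 1 [← hba]
    rw [mul_assoc, haW, D.gen_mul_epow (by omega), D.epow_eq_iff (by omega) (by omega)]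
    omega
  · simp only [sqExp, x0, if_false, px]
    rw [epow_two, mul_assoc, hab, mul_epow a (by omega), D.epow_eq_iff (by omega) (by omega)]
    omega
  · simp only [sqExp, if_true, t1]
    rw [D.mul_sq, D.epow_eq_iff (by omega) (by omega)]
    omega

/-- Evaluating a^2 b b with bb = ab gives exponents i + 1 and i + β, so β = 1 or the cap is reached,
that is β = m - 2. -/
theorem hasCode_all_extra (D : Extraction a b W m β i j)
    (hab : a * b = W) (hba : b * a = W) (hbb : b * b = W) : HasCode S D.hm := by
  have hm := D.hm; have h1 := D.one_le; have h2 := D.le; have hi := D.hi; have hj := D.hj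
  have haW : a * W = epow a i := by rw [← hab, ← mul_assoc, ← epow_two, D.sq_mul]
  have hWa : W * a = epow a i := by rw [← haW, ← hab, mul_assoc, hba, hab]
  have hWb : W * b = epow a i := by rw [← haW, ← hbb, ← mul_assoc, hab, hbb]
  have hbW : b * W = epow a i := by rw [← hWb, ← hbb, mul_assoc]
  have hji : b * epow a 2 = epow a i := by rw [epow_two, ← mul_assoc, hba, hWa]
  have e1 : epow a (i + 1) = epow a (i + β) := by
    rw [← mul_epow a (by omega), ← haW, ← mul_assoc, ← epow_two, ← D.epow_mul_gen (by omega),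
      ← D.sq_mul, mul_assoc, hbb]
  rw [D.epow_eq_iff (by omega) (by omega)] at e1
  obtain ⟨t1, t2, t3⟩ := tripleCode_spec (m := m) (s := 2 + β) (l := i) (by omega)
  set t := tripleCode m (2 + β) i
  have hc : IsCode m β 0 0 0 t := by constructor <;> omega
  refine ⟨β, 0, 0, 0, t, hc, D.uni.areIso_tab₂ D.hm D.card hc hab hba hbb
    ?_ ?_ ?_ ?_ ?_ ?_ ?_ D.surj⟩
  · simp only [extraExp, if_true, t1]
    rw [haW, D.epow_eq_iff (by omega) (by omega)]
    omega
  · simp only [extraExp, if_true, t1]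
    rw [hWa, D.epow_eq_iff (by omega) (by omega)]
    omega
  · simp only [extraExp', if_true, t1]
    rw [hbW, D.epow_eq_iff (by omega) (by omega)]
    omega
  · simp only [extraExp', if_true, t1]
    rw [hWb, D.epow_eq_iff (by omega) (by omega)]
    omega
  · rw [if_neg (by simp)]
    nth_rw 2 [← hab]
    rw [← mul_assoc, hWa, D.epow_mul_gen (by omega), D.epow_eq_iff (by omega) (by omega)]
    omega
  · simp only [sqExp, if_true, t1]
    rw [D.sq_mul, D.epow_eq_iff (by omega) (by omega)]
    omega
  · simp only [sqExp, if_true, t1]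
    rw [hji, D.epow_eq_iff (by omega) (by omega)]
    omega

end Extraction

end TwoGeneratorsExtraction

/-! ### The classification up to isomorphism by models. -/

section TwoGeneratorsExistence

variable {S : Type*} [Semigroup S] {m : ℕ}

theorem IsUniserial.hasCode {a : S} (h : IsUniserial a m) (hm : 4 ≤ m)
    (hcard : Nat.card S = m + 3) (hsub : ∀ l, 2 ≤ l → (layer S l).Subsingleton)
    (h0 : (layer S 0).ncard = 2) (h1 : (layer S 1).ncard = 2) : Extraction.HasCode S hm := by
  obtain ⟨b, hb⟩ : ∃ b, layer S 0 = {a, b} := by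
    obtain ⟨p, q, -, hpq⟩ := Set.ncard_eq_two.1 h0
    have ha : a ∈ layer S 0 := h.mem 0 (by omega)
    rw [hpq] at ha
    rcases ha with rfl | rfl
    · exact ⟨q, hpq⟩
    · exact ⟨p, by rw [hpq, Set.pair_comm]⟩
  obtain ⟨W, hWne, hW⟩ : ∃ W, W ≠ epow a 2 ∧ layer S 1 = {epow a 2, W} := by
    obtain ⟨p, q, hne, hpq⟩ := Set.ncard_eq_two.1 h1
    have ha : epow a 2 ∈ layer S 1 := h.mem 1 (by omega)
    rw [hpq] at ha
    rcases ha with ha | ha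
    · exact ⟨q, fun h => hne (ha.symm.trans h.symm), by rw [hpq, ha]⟩
    · exact ⟨p, fun h => hne (h.trans ha), by rw [hpq, ha, Set.pair_comm]⟩
  have hdeep : ∀ s ∈ mulPow S 2, ∃ j, 3 ≤ j ∧ s = epow a j := fun s hs => h.mem_mulPow hsub hs
  have hprod : ∀ s ∈ mulPow S 1, s = W ∨ ∃ j, 2 ≤ j ∧ s = epow a j := by
    intro s hs
    by_cases hs2 : s ∈ mulPow S 2
    · obtain ⟨j, hj, h⟩ := hdeep s hs2
      exact .inr ⟨j, by omega, h⟩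
    · have : s ∈ layer S 1 := ⟨hs, hs2⟩
      rw [hW] at this
      rcases this with h | h
      · exact .inr ⟨2, le_rfl, h⟩
      · exact .inl h
  have hprod' : ∀ s t : S, s * t = W ∨ ∃ j, 2 ≤ j ∧ s * t = epow a j := fun s t =>
    hprod _ (mul_mem_mulPow (i := 0) (j := 0) trivial trivial)
  have h3 : ∀ s t u : S, ∃ j, 3 ≤ j ∧ s * t * u = epow a j := fun s t u =>
    hdeep _ (mul_mem_mulPow (i := 1) (j := 0) (mul_mem_mulPow (i := 0) (j := 0) trivial trivial)
      trivial)
  obtain ⟨i, hi, haab⟩ := h3 a a b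
  obtain ⟨j, hj, hbaa⟩ := h3 b a a
  obtain ⟨k, hk, haba⟩ := h3 a b a
  -- Comparing aab and baa with aba after multiplying by a shows that b has the same weight on both
  -- sides.
  have e1 : epow a (i + 1) = epow a (k + 1) := by
    rw [← Extraction.epow_mul_self a (by omega), ← haab, ← Extraction.mul_epow a (by omega), ← haba]
    simp only [mul_assoc]
  have e2 : epow a (j + 1) = epow a (k + 1) := by
    rw [← Extraction.mul_epow a (by omega), ← hbaa, ← Extraction.epow_mul_self a (by omega), ← haba]
    simp only [mul_assoc]
  rw [h.epow_eq_iff (by omega) (by omega)] at e1 e2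
  -- The weight comes from a^2 b = a^i; the cap merges a^m and 0 into the largest weight m - 2.
  have D : Extraction a b W m (min i m - 2) i j :=
    { uni := h
      hm := hm
      card := hcard
      one_le := by omega
      le := by omega
      hi := by omega
      hj := by omega
      sq_mul := haab
      mul_sq := by rw [epow_two, ← mul_assoc, hbaa]
      surj := by
        intro s
        by_cases hs : s ∈ mulPow S 1
        · rcases hprod s hs with h | h
          · exact .inl (.inr (.inr h))
          · exact .inr h
        · have : s ∈ layer S 0 := ⟨trivial, hs⟩
          rw [hb] at this
          rcases this with h | h
          · exact .inl (.inl h)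
          · exact .inl (.inr (.inl h)) }
  rcases hprod' a b with hab | ⟨l, hl, hab⟩ <;> rcases hprod' b a with hba | ⟨l', hl', hba⟩ <;>
    rcases hprod' b b with hbb | ⟨n, hn, hbb⟩
  · exact D.hasCode_all_extra hab hba hbb
  · exact D.hasCode_commuting_extra hn hab hba hbb
  · exact D.hasCode_left_square_extra hl' hab hba hbb
  · exact D.hasCode_left_extra hl' hn hab hba hbb
  · exact D.hasCode_right_square_extra hl hab hba hbb
  · exact D.hasCode_right_extra hl hn hab hba hbb
  · obtain ⟨g, hg, hbbb⟩ := h3 b b b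
    exact D.hasCode_square_extra hl hl' hg hab hba hbb (by rw [← hbb, ← mul_assoc, hbbb])
  -- W is a product of two generators, so all three products cannot be powers of a: a^2 is excluded
  -- by the choice of W, and higher powers lie too deep.
  · exfalso
    have hW1 : W ∈ layer S 1 := by rw [hW]; exact .inr rfl
    obtain ⟨s, hs, t, ht, hst⟩ := exists_mul_eq_of_mem_layer (i := 0) (j := 0) hW1
    rw [hb] at hs ht
    obtain ⟨r, hr, hWr⟩ : ∃ r, 2 ≤ r ∧ W = epow a r := by
      rw [← hst]
      rcases hs with rfl | rfl <;> rcases ht with rfl | rfl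
      · exact ⟨2, le_rfl, rfl⟩
      · exact ⟨l, hl, hab⟩
      · exact ⟨l', hl', hba⟩
      · exact ⟨n, hn, hbb⟩
    rcases hr.eq_or_lt with rfl | hr
    · exact hWne hWr
    · apply hW1.2
      rw [hWr]
      exact mulPow_antitone (show 1 + 1 ≤ r - 1 by omega) (spow_mem_mulPow a (r - 1))

theorem exists_areIso_of_coclass_two (hm : 4 ≤ m) [Finite S] (h : IsNilpotentOfClass S m)
    (hcard : Nat.card S = m + 3) :
    (∃ (w : Fin 3 → ℕ) (hw : ∀ x, 1 ≤ w x) (e : Fin 3 → Fin 3 → Bool), (∀ x, w x < m) ∧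
      (∃ i, w i = 1) ∧ AreIso (tab₁ hm w hw e).Mod S) ∨
    ∃ (β x y u t : ℕ) (hc : IsCode m β x y u t), AreIso (tab₂ hm hc).Mod S := by
  obtain ⟨hsub, h0 | h0⟩ := layer_ncard_of_coclass_two hm h hcard
  · obtain ⟨a, ha⟩ := exists_isUniserial hm h hsub
    left
    refine ha.exists_tab₁ hm hcard (fun l hl => ?_) h0.1
    rcases hl.eq_or_lt with rfl | hl
    · rw [← Set.ncard_le_one_iff_subsingleton]; exact h0.2.le
    · exact hsub l hl
  · obtain ⟨a, ha⟩ := exists_isUniserial hm h hsub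
    exact .inr (ha.hasCode hm hcard hsub h0.1 h0.2)

end TwoGeneratorsExistence

/-! ### The two coincidences among codes with β = 1. -/

section Swap

variable {m : ℕ} (hm : 4 ≤ m)

theorem isCode_one {x y u : ℕ} (hm : 4 ≤ m) (hx : x ≤ 1) (hy : y ≤ 1) (hu : u ≤ 1)
    (h : x = 0 ∨ y = 0 ∨ u = 0) : IsCode m 1 x y u 0 := by
  constructor <;> omega

theorem pairExp_two_one (hm : 4 ≤ m) : pairExp m 2 1 = 2 := by
  unfold pairExp
  omega

/-- In the second semigroup ab = ba = a^2 and bb = W. With b as first generator, W becomes its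
square and the old a^2 becomes the extra element; cubes and higher powers are unchanged. -/
theorem areIso_swap_of_square_extra (h : IsCode m 1 0 0 0 0) (h' : IsCode m 1 1 1 0 0) :
    AreIso (tab₂ hm h).Mod (tab₂ hm h').Mod := by
  have hp := pairExp_two_one hm
  have h3 : min 3 m = 3 := by omega
  set T := tab₂ hm h' with hT
  have m00 : T.gen 0 * T.gen 0 = T.pw 2 := rfl
  have m11 : T.gen 1 * T.gen 1 = T.gen 2 := rfl
  have m01 : T.gen 0 * T.gen 1 = T.pw 2 := congrArg T.pw hp
  have m10 : T.gen 1 * T.gen 0 = T.pw 2 := congrArg T.pw hp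
  have l2 : T.l 2 = 2 := by
    change extraExp m 1 1 1 0 - 1 = 2
    simp [extraExp, hp]
  have l1 : T.l 1 = 1 := by
    change sqExp m 1 1 0 - 2 = 1
    simp [sqExp, hp]
  have r2 : T.r 2 = 2 := l2
  have r1 : T.r 1 = 1 := l1
  have l0 : T.l 0 = 1 := rfl
  have r0 : T.r 0 = 1 := rfl
  have m22 : T.gen 2 * T.gen 2 = T.pw 4 := rfl
  have m12 : T.gen 1 * T.gen 2 = T.pw 3 := by
    refine congrArg T.pw (show extraExp' m 1 1 1 0 0 = 3 from ?_)
    simp [extraExp', h3]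
  have m21 : T.gen 2 * T.gen 1 = T.pw 3 := m12
  have m02 : T.gen 0 * T.gen 2 = T.pw 3 := by
    refine congrArg T.pw (show extraExp m 1 1 1 0 = 3 from ?_)
    simp [extraExp, hp]
  have m20 : T.gen 2 * T.gen 0 = T.pw 3 := m02
  have ex : extraExp m 1 0 0 0 = 3 := by simp [extraExp, h3]
  have ex' : extraExp' m 1 0 0 0 0 = 3 := by simp [extraExp', h3]
  have sq : sqExp m 1 0 0 = 3 := by simp [sqExp, h3]
  refine Tab.equivOf _ T.card_mod ![T.gen 1, T.gen 0, T.pw 2]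
    (fun k => if k = 2 then T.gen 2 else T.pw k) (fun i j hi hj => ?_) (fun i j hij => ?_)
    (forall_fin_three (forall_fin_three ?_ ?_ ?_) (forall_fin_three ?_ ?_ ?_)
      (forall_fin_three ?_ ?_ ?_)) (fun k x hk => ?_) (fun k x hk => ?_) (fun s => ?_)
  · rw [if_neg (by omega : i + j ≠ 2)]
    split_ifs with h1 h2 h2
    · rw [m22, h1, h2]
    · rw [T.gen_mul_pw hj, r2, h1]
    · rw [T.pw_mul_gen hi, l2, h2]
    · rw [T.pw_mul_pw hi hj]
  · rcases hij with rfl | hij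
    · rfl
    · rw [if_neg (by omega), if_neg (by omega), T.pw_congr (.inr hij)]
  · exact m11
  · exact m10
  · change T.gen 1 * T.pw 2 = if extraExp m 1 0 0 0 = 2 then _ else T.pw (extraExp m 1 0 0 0)
    rw [ex, T.gen_mul_pw le_rfl, r1]; rfl
  · exact m01
  · exact m00
  · change T.gen 0 * T.pw 2 = if extraExp' m 1 0 0 0 0 = 2 then _ else T.pw (extraExp' m 1 0 0 0 0)
    rw [ex', T.gen_mul_pw le_rfl, r0]; rfl
  · change T.pw 2 * T.gen 1 = if extraExp m 1 0 0 0 = 2 then _ else T.pw (extraExp m 1 0 0 0)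
    rw [ex, T.pw_mul_gen le_rfl, l1]; rfl
  · change T.pw 2 * T.gen 0 = if extraExp' m 1 0 0 0 0 = 2 then _ else T.pw (extraExp' m 1 0 0 0 0)
    rw [ex', T.pw_mul_gen le_rfl, l0]; rfl
  · exact T.pw_mul_pw le_rfl le_rfl
  · revert x
    refine forall_fin_three ?_ ?_ ?_
    · change (if k = 2 then T.gen 2 else T.pw k) * T.gen 1 = if k + 1 = 2 then _ else T.pw (k + 1)
      rw [if_neg (by omega : k + 1 ≠ 2)]
      split_ifs with h1
      · rw [m21, h1]
      · rw [T.pw_mul_gen hk, l1]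
    · change (if k = 2 then T.gen 2 else T.pw k) * T.gen 0 =
        if k + (sqExp m 1 0 0 - 2) = 2 then _ else T.pw (k + (sqExp m 1 0 0 - 2))
      rw [sq, if_neg (by omega : k + (3 - 2) ≠ 2)]
      split_ifs with h1
      · rw [m20, h1]
      · rw [T.pw_mul_gen hk, l0]
    · change (if k = 2 then T.gen 2 else T.pw k) * T.pw 2 =
        if k + (extraExp m 1 0 0 0 - 1) = 2 then _ else T.pw (k + (extraExp m 1 0 0 0 - 1))
      rw [ex, if_neg (by omega : k + (3 - 1) ≠ 2)]
      split_ifs with h1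
      · rw [T.gen_mul_pw le_rfl, r2, h1]
      · rw [T.pw_mul_pw hk le_rfl]
  · revert x
    refine forall_fin_three ?_ ?_ ?_
    · change T.gen 1 * (if k = 2 then T.gen 2 else T.pw k) = if 1 + k = 2 then _ else T.pw (1 + k)
      rw [if_neg (by omega : 1 + k ≠ 2)]
      split_ifs with h1
      · rw [m12, h1]
      · rw [T.gen_mul_pw hk, r1]
    · change T.gen 0 * (if k = 2 then T.gen 2 else T.pw k) =
        if (sqExp m 1 0 0 - 2) + k = 2 then _ else T.pw ((sqExp m 1 0 0 - 2) + k)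
      rw [sq, if_neg (by omega : 3 - 2 + k ≠ 2)]
      split_ifs with h1
      · rw [m02, h1]
      · rw [T.gen_mul_pw hk, r0]
    · change T.pw 2 * (if k = 2 then T.gen 2 else T.pw k) =
        if (extraExp m 1 0 0 0 - 1) + k = 2 then _ else T.pw ((extraExp m 1 0 0 0 - 1) + k)
      rw [ex, if_neg (by omega : 3 - 1 + k ≠ 2)]
      split_ifs with h1
      · rw [T.pw_mul_gen le_rfl, l2, h1]
      · rw [T.pw_mul_pw le_rfl hk]
  · rcases T.cases s with ⟨x, rfl⟩ | ⟨k, hk, -, rfl⟩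
    · revert x
      exact forall_fin_three (.inl ⟨1, rfl⟩) (.inl ⟨0, rfl⟩) (.inr ⟨2, le_rfl, rfl⟩)
    · by_cases h2 : k = 2
      · exact .inl ⟨2, by rw [h2]; rfl⟩
      · exact .inr ⟨k, hk, by rw [if_neg h2]⟩

/-- Here bb = a^2, so exchanging a and b keeps all powers and W in place and only interchanges ab
with ba. -/
theorem areIso_swap_of_right_extra (h : IsCode m 1 0 1 1 0) (h' : IsCode m 1 1 0 1 0) :
    AreIso (tab₂ hm h).Mod (tab₂ hm h').Mod := by
  have hp := pairExp_two_one hm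
  have h3 : min 3 m = 3 := by omega
  set T := tab₂ hm h' with hT
  have m00 : T.gen 0 * T.gen 0 = T.pw 2 := rfl
  have m11 : T.gen 1 * T.gen 1 = T.pw 2 := congrArg T.pw hp
  have m01 : T.gen 0 * T.gen 1 = T.pw 2 := congrArg T.pw hp
  have ex : extraExp m 1 0 1 0 = 3 := by simp [extraExp, h3]
  have ex2 : extraExp m 1 1 0 0 = 3 := by simp [extraExp, hp]
  have ex' : extraExp' m 1 0 1 1 0 = 3 := by simp [extraExp', hp]
  have ex2' : extraExp' m 1 1 0 1 0 = 3 := by simp [extraExp', hp]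
  have sq : sqExp m 1 0 0 = 3 := by simp [sqExp, h3]
  have sq1 : sqExp m 1 1 0 = 3 := by simp [sqExp, hp]
  have hl : T.l = wt₂ 1 2 := by
    change wt₂ (sqExp m 1 1 0 - 2) (extraExp m 1 1 0 0 - 1) = _
    rw [sq1, ex2]
  have hr : T.r = wt₂ 1 2 := by
    change wt₂ (sqExp m 1 0 0 - 2) (extraExp m 1 0 1 0 - 1) = _
    rw [sq, ex]
  have hl' : (tab₂ hm h).l = wt₂ 1 2 := by
    change wt₂ (sqExp m 1 0 0 - 2) (extraExp m 1 0 1 0 - 1) = _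
    rw [sq, ex]
  have hr' : (tab₂ hm h).r = wt₂ 1 2 := by
    change wt₂ (sqExp m 1 1 0 - 2) (extraExp m 1 1 0 0 - 1) = _
    rw [sq1, ex2]
  have ev2 : T.pw (pairExp m 2 1) = T.pw 2 := by rw [hp]
  refine Tab.equivOf _ T.card_mod ![T.gen 1, T.gen 0, T.gen 2] T.pw
    (fun i j hi hj => T.pw_mul_pw hi hj) (fun i j hij => T.pw_congr hij)
    (forall_fin_three (forall_fin_three ?_ ?_ ?_) (forall_fin_three ?_ ?_ ?_)
      (forall_fin_three ?_ ?_ ?_)) (fun k x hk => ?_) (fun k x hk => ?_) (fun s => ?_)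
  · exact m11
  · rfl
  · change T.pw (extraExp' m 1 1 0 1 0) = T.pw (extraExp m 1 0 1 0)
    rw [ex2', ex]
  · exact m01.trans ev2.symm
  · exact m00.trans ev2.symm
  · change T.pw (extraExp m 1 1 0 0) = T.pw (extraExp' m 1 0 1 1 0)
    rw [ex2, ex']
  · change T.pw (extraExp' m 1 1 0 1 0) = T.pw (extraExp m 1 1 0 0)
    rw [ex2', ex2]
  · change T.pw (extraExp m 1 0 1 0) = T.pw (extraExp' m 1 0 1 1 0)
    rw [ex, ex']
  · rfl
  · rw [hl']
    revert x
    refine forall_fin_three ?_ ?_ ?_ <;> exact (T.pw_mul_gen hk _).trans (by rw [hl]; try rfl)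
  · rw [hr']
    revert x
    refine forall_fin_three ?_ ?_ ?_ <;> exact (T.gen_mul_pw hk _).trans (by rw [hr]; try rfl)
  · rcases T.cases s with ⟨x, rfl⟩ | ⟨k, hk, -, rfl⟩
    · revert x
      exact forall_fin_three (.inl ⟨1, rfl⟩) (.inl ⟨0, rfl⟩) (.inl ⟨2, rfl⟩)
    · exact .inr ⟨k, hk, rfl⟩

end Swap

/-! ### Numerical codes and the effect of isomorphism and duality on them. -/

section Codes

theorem AreIso.symm {S T : Type*} [Semigroup S] [Semigroup T] (h : AreIso S T) : AreIso T S := by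
  obtain ⟨e⟩ := h; exact ⟨e.symm⟩

theorem AreIso.trans {S T U : Type*} [Semigroup S] [Semigroup T] [Semigroup U] (h : AreIso S T)
    (h' : AreIso T U) : AreIso S U := by
  obtain ⟨e⟩ := h; obtain ⟨f⟩ := h'; exact ⟨e.trans f⟩

theorem AreAntiIso.trans_iso {S T U : Type*} [Semigroup S] [Semigroup T] [Semigroup U]
    (h : AreAntiIso S T) (h' : AreIso T U) : AreAntiIso S U := by
  obtain ⟨e⟩ := h; obtain ⟨f⟩ := h'; exact ⟨e.trans (MulEquiv.op f)⟩

theorem AreAntiIso.symm {S T : Type*} [Semigroup S] [Semigroup T] (h : AreAntiIso S T) :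
    AreAntiIso T S := by
  obtain ⟨e⟩ := h; exact ⟨(MulEquiv.opOp T).trans (MulEquiv.op e.symm)⟩

theorem AreAntiIso.trans {S T U : Type*} [Semigroup S] [Semigroup T] [Semigroup U]
    (h : AreAntiIso S T) (h' : AreAntiIso T U) : AreIso S U := by
  obtain ⟨e⟩ := h; obtain ⟨f⟩ := h'
  exact ⟨(e.trans (MulEquiv.op f)).trans (MulEquiv.opOp U).symm⟩

/-- The Boolean matrix encoded by a number. -/
def bits (k : ℕ) (x y : Fin 3) : Bool := k.testBit (3 * x.1 + y.1)

/-- The number encoding a Boolean matrix. -/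
def enc (e : Fin 3 → Fin 3 → Bool) : ℕ :=
  Nat.ofBits fun i : Fin 9 => e ⟨i.1 / 3, by omega⟩ ⟨i.1 % 3, by omega⟩

theorem enc_lt (e : Fin 3 → Fin 3 → Bool) : enc e < 512 := Nat.ofBits_lt_two_pow _

theorem bits_enc (e : Fin 3 → Fin 3 → Bool) : bits (enc e) = e := by
  funext x y
  unfold bits enc
  rw [Nat.testBit_ofBits_lt _ _ (by omega)]
  congr 1 <;> (ext; simp <;> omega)

theorem bits_injOn {k k' : ℕ} (hk : k < 512) (hk' : k' < 512) (h : bits k = bits k') : k = k' := by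
  apply Nat.eq_of_testBit_eq
  intro i
  by_cases hi : i < 9
  · have := congrFun (congrFun h ⟨i / 3, by omega⟩) ⟨i % 3, by omega⟩
    simp only [bits] at this
    rwa [Nat.div_add_mod] at this
  · rw [Nat.testBit_lt_two_pow (hk.trans_le ?_), Nat.testBit_lt_two_pow (hk'.trans_le ?_)] <;>
      exact Nat.pow_le_pow_right (n := 2) (i := 9) (by omega) (by omega)

/-- Relabelling of an encoded matrix. -/
def act (σ : Fin 3 → Fin 3) (k : ℕ) : ℕ := enc fun x y => bits k (σ x) (σ y)

/-- Transposition of an encoded matrix. -/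
def transp (k : ℕ) : ℕ := enc fun x y => bits k y x

theorem bits_act (σ : Fin 3 → Fin 3) (k : ℕ) : bits (act σ k) = fun x y => bits k (σ x) (σ y) :=
  bits_enc _

theorem bits_transp (k : ℕ) : bits (transp k) = fun x y => bits k y x := bits_enc _

theorem act_lt (σ : Fin 3 → Fin 3) (k : ℕ) : act σ k < 512 := enc_lt _

theorem transp_lt (k : ℕ) : transp k < 512 := enc_lt _

theorem transp_transp {k : ℕ} (hk : k < 512) : transp (transp k) = k := by
  apply bits_injOn (transp_lt _) hk
  rw [bits_transp, bits_transp]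

/-- The weights of the three generators. -/
def wts (p q : ℕ) : Fin 3 → ℕ := ![1, p, q]

/-- Codes of semigroups with three generators. -/
structure Valid₁ (m p q k : ℕ) : Prop where
  one_le : 1 ≤ p
  le : p ≤ q
  lt : q < m
  lt' : k < 512
  mask : ∀ x y, bits k x y = true → m ≤ wts p q x + wts p q y

variable {m : ℕ} (hm : 4 ≤ m)

/-- The semigroup `S` is described by a code with three generators. -/
def Has₁ (p q k : ℕ) (S : Type) [Semigroup S] : Prop :=
  ∃ hw : ∀ x, 1 ≤ wts p q x, AreIso (tab₁ hm (wts p q) hw (bits k)).Mod S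

/-- The semigroup `S` is described by a code with two generators. -/
def Has₂ (β x y u t : ℕ) (S : Type) [Semigroup S] : Prop :=
  ∃ h : IsCode m β x y u t, AreIso (tab₂ hm h).Mod S

theorem one_le_wts {p q : ℕ} (hp : 1 ≤ p) (hq : 1 ≤ q) : ∀ x, 1 ≤ wts p q x :=
  forall_fin_three le_rfl hp hq

theorem monotone_wts {p q : ℕ} (hp : 1 ≤ p) (hq : p ≤ q) : Monotone (wts p q) := by
  have : ∀ i j : Fin 3, i ≤ j → wts p q i ≤ wts p q j := by
    refine forall_fin_three (forall_fin_three ?_ ?_ ?_) (forall_fin_three ?_ ?_ ?_)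
      (forall_fin_three ?_ ?_ ?_) <;> intro h <;> simp [wts] at h ⊢ <;> omega
  exact fun i j => this i j

theorem tab₁_congr {w : Fin 3 → ℕ} (hw : ∀ x, 1 ≤ w x) {e e' : Fin 3 → Fin 3 → Bool}
    (h : ∀ x y, m ≤ w x + w y → e x y = e' x y) : tab₁ hm w hw e = tab₁ hm w hw e' := by
  have : (fun x y => (Sum.inr (expo m (w x) (w y) (e x y)) : Fin 3 ⊕ ℕ)) =
      fun x y => .inr (expo m (w x) (w y) (e' x y)) := by
    funext x y
    by_cases hxy : m ≤ w x + w y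
    · rw [h x y hxy]
    · unfold expo
      rw [if_pos (by omega), if_pos (by omega)]
  unfold tab₁
  simp only [this]

theorem tab₁_perm_of_eq {w w' : Fin 3 → ℕ} (hw : ∀ x, 1 ≤ w x) (hw' : ∀ x, 1 ≤ w' x)
    {e e' : Fin 3 → Fin 3 → Bool} (σ : Equiv.Perm (Fin 3)) (h : w' = w ∘ σ)
    (he : e' = fun x y => e (σ x) (σ y)) :
    AreIso (tab₁ hm w' hw' e').Mod (tab₁ hm w hw e).Mod := by
  subst h he
  exact tab₁_perm hm w hw e σ

theorem exists_has₁ {S : Type} [Semigroup S] {w : Fin 3 → ℕ} {hw : ∀ x, 1 ≤ w x}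
    {e : Fin 3 → Fin 3 → Bool} (hwm : ∀ x, w x < m) (hi : ∃ i, w i = 1)
    (h : AreIso (tab₁ hm w hw e).Mod S) : ∃ p q k, Valid₁ m p q k ∧ Has₁ hm p q k S := by
  obtain ⟨i, hi⟩ := hi
  set σ := Tuple.sort w
  have hmon : Monotone (w ∘ σ) := Tuple.monotone_sort w
  have h0 : w (σ 0) = 1 := by
    have := hmon (Fin.zero_le (σ.symm i))
    simp only [Function.comp, Equiv.apply_symm_apply, hi] at this
    have := hw (σ 0)
    omega
  have hws : wts (w (σ 1)) (w (σ 2)) = w ∘ σ := by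
    funext x
    revert x
    exact forall_fin_three h0.symm rfl rfl
  have h12 : w (σ 1) ≤ w (σ 2) := hmon (show (1 : Fin 3) ≤ 2 by decide)
  -- Bits at positions where the product is forced are irrelevant to the table; clearing them makes
  -- the code a normal form.
  set k := enc fun x y => decide (m ≤ w (σ x) + w (σ y)) && e (σ x) (σ y)
  refine ⟨w (σ 1), w (σ 2), k, ⟨hw _, h12, hwm _, enc_lt _, ?_⟩, one_le_wts (hw _) (hw _), ?_⟩
  · intro x y hxy
    rw [bits_enc] at hxy
    rw [hws]
    simp at hxy
    exact hxy.1
  · refine AreIso.trans ?_ h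
    rw [tab₁_congr hm _ (e' := fun x y => e (σ x) (σ y))]
    · exact tab₁_perm_of_eq hm hw _ σ hws rfl
    · intro x y hxy
      rw [hws] at hxy
      rw [bits_enc]
      simp only [Function.comp] at hxy
      simp [hxy]

variable {S T : Type} [Semigroup S] [Semigroup T] {p q k p' q' k' : ℕ}

/-- Weights are determined up to permutation, and sorted tuples that are permutations of each other
coincide. The bits agree on free positions by `tab₁_iso` and vanish elsewhere by the mask. -/
theorem Has₁.unique (hv : Valid₁ m p q k) (hv' : Valid₁ m p' q' k') (h : Has₁ hm p q k S)
    (h' : Has₁ hm p' q' k' S) : p = p' ∧ q = q' ∧ ∃ σ : Equiv.Perm (Fin 3),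
      (∀ x, wts p q (σ x) = wts p q x) ∧ ∀ x y, bits k x y = bits k' (σ x) (σ y) := by
  obtain ⟨hw, h⟩ := h
  obtain ⟨hw', h'⟩ := h'
  have b1 := hv.one_le; have b2 := hv.le; have b3 := hv.lt
  have b1' := hv'.one_le; have b2' := hv'.le; have b3' := hv'.lt
  obtain ⟨σ, h1, h2⟩ := tab₁_iso hm (w := wts p q) (w' := wts p' q')
    (forall_fin_three (by change 1 < m; omega) (by change p < m; omega) (by change q < m; omega))
    (forall_fin_three (by change 1 < m; omega) (by change p' < m; omega) (by change q' < m; omega))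
    (i := 0) (i' := 0) rfl rfl (h.trans h'.symm)
  have hcomp : wts p' q' ∘ σ = wts p q := funext h1
  have heq : wts p' q' = wts p q := by
    rw [← hcomp]
    refine Tuple.unique_monotone (σ := 1) (τ := σ) (monotone_wts b1' b2') ?_
    exact hcomp ▸ monotone_wts b1 b2
  refine ⟨(congrFun heq 1).symm, (congrFun heq 2).symm, σ, fun x => by rw [← h1 x, heq], ?_⟩
  intro x y
  by_cases hxy : m ≤ wts p q x + wts p q y
  · exact h2 x y hxy
  · have e1 : bits k x y = false := by
      by_contra hne
      exact hxy (hv.mask x y (by simpa using hne))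
    have e2 : bits k' (σ x) (σ y) = false := by
      by_contra hne
      have := hv'.mask _ _ (by simpa using hne)
      rw [h1, h1] at this
      exact hxy this
    rw [e1, e2]

theorem Valid₁.act (hv : Valid₁ m p q k) (σ : Fin 3 → Fin 3) (hσ : wts p q ∘ σ = wts p q) :
    Valid₁ m p q (act σ k) := by
  refine ⟨hv.one_le, hv.le, hv.lt, enc_lt _, fun x y hxy => ?_⟩
  rw [bits_act] at hxy
  have := hv.mask _ _ hxy
  rwa [← hσ]

theorem Has₁.act (h : Has₁ hm p q k S) (σ : Equiv.Perm (Fin 3)) (hσ : wts p q ∘ σ = wts p q) :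
    Has₁ hm p q (act σ k) S := by
  obtain ⟨hw, h⟩ := h
  exact ⟨hw, (tab₁_perm_of_eq hm hw hw σ hσ.symm (bits_act _ _)).trans h⟩

theorem Valid₁.transp (hv : Valid₁ m p q k) : Valid₁ m p q (transp k) := by
  refine ⟨hv.one_le, hv.le, hv.lt, enc_lt _, fun x y hxy => ?_⟩
  rw [bits_transp] at hxy
  rw [add_comm]
  exact hv.mask _ _ hxy

theorem Has₁.anti (h : Has₁ hm p q k S) (hTS : AreAntiIso T S) : Has₁ hm p q (transp k) T := by
  obtain ⟨hw, h⟩ := h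
  refine ⟨hw, ?_⟩
  have := tab₁_op hm (wts p q) hw (bits k)
  rw [bits_transp]
  exact (this.trans_iso h).trans hTS.symm

theorem Has₁.comm_iff (hv : Valid₁ m p q k) (h : Has₁ hm p q k S) :
    (∀ s t : S, s * t = t * s) ↔ transp k = k := by
  obtain ⟨hw, ⟨φ⟩⟩ := h
  have h1 : (∀ s t : S, s * t = t * s) ↔
      ∀ s t : (tab₁ hm (wts p q) hw (bits k)).Mod, s * t = t * s := by
    constructor
    · intro h s t
      apply φ.injective
      rw [map_mul, map_mul, h]
    · intro h s t
      apply φ.symm.injective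
      rw [map_mul, map_mul, h]
  rw [h1, tab₁_mul_comm_iff]
  constructor
  · intro h
    apply bits_injOn (transp_lt _) hv.lt'
    rw [bits_transp]
    funext x y
    by_cases hxy : m ≤ wts p q x + wts p q y
    · exact (h x y hxy).symm
    · have e1 : bits k x y = false := by
        by_contra hne
        exact hxy (hv.mask x y (by simpa using hne))
      have e2 : bits k y x = false := by
        by_contra hne
        exact hxy (by rw [add_comm]; exact hv.mask y x (by simpa using hne))
      rw [e1, e2]
  · intro h x y _
    conv_lhs => rw [← h, bits_transp]

theorem Has₁.congr (h : Has₁ hm p q k S) (hST : AreIso S T) : Has₁ hm p q k T := by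
  obtain ⟨hw, h⟩ := h
  exact ⟨hw, h.trans hST⟩

theorem Has₁.iso (h : Has₁ hm p q k S) (h' : Has₁ hm p q k T) : AreIso S T := by
  obtain ⟨hw, h⟩ := h
  obtain ⟨hw', h'⟩ := h'
  exact h.symm.trans h'

variable {β x y u t β' x' y' u' t' : ℕ}

theorem Has₂.congr (h : Has₂ hm β x y u t S) (hST : AreIso S T) : Has₂ hm β x y u t T := by
  obtain ⟨hw, h⟩ := h
  exact ⟨hw, h.trans hST⟩

theorem Has₂.iso (h : Has₂ hm β x y u t S) (h' : Has₂ hm β x y u t T) : AreIso S T := by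
  obtain ⟨hw, h⟩ := h
  obtain ⟨hw', h'⟩ := h'
  exact h.symm.trans h'

theorem Has₂.unique (h : Has₂ hm β x y u t S) (h' : Has₂ hm β' x' y' u' t' S) :
    (β = β' ∧ x = x' ∧ y = y' ∧ u = u' ∧ t = t') ∨
      (β = 1 ∧ β' = 1 ∧ (x = 1 ↔ y' = u') ∧ (y = 1 ↔ x' = u') ∧ (u = 1 ↔ u' = 1)) := by
  obtain ⟨hc, h⟩ := h
  obtain ⟨hc', h'⟩ := h'
  exact tab₂_iso hm (h.trans h'.symm)

theorem Has₂.anti (h : Has₂ hm β x y u t S) (hTS : AreAntiIso T S) : Has₂ hm β y x u t T := by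
  obtain ⟨hc, h⟩ := h
  exact ⟨hc.symm, ((tab₂_op hm hc).trans_iso h).trans hTS.symm⟩

theorem Has₂.comm_iff (h : Has₂ hm β x y u t S) : (∀ s t : S, s * t = t * s) ↔ x = y := by
  obtain ⟨hc, ⟨φ⟩⟩ := h
  rw [← tab₂_mul_comm_iff hm hc]
  constructor
  · intro h s t
    apply φ.injective
    rw [map_mul, map_mul, h]
  · intro h s t
    apply φ.symm.injective
    rw [map_mul, map_mul, h]

theorem Has₁.not_has₂ (h : Has₁ hm p q k S) : ¬ Has₂ hm β x y u t S := by
  rintro ⟨hc, h'⟩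
  obtain ⟨hw, h⟩ := h
  exact not_areIso_tab₁_tab₂ hm hw _ hc (h.trans h'.symm)

end Codes

/-! ### One canonical code for each class. -/

section Representatives

/-- The relation R says that a label describes an object. The hypotheses make it a bijection between
labels in F and classes, so the three counts differ only in the choice of F and R. -/
theorem Nat.card_quotient_eq_card_finset {α : Type*} {κ : Type*} (s : Setoid α) (F : Finset κ)
    (R : κ → α → Prop) (h₁ : ∀ k ∈ F, ∃ a, R k a) (h₂ : ∀ a, ∃ k ∈ F, R k a)
    (h₃ : ∀ k a b, R k a → s a b → R k b) (h₄ : ∀ k a b, R k a → R k b → s a b)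
    (h₅ : ∀ k ∈ F, ∀ k' ∈ F, ∀ a, R k a → R k' a → k = k') :
    Nat.card (Quotient s) = F.card := by
  choose f hfF hf using h₂
  have key : Function.Bijective (Quotient.lift (s := s) (fun a => (⟨f a, hfF a⟩ : F))
      fun a b hab => Subtype.ext <|
        h₅ _ (hfF a) _ (hfF b) b (h₃ _ _ _ (hf a) hab) (hf b)) := by
    constructor
    · intro a b
      refine Quotient.inductionOn₂ a b fun a b hab => Quotient.sound ?_
      have hab' : f a = f b := congrArg Subtype.val hab
      exact h₄ (f a) a b (hf a) (hab' ▸ hf b)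
    · rintro ⟨k, hk⟩
      obtain ⟨a, ha⟩ := h₁ k hk
      exact ⟨Quotient.mk s a, Subtype.ext (h₅ _ (hfF a) _ hk a (hf a) ha)⟩
  rw [Nat.card_eq_of_bijective _ key]
  simp

/-- A code `⟨q, p, k⟩` with three generators, or a code `⟨β, x, y, u, t⟩` with two. -/
abbrev Code : Type := ((_ : ℕ) × (_ : ℕ) × ℕ) ⊕ ((_ : ℕ) × (ℕ × ℕ × ℕ × ℕ))

theorem transp_act (σ : Fin 3 → Fin 3) (k : ℕ) : transp (act σ k) = act σ (transp k) := by
  apply bits_injOn (transp_lt _) (act_lt _ _)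
  rw [bits_transp, bits_act, bits_act, bits_transp]

/-- The code is the least one in its orbit under relabelling (and transposition). -/
def Least₁ (anti : Bool) (p q k : ℕ) : Prop :=
  ∀ σ : Equiv.Perm (Fin 3), wts p q ∘ σ = wts p q →
    k ≤ act σ k ∧ (anti = true → k ≤ act σ (transp k))

/-- A choice of representatives among the codes with two generators. -/
def Least₂ (anti : Bool) (β x y u : ℕ) : Prop :=
  ¬(β = 1 ∧ x = 1 ∧ ((y = 1 ∧ u = 0) ∨ (y = 0 ∧ u = 1))) ∧ (anti = true → x ≤ y)

/-- The canonical codes. -/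
def Canon (m : ℕ) (anti : Bool) : Code → Prop
  | .inl ⟨q, p, k⟩ => Valid₁ m p q k ∧ Least₁ anti p q k
  | .inr ⟨β, x, y, u, t⟩ => IsCode m β x y u t ∧ Least₂ anti β x y u

/-- The codes of commutative semigroups. -/
def SymmCode : Code → Prop
  | .inl ⟨_, _, k⟩ => transp k = k
  | .inr ⟨_, x, y, _, _⟩ => x = y

variable {m : ℕ} (hm : 4 ≤ m)

/-- The code describes the semigroup (or its dual). -/
def Describes (anti : Bool) : Code → (S : Type) → [Semigroup S] → Prop
  | .inl ⟨q, p, k⟩, S, _ => Has₁ hm p q k S ∨ (anti = true ∧ Has₁ hm p q (transp k) S)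
  | .inr ⟨β, x, y, u, t⟩, S, _ => Has₂ hm β x y u t S ∨ (anti = true ∧ Has₂ hm β y x u t S)

variable {S T : Type} [Semigroup S] [Semigroup T] {anti : Bool} {c c' : Code}

theorem Describes.congr (h : Describes hm anti c S) (hST : AreIso S T) : Describes hm anti c T := by
  rcases c with ⟨q, p, k⟩ | ⟨β, x, y, u, t⟩
  · exact h.imp (fun h => h.congr hm hST) fun h => ⟨h.1, h.2.congr hm hST⟩
  · exact h.imp (fun h => h.congr hm hST) fun h => ⟨h.1, h.2.congr hm hST⟩

theorem Describes.of_antiIso (hc : Canon m true c) (h : Describes hm true c S) (hST : AreAntiIso S T) :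
    Describes hm true c T := by
  rcases c with ⟨q, p, k⟩ | ⟨β, x, y, u, t⟩
  · rcases h with h | ⟨-, h⟩
    · exact .inr ⟨rfl, h.anti hm hST.symm⟩
    · have := h.anti hm hST.symm
      rw [transp_transp hc.1.lt'] at this
      exact .inl this
  · rcases h with h | ⟨-, h⟩
    · exact .inr ⟨rfl, h.anti hm hST.symm⟩
    · exact .inl (h.anti hm hST.symm)

theorem exists_antiIso (S : Type) [Semigroup S] : AreAntiIso Sᵐᵒᵖ S := ⟨MulEquiv.refl _⟩

theorem Describes.rel (hc : Canon m anti c) (h : Describes hm anti c S) (h' : Describes hm anti c T) :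
    AreIso S T ∨ (anti = true ∧ AreAntiIso S T) := by
  have key : ∀ {S T : Type} [Semigroup S] [Semigroup T], AreIso Sᵐᵒᵖ T → AreAntiIso S T :=
    fun h => ((exists_antiIso _).symm).trans_iso h
  rcases c with ⟨q, p, k⟩ | ⟨β, x, y, u, t⟩
  · have ht := transp_transp hc.1.lt'
    rcases h with h | ⟨ha, h⟩ <;> rcases h' with h' | ⟨ha', h'⟩
    · exact .inl (h.iso hm h')
    · exact .inr ⟨ha', key ((h.anti hm (exists_antiIso S)).iso hm h')⟩
    · have := h.anti hm (exists_antiIso S)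
      rw [ht] at this
      exact .inr ⟨ha, key (this.iso hm h')⟩
    · exact .inl (h.iso hm h')
  · rcases h with h | ⟨ha, h⟩ <;> rcases h' with h' | ⟨ha', h'⟩
    · exact .inl (h.iso hm h')
    · exact .inr ⟨ha', key ((h.anti hm (exists_antiIso S)).iso hm h')⟩
    · exact .inr ⟨ha, key ((h.anti hm (exists_antiIso S)).iso hm h')⟩
    · exact .inl (h.iso hm h')

theorem Describes.exists_model (hc : Canon m anti c) : ∃ (S : Type) (_ : Semigroup S),
    Nat.card S = m + 3 ∧ HasCoclass S 2 ∧ Describes hm anti c S := by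
  rcases c with ⟨q, p, k⟩ | ⟨β, x, y, u, t⟩
  · have hw := one_le_wts hc.1.one_le (hc.1.one_le.trans hc.1.le)
    exact ⟨(tab₁ hm (wts p q) hw (bits k)).Mod, inferInstance, Tab.card_mod _,
      hasCoclass_tab₁ hm hw (bits k) (i := 0) rfl, .inl ⟨hw, ⟨MulEquiv.refl _⟩⟩⟩
  · exact ⟨(tab₂ hm hc.1).Mod, inferInstance, Tab.card_mod _, hasCoclass_tab₂ hm hc.1,
      .inl ⟨hc.1, ⟨MulEquiv.refl _⟩⟩⟩

theorem Has₁.exists_act {p q k p' q' k' : ℕ} (hv : Valid₁ m p q k) (hv' : Valid₁ m p' q' k')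
    (h : Has₁ hm p q k S) (h' : Has₁ hm p' q' k' S) : p = p' ∧ q = q' ∧
      ∃ σ : Equiv.Perm (Fin 3), wts p q ∘ σ = wts p q ∧ k = _root_.act σ k' := by
  obtain ⟨h1, h2, σ, h3, h4⟩ := h.unique hm hv hv' h'
  refine ⟨h1, h2, σ, funext h3, bits_injOn hv.lt' (act_lt _ _) ?_⟩
  rw [bits_act]
  funext x y
  exact h4 x y

/-- Two codes of the same semigroup differ by a relabelling and perhaps a transposition, so
minimality of k' bounds it by k. Applied in both directions this gives equality. -/
theorem Has₁.le_of_rep {p q k p' q' k' : ℕ} (hc : Canon m anti (.inl ⟨q, p, k⟩))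
    (hc' : Canon m anti (.inl ⟨q', p', k'⟩)) (h : Describes hm anti (.inl ⟨q, p, k⟩) S)
    (h' : Describes hm anti (.inl ⟨q', p', k'⟩) S) : p = p' ∧ q = q' ∧ k' ≤ k := by
  have main : p = p' ∧ q = q' ∧ ∃ σ : Equiv.Perm (Fin 3), wts p q ∘ σ = wts p q ∧
      (k = _root_.act σ k' ∨ (anti = true ∧ k = _root_.act σ (transp k'))) := by
    rcases h with h | ⟨ha, h⟩ <;> rcases h' with h' | ⟨ha', h'⟩
    · obtain ⟨h1, h2, σ, h3, h4⟩ := h.exists_act hm hc.1 hc'.1 h'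
      exact ⟨h1, h2, σ, h3, .inl h4⟩
    · obtain ⟨h1, h2, σ, h3, h4⟩ := h.exists_act hm hc.1 hc'.1.transp h'
      exact ⟨h1, h2, σ, h3, .inr ⟨ha', h4⟩⟩
    · obtain ⟨h1, h2, σ, h3, h4⟩ := h.exists_act hm hc.1.transp hc'.1 h'
      refine ⟨h1, h2, σ, h3, .inr ⟨ha, ?_⟩⟩
      rw [← transp_act, ← h4, transp_transp hc.1.lt']
    · obtain ⟨h1, h2, σ, h3, h4⟩ := h.exists_act hm hc.1.transp hc'.1.transp h'
      refine ⟨h1, h2, σ, h3, .inl ?_⟩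
      rw [← transp_act] at h4
      rw [← transp_transp hc.1.lt', h4, transp_transp (act_lt _ _)]
  obtain ⟨rfl, rfl, σ, hσ, h⟩ := main
  refine ⟨rfl, rfl, ?_⟩
  rcases h with h | ⟨ha, h⟩
  · exact h ▸ (hc'.2 σ hσ).1
  · exact h ▸ (hc'.2 σ hσ).2 ha

variable {β x y u t β' x' y' u' t' : ℕ}

theorem Has₂.le_one (h : Has₂ hm 1 x y u t S) : x ≤ 1 ∧ y ≤ 1 ∧ u ≤ 1 ∧ t = 0 := by
  have e1 := h.1.hx2; have e2 := h.1.hy2; have e3 := h.1.hu2; have e4 := h.1.eq_one rfl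
  omega

/-- The numbers with subscript 0 are those seen by S itself, while x, y are those of the canonical
code, possibly of the dual. When the codes differ only by orientation, x ≤ y decides; exchanges of
generators occur only for β = 1 and leave finitely many codes. -/
theorem Has₂.eq_of_least {x₀ y₀ x₀' y₀' : ℕ} (he : IsCode m β x y u t)
    (he' : IsCode m β' x' y' u' t') (hl : Least₂ anti β x y u)
    (hl' : Least₂ anti β' x' y' u') (h : Has₂ hm β x₀ y₀ u t S) (h' : Has₂ hm β' x₀' y₀' u' t' S)
    (hx : (x₀ = x ∧ y₀ = y) ∨ (anti = true ∧ x₀ = y ∧ y₀ = x))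
    (hx' : (x₀' = x' ∧ y₀' = y') ∨ (anti = true ∧ x₀' = y' ∧ y₀' = x')) :
    β = β' ∧ x = x' ∧ y = y' ∧ u = u' ∧ t = t' := by
  obtain ⟨l1, l2⟩ := hl
  obtain ⟨l1', l2'⟩ := hl'
  rcases h.unique hm h' with ⟨rfl, hu⟩ | ⟨rfl, rfl, hu⟩
  · refine ⟨rfl, ?_⟩
    rcases hx with hx | ⟨ha, hx⟩ <;> rcases hx' with hx' | ⟨ha', hx'⟩
    · omega
    · have := l2 ha'; have := l2' ha'; omega
    · have := l2 ha; have := l2' ha; omega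
    · omega
  · obtain ⟨b1, b2, b3, rfl⟩ := h.le_one hm
    obtain ⟨b1', b2', b3', rfl⟩ := h'.le_one hm
    have e5 := he.exists_extra
    have e5' := he'.exists_extra
    refine ⟨rfl, ?_⟩
    rcases hx with ⟨rfl, rfl⟩ | ⟨ha, rfl, rfl⟩ <;> rcases hx' with ⟨rfl, rfl⟩ | ⟨ha', rfl, rfl⟩
    · clear l2 l2'
      interval_cases x₀ <;> interval_cases y₀ <;> interval_cases u <;> simp at hu l1 e5 <;> omega
    · replace l2 := l2 ha'
      replace l2' := l2' ha'
      interval_cases x₀ <;> interval_cases y₀ <;> interval_cases u <;> simp at hu l1 l2 e5 <;> omega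
    · replace l2 := l2 ha
      replace l2' := l2' ha
      interval_cases x₀ <;> interval_cases y₀ <;> interval_cases u <;> simp at hu l1 l2 e5 <;> omega
    · replace l2 := l2 ha
      replace l2' := l2' ha
      interval_cases x₀ <;> interval_cases y₀ <;> interval_cases u <;> simp at hu l1 l2 e5 <;> omega

theorem Describes.unique (hc : Canon m anti c) (hc' : Canon m anti c') (h : Describes hm anti c S)
    (h' : Describes hm anti c' S) : c = c' := by
  rcases c with ⟨q, p, k⟩ | ⟨β, x, y, u, t⟩ <;> rcases c' with ⟨q', p', k'⟩ | ⟨β', x', y', u', t'⟩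
  · obtain ⟨rfl, rfl, h1⟩ := Has₁.le_of_rep hm hc hc' h h'
    obtain ⟨-, -, h2⟩ := Has₁.le_of_rep hm hc' hc h' h
    rw [le_antisymm h1 h2]
  · exfalso
    rcases h with h | ⟨ha, h⟩ <;> rcases h' with h' | ⟨ha', h'⟩ <;> exact h.not_has₂ hm h'
  · exfalso
    rcases h with h | ⟨ha, h⟩ <;> rcases h' with h' | ⟨ha', h'⟩ <;> exact h'.not_has₂ hm h
  · obtain ⟨hc, hl⟩ := hc
    obtain ⟨hc', hl'⟩ := hc'
    have main : β = β' ∧ x = x' ∧ y = y' ∧ u = u' ∧ t = t' := by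
      rcases h with h | ⟨ha, h⟩ <;> rcases h' with h' | ⟨ha', h'⟩ <;>
        refine Has₂.eq_of_least hm hc hc' hl hl' h h' ?_ ?_ <;> simp [*]
    obtain ⟨rfl, rfl, rfl, rfl, rfl⟩ := main
    rfl

/-- The least matrix describing S is canonical, because every relabelling or permitted transposition
of it also describes S. -/
theorem exists_rep₁ {p q k : ℕ} (hv : Valid₁ m p q k) (h : Has₁ hm p q k S) :
    ∃ k', Canon m anti (.inl ⟨q, p, k'⟩) ∧ Describes hm anti (.inl ⟨q, p, k'⟩) S := by
  classical
  have hex : ∃ k', Valid₁ m p q k' ∧ Describes hm anti (.inl ⟨q, p, k'⟩) S := ⟨k, hv, .inl h⟩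
  obtain ⟨h1, h2⟩ := Nat.find_spec hex
  set k₀ := Nat.find hex
  refine ⟨k₀, ⟨h1, fun σ hσ => ⟨Nat.find_min' hex ⟨h1.act σ hσ, ?_⟩, fun ha =>
    Nat.find_min' hex ⟨h1.transp.act σ hσ, ?_⟩⟩⟩, h2⟩
  · rcases h2 with h2 | ⟨ha, h2⟩
    · exact .inl (h2.act hm σ hσ)
    · refine .inr ⟨ha, ?_⟩
      rw [transp_act]
      exact h2.act hm σ hσ
  · rcases h2 with h2 | ⟨-, h2⟩
    · refine .inr ⟨ha, ?_⟩
      rw [transp_act, transp_transp h1.lt']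
      exact h2.act hm σ hσ
    · exact .inl (h2.act hm σ hσ)

theorem exists_least₂ {β x y u t : ℕ} (h : Has₂ hm β x y u t S) :
    ∃ x y u, Least₂ false β x y u ∧ Has₂ hm β x y u t S := by
  by_cases hbad : β = 1 ∧ x = 1 ∧ ((y = 1 ∧ u = 0) ∨ (y = 0 ∧ u = 1))
  · obtain ⟨hc, hS⟩ := h
    obtain ⟨rfl, rfl, ⟨rfl, rfl⟩ | ⟨rfl, rfl⟩⟩ := hbad
    · obtain rfl : t = 0 := hc.eq_one rfl
      have hc' : IsCode m 1 0 0 0 0 := isCode_one hm (by omega) (by omega) (by omega) (by omega)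
      exact ⟨0, 0, 0, ⟨by omega, by simp⟩, hc', (areIso_swap_of_square_extra hm hc' hc).trans hS⟩
    · obtain rfl : t = 0 := hc.eq_one rfl
      have hc' : IsCode m 1 0 1 1 0 := isCode_one hm (by omega) (by omega) (by omega) (by omega)
      exact ⟨0, 1, 1, ⟨by omega, by simp⟩, hc', (areIso_swap_of_right_extra hm hc' hc).trans hS⟩
  · exact ⟨x, y, u, ⟨hbad, by simp⟩, h⟩

theorem exists_rep (h : HasCoclass S 2) (hcard : Nat.card S = m + 3) :
    ∃ c, Canon m anti c ∧ Describes hm anti c S := by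
  obtain ⟨hfin, c, hc, hc'⟩ := h
  obtain rfl : c = m := by omega
  rcases exists_areIso_of_coclass_two hm hc hcard with
    ⟨w, hw, e, hwm, hi, h⟩ | ⟨β, x, y, u, t, hcode, h⟩
  · obtain ⟨p, q, k, hv, h⟩ := exists_has₁ hm hwm hi h
    obtain ⟨k', h⟩ := exists_rep₁ (anti := anti) hm hv h
    exact ⟨_, h⟩
  · obtain ⟨x, y, u, hl, h⟩ := exists_least₂ hm (S := S) ⟨hcode, h⟩
    have hcode := h.1
    by_cases hxy : anti = true → x ≤ y
    · exact ⟨.inr ⟨β, x, y, u, t⟩, ⟨hcode, hl.1, hxy⟩, .inl h⟩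
    · push Not at hxy
      -- Passing to the dual restores the order. The excluded codes do not reappear: their first
      -- entry is 1 and their second at most 1, while here y < x.
      refine ⟨.inr ⟨β, y, x, u, t⟩, ⟨hcode.symm, ?_, fun _ => hxy.2.le⟩, .inr ⟨hxy.1, h⟩⟩
      have := hl.1
      omega

theorem Describes.comm_iff (hc : Canon m false c) (h : Describes hm false c S) :
    (∀ s t : S, s * t = t * s) ↔ SymmCode c := by
  rcases c with ⟨q, p, k⟩ | ⟨β, x, y, u, t⟩
  · rcases h with h | ⟨ha, h⟩
    · exact h.comm_iff hm hc.1
    · simp at ha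
  · rcases h with h | ⟨ha, h⟩
    · exact h.comm_iff hm
    · simp at ha

/-- The conditions on the last component of a counted code with three generators. -/
def Good₁ (m : ℕ) (anti comm : Bool) (q p k : ℕ) : Prop :=
  Valid₁ m p q k ∧ Least₁ anti p q k ∧ (comm = true → transp k = k)

/-- The conditions on a counted code with two generators. -/
def Good₂ (m : ℕ) (anti comm : Bool) (β : ℕ) (d : ℕ × ℕ × ℕ × ℕ) : Prop :=
  IsCode m β d.1 d.2.1 d.2.2.1 d.2.2.2 ∧ Least₂ anti β d.1 d.2.1 d.2.2.1 ∧
    (comm = true → d.1 = d.2.1)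

open Classical in
/-- The number of codes with three generators of given weights. -/
noncomputable def num₁ (m : ℕ) (anti comm : Bool) (q p : ℕ) : ℕ :=
  ((Finset.range 512).filter (Good₁ m anti comm q p)).card

open Classical in
/-- The number of codes with two generators of given weight. -/
noncomputable def num₂ (m : ℕ) (anti comm : Bool) (β : ℕ) : ℕ :=
  ((Finset.range 4 ×ˢ Finset.range 4 ×ˢ Finset.range 4 ×ˢ Finset.range 2).filter
    (Good₂ m anti comm β)).card

open Classical in
/-- The set of all counted codes. -/
noncomputable def codes (m : ℕ) (anti comm : Bool) : Finset Code :=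
  ((Finset.Ico 1 m).sigma fun q => (Finset.Ico 1 (q + 1)).sigma fun p =>
    (Finset.range 512).filter (Good₁ m anti comm q p)).disjSum
  ((Finset.Ico 1 (m - 1)).sigma fun β =>
    (Finset.range 4 ×ˢ Finset.range 4 ×ˢ Finset.range 4 ×ˢ Finset.range 2).filter
    (Good₂ m anti comm β))

theorem card_codes (m : ℕ) (anti comm : Bool) : (codes m anti comm).card =
    ∑ q ∈ Finset.Ico 1 m, ∑ p ∈ Finset.Ico 1 (q + 1), num₁ m anti comm q p +
      ∑ β ∈ Finset.Ico 1 (m - 1), num₂ m anti comm β := by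
  simp only [codes, Finset.card_disjSum, Finset.card_sigma]
  rfl

theorem mem_codes {comm : Bool} :
    c ∈ codes m anti comm ↔ Canon m anti c ∧ (comm = true → SymmCode c) := by
  rcases c with ⟨q, p, k⟩ | ⟨β, x, y, u, t⟩
  · simp only [codes, Finset.inl_mem_disjSum, Finset.mem_sigma, Finset.mem_Ico, Finset.mem_filter,
      Finset.mem_range, Good₁, Canon, SymmCode]
    constructor
    · rintro ⟨-, -, -, h1, h2, h3⟩
      exact ⟨⟨h1, h2⟩, h3⟩
    · rintro ⟨⟨h1, h2⟩, h3⟩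
      have := h1.one_le; have := h1.le; have := h1.lt
      exact ⟨by omega, by omega, h1.lt', h1, h2, h3⟩
  · simp only [codes, Finset.inr_mem_disjSum, Finset.mem_sigma, Finset.mem_Ico, Finset.mem_filter,
      Finset.mem_range, Finset.mem_product, Good₂, Canon, SymmCode]
    constructor
    · rintro ⟨-, -, h1, h2, h3⟩
      exact ⟨⟨h1, h2⟩, h3⟩
    · rintro ⟨⟨h1, h2⟩, h3⟩
      have := h1.one_le; have := h1.le; have := h1.hx; have := h1.hy; have := h1.hu; have := h1.ht
      exact ⟨by omega, by omega, h1, h2, h3⟩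

theorem numIso_eq_card_codes (hm : 4 ≤ m) : numIso (m + 3) 2 = (codes m false false).card := by
  refine Nat.card_quotient_eq_card_finset _ _ (fun c S => Canon m false c ∧ Describes hm false c S.1)
    ?_ ?_ ?_ ?_ ?_
  · intro c hc
    rw [mem_codes] at hc
    obtain ⟨S, _, h1, h2, h3⟩ := Describes.exists_model hm hc.1
    exact ⟨⟨Semigrp.of S, h1, h2⟩, hc.1, h3⟩
  · rintro ⟨S, h1, h2⟩
    obtain ⟨c, hc, h⟩ := exists_rep (anti := false) hm h2 h1
    exact ⟨c, mem_codes.2 ⟨hc, by simp⟩, hc, h⟩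
  · rintro c S T ⟨hc, h⟩ hST
    exact ⟨hc, h.congr hm hST⟩
  · rintro c S T ⟨hc, h⟩ ⟨-, h'⟩
    exact (h.rel hm hc h').resolve_right (by simp)
  · rintro c - c' - S ⟨hc, h⟩ ⟨hc', h'⟩
    exact h.unique hm hc hc' h'

theorem numCommIso_eq_card_codes (hm : 4 ≤ m) : numCommIso (m + 3) 2 = (codes m false true).card := by
  refine Nat.card_quotient_eq_card_finset _ _ (fun c S => Canon m false c ∧ Describes hm false c S.1.1)
    ?_ ?_ ?_ ?_ ?_
  · intro c hc
    rw [mem_codes] at hc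
    obtain ⟨S, _, h1, h2, h3⟩ := Describes.exists_model hm hc.1
    exact ⟨⟨⟨Semigrp.of S, h1, h2⟩, (h3.comm_iff hm hc.1).2 (hc.2 rfl)⟩, hc.1, h3⟩
  · rintro ⟨⟨S, h1, h2⟩, h3⟩
    obtain ⟨c, hc, h⟩ := exists_rep (anti := false) hm h2 h1
    exact ⟨c, mem_codes.2 ⟨hc, fun _ => (h.comm_iff hm hc).1 h3⟩, hc, h⟩
  · rintro c S T ⟨hc, h⟩ hST
    exact ⟨hc, h.congr hm hST⟩
  · rintro c S T ⟨hc, h⟩ ⟨-, h'⟩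
    exact (h.rel hm hc h').resolve_right (by simp)
  · rintro c - c' - S ⟨hc, h⟩ ⟨hc', h'⟩
    exact h.unique hm hc hc' h'

theorem numIsoOrAntiIso_eq_card_codes (hm : 4 ≤ m) :
    numIsoOrAntiIso (m + 3) 2 = (codes m true false).card := by
  refine Nat.card_quotient_eq_card_finset _ _ (fun c S => Canon m true c ∧ Describes hm true c S.1)
    ?_ ?_ ?_ ?_ ?_
  · intro c hc
    rw [mem_codes] at hc
    obtain ⟨S, _, h1, h2, h3⟩ := Describes.exists_model hm hc.1
    exact ⟨⟨Semigrp.of S, h1, h2⟩, hc.1, h3⟩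
  · rintro ⟨S, h1, h2⟩
    obtain ⟨c, hc, h⟩ := exists_rep (anti := true) hm h2 h1
    exact ⟨c, mem_codes.2 ⟨hc, by simp⟩, hc, h⟩
  · rintro c S T ⟨hc, h⟩ hST
    rcases hST with hST | hST
    · exact ⟨hc, h.congr hm hST⟩
    · exact ⟨hc, h.of_antiIso hm hc hST⟩
  · rintro c S T ⟨hc, h⟩ ⟨-, h'⟩
    exact (h.rel hm hc h').imp id And.right
  · rintro c - c' - S ⟨hc, h⟩ ⟨hc', h'⟩
    exact h.unique hm hc hc' h'

end Representatives

/-! ### The number of canonical codes for given weights. -/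

section Counting

/-- Binary digits, in a form that evaluates quickly. -/
def bit (k i : ℕ) : ℕ := Nat.land (Nat.shiftRight k i) 1

/-- The effect on an encoded matrix of exchanging the first two labels. -/
def swapFirst (k : ℕ) : ℕ :=
  bit k 4 + 2 * bit k 3 + 4 * bit k 5 + 8 * bit k 1 + 16 * bit k 0 + 32 * bit k 2 +
    64 * bit k 7 + 128 * bit k 6 + 256 * bit k 8

/-- The effect on an encoded matrix of exchanging the last two labels. -/
def swapLast (k : ℕ) : ℕ :=
  bit k 0 + 2 * bit k 2 + 4 * bit k 1 + 8 * bit k 6 + 16 * bit k 8 + 32 * bit k 7 +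
    64 * bit k 3 + 128 * bit k 5 + 256 * bit k 4

/-- The effect on an encoded matrix of transposition. -/
def flipCode (k : ℕ) : ℕ :=
  bit k 0 + 2 * bit k 3 + 4 * bit k 6 + 8 * bit k 1 + 16 * bit k 4 + 32 * bit k 7 +
    64 * bit k 2 + 128 * bit k 5 + 256 * bit k 8

theorem forall_lt_of_all {P : ℕ → Bool} {n : ℕ} (h : (List.range n).all P = true) {k : ℕ}
    (hk : k < n) : P k = true :=
  List.all_eq_true.1 h k (List.mem_range.2 hk)

-- Relabellings and transposition are replaced by explicit bit formulas, so that the counts below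
-- can be evaluated in the kernel.
set_option maxRecDepth 100000 in
theorem act_swapFirst {k : ℕ} (hk : k < 512) : act (Equiv.swap 0 1) k = swapFirst k := by
  have h : (List.range 512).all (fun k => Nat.beq (act ![1, 0, 2] k) (swapFirst k)) = true := by
    decide +kernel
  have e : ⇑(Equiv.swap (0 : Fin 3) 1) = ![1, 0, 2] := by decide
  rw [e]
  exact Nat.eq_of_beq_eq_true (forall_lt_of_all h hk)

set_option maxRecDepth 100000 in
theorem act_swapLast {k : ℕ} (hk : k < 512) : act (Equiv.swap 1 2) k = swapLast k := by
  have h : (List.range 512).all (fun k => Nat.beq (act ![0, 2, 1] k) (swapLast k)) = true := by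
    decide +kernel
  have e : ⇑(Equiv.swap (1 : Fin 3) 2) = ![0, 2, 1] := by decide
  rw [e]
  exact Nat.eq_of_beq_eq_true (forall_lt_of_all h hk)

set_option maxRecDepth 100000 in
theorem transp_eq_flipCode {k : ℕ} (hk : k < 512) : transp k = flipCode k := by
  have h : (List.range 512).all (fun k => Nat.beq (transp k) (flipCode k)) = true := by
    decide +kernel
  exact Nat.eq_of_beq_eq_true (forall_lt_of_all h hk)

/-- The conditions on counted codes with three generators in terms of the comparisons that they
depend on; `bᵢⱼ` tells whether the product of the generators `i` and `j` is free, `tᵢⱼ` whether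
these generators have equal weights. -/
def good₁ (b01 b02 b11 b12 b22 t01 t12 anti comm : Bool) (k : ℕ) : Bool :=
  !k.testBit 0 && (b01 || (!k.testBit 1 && !k.testBit 3)) &&
  (b02 || (!k.testBit 2 && !k.testBit 6)) && (b11 || !k.testBit 4) &&
  (b12 || (!k.testBit 5 && !k.testBit 7)) && (b22 || !k.testBit 8) &&
  (!t01 || Nat.ble k (swapFirst k)) && (!t12 || Nat.ble k (swapLast k)) &&
  (!anti || (Nat.ble k (flipCode k) && (!t01 || Nat.ble k (swapFirst (flipCode k))) &&
    (!t12 || Nat.ble k (swapLast (flipCode k))))) && (!comm || Nat.beq (flipCode k) k)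

theorem perm_fin_three : ∀ σ : Equiv.Perm (Fin 3), σ = 1 ∨ σ = Equiv.swap 0 1 ∨
    σ = Equiv.swap 1 2 ∨ σ 0 = 2 ∨ σ 2 = 0 := by decide

theorem act_one {k : ℕ} (hk : k < 512) : act (1 : Equiv.Perm (Fin 3)) k = k :=
  bits_injOn (act_lt _ _) hk (bits_act _ _)

theorem wts_comp_swapFirst {p q : ℕ} : wts p q ∘ Equiv.swap 0 1 = wts p q ↔ p = 1 := by
  constructor
  · intro h
    exact congrFun h 0
  · rintro rfl
    funext x
    revert x
    exact forall_fin_three rfl rfl rfl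

theorem wts_comp_swapLast {p q : ℕ} : wts p q ∘ Equiv.swap 1 2 = wts p q ↔ p = q := by
  constructor
  · intro h
    exact congrFun h 2
  · rintro rfl
    funext x
    revert x
    exact forall_fin_three rfl rfl rfl

/-- A permutation other than the identity and the two adjacent transpositions carries 0 to 2 or 2 to
0; if it preserved the weights it would force q = 1. -/
theorem least₁_iff {anti : Bool} {p q k : ℕ} (hk : k < 512) (hq : q ≠ 1) : Least₁ anti p q k ↔
    (p = 1 → k ≤ swapFirst k) ∧ (p = q → k ≤ swapLast k) ∧
      (anti = true → k ≤ flipCode k ∧ (p = 1 → k ≤ swapFirst (flipCode k)) ∧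
        (p = q → k ≤ swapLast (flipCode k))) := by
  have hf : flipCode k < 512 := transp_eq_flipCode hk ▸ transp_lt k
  constructor
  · intro h
    have h0 := h 1 rfl
    have h1 := fun hp => h (Equiv.swap 0 1) (wts_comp_swapFirst.2 hp)
    have h2 := fun hp => h (Equiv.swap 1 2) (wts_comp_swapLast.2 hp)
    simp only [act_one hk, transp_eq_flipCode hk, act_one hf, act_swapFirst hk, act_swapFirst hf,
      act_swapLast hk, act_swapLast hf] at h0 h1 h2
    exact ⟨fun hp => (h1 hp).1, fun hp => (h2 hp).1,
      fun ha => ⟨h0.2 ha, fun hp => (h1 hp).2 ha, fun hp => (h2 hp).2 ha⟩⟩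
  · rintro ⟨h1, h2, h3⟩ σ hσ
    rcases perm_fin_three σ with rfl | rfl | rfl | h | h
    · rw [transp_eq_flipCode hk, act_one hk, act_one hf]
      exact ⟨le_rfl, fun ha => (h3 ha).1⟩
    · rw [transp_eq_flipCode hk, act_swapFirst hk, act_swapFirst hf]
      have hp := wts_comp_swapFirst.1 hσ
      exact ⟨h1 hp, fun ha => (h3 ha).2.1 hp⟩
    · rw [transp_eq_flipCode hk, act_swapLast hk, act_swapLast hf]
      have hp := wts_comp_swapLast.1 hσ
      exact ⟨h2 hp, fun ha => (h3 ha).2.2 hp⟩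
    · have := congrFun hσ 0
      rw [Function.comp_apply, h] at this
      exact absurd this hq
    · have := congrFun hσ 2
      rw [Function.comp_apply, h] at this
      exact absurd this.symm hq

theorem card_filter_range_eq_countP (n : ℕ) (P : ℕ → Bool) :
    ((Finset.range n).filter fun k => P k = true).card = (List.range n).countP P := by
  rw [List.countP_eq_length_filter]
  simp [Finset.card, Finset.filter, Finset.range, Multiset.range]

theorem mask_iff {m p q k : ℕ} (hm : 4 ≤ m) :
    (∀ x y, bits k x y = true → m ≤ wts p q x + wts p q y) ↔
      k.testBit 0 = false ∧ (m ≤ 1 + p ∨ k.testBit 1 = false ∧ k.testBit 3 = false) ∧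
      (m ≤ 1 + q ∨ k.testBit 2 = false ∧ k.testBit 6 = false) ∧
      (m ≤ p + p ∨ k.testBit 4 = false) ∧
      (m ≤ p + q ∨ k.testBit 5 = false ∧ k.testBit 7 = false) ∧
      (m ≤ q + q ∨ k.testBit 8 = false) := by
  constructor
  · intro h
    have key : ∀ x y : Fin 3, m ≤ wts p q x + wts p q y ∨ k.testBit (3 * x.1 + y.1) = false := by
      intro x y
      have := h x y
      rw [bits] at this
      cases hb : k.testBit (3 * x.1 + y.1)
      · exact .inr rfl
      · exact .inl (this hb)
    have h00 : m ≤ 1 + 1 ∨ k.testBit 0 = false := key 0 0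
    have h01 : m ≤ 1 + p ∨ k.testBit 1 = false := key 0 1
    have h02 : m ≤ 1 + q ∨ k.testBit 2 = false := key 0 2
    have h10 : m ≤ p + 1 ∨ k.testBit 3 = false := key 1 0
    have h11 : m ≤ p + p ∨ k.testBit 4 = false := key 1 1
    have h12 : m ≤ p + q ∨ k.testBit 5 = false := key 1 2
    have h20 : m ≤ q + 1 ∨ k.testBit 6 = false := key 2 0
    have h21 : m ≤ q + p ∨ k.testBit 7 = false := key 2 1
    have h22 : m ≤ q + q ∨ k.testBit 8 = false := key 2 2
    rw [add_comm] at h10 h20 h21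
    exact ⟨h00.resolve_left (by omega), or_and_left.2 ⟨h01, h10⟩, or_and_left.2 ⟨h02, h20⟩, h11,
      or_and_left.2 ⟨h12, h21⟩, h22⟩
  · rintro ⟨h00, h01, h02, h11, h12, h22⟩
    have key : ∀ {a b : ℕ} {i : ℕ}, m ≤ a + b ∨ k.testBit i = false → k.testBit i = true →
        m ≤ a + b := fun h h' => h.resolve_right (by simp [h'])
    have key' : ∀ {a b : ℕ} {i : ℕ}, m ≤ a + b ∨ k.testBit i = false → k.testBit i = true →
        m ≤ b + a := fun h h' => by rw [Nat.add_comm]; exact key h h'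
    exact forall_fin_three
      (forall_fin_three (key (a := 1) (b := 1) (i := 0) (.inr h00))
        (key (a := 1) (b := p) (i := 1) (or_and_left.1 h01).1)
        (key (a := 1) (b := q) (i := 2) (or_and_left.1 h02).1))
      (forall_fin_three (key' (b := p) (i := 3) (or_and_left.1 h01).2)
        (key (a := p) (b := p) (i := 4) h11) (key (a := p) (b := q) (i := 5) (or_and_left.1 h12).1))
      (forall_fin_three (key' (b := q) (i := 6) (or_and_left.1 h02).2)
        (key' (b := q) (a := p) (i := 7) (or_and_left.1 h12).2) (key (a := q) (b := q) (i := 8) h22))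

/-- Only the comparisons of sums of two weights with m and the equalities p = 1, p = q matter, so
infinitely many weights lead to finitely many Boolean computations. -/
theorem num₁_eq {m p q : ℕ} (hm : 4 ≤ m) (anti comm : Bool) (hp : 1 ≤ p) (hpq : p ≤ q)
    (hq : q < m) (hq1 : q ≠ 1) : num₁ m anti comm q p =
      (List.range 512).countP (good₁ (m ≤ 1 + p) (m ≤ 1 + q) (m ≤ p + p) (m ≤ p + q) (m ≤ q + q)
        (p = 1) (p = q) anti comm) := by
  classical
  have : ∀ k ∈ Finset.range 512, Good₁ m anti comm q p k ↔ good₁ (m ≤ 1 + p) (m ≤ 1 + q)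
      (m ≤ p + p) (m ≤ p + q) (m ≤ q + q) (p = 1) (p = q) anti comm k = true := by
    intro k hk
    have hk := Finset.mem_range.1 hk
    have hv : Valid₁ m p q k ↔ ∀ x y, bits k x y = true → m ≤ wts p q x + wts p q y :=
      ⟨fun h => h.mask, fun h => ⟨hp, hpq, hq, hk, h⟩⟩
    rw [Good₁, hv, mask_iff hm, least₁_iff hk hq1, transp_eq_flipCode hk]
    simp only [good₁, Bool.and_eq_true, Bool.or_eq_true, Bool.not_eq_true', decide_eq_true_eq,
      decide_eq_false_iff_not, Nat.ble_eq, Nat.beq_eq, imp_iff_not_or, Bool.not_eq_true, and_assoc]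
  unfold num₁
  rw [Finset.filter_congr this]
  exact card_filter_range_eq_countP _ _

/-- The number of codes: one value for each way of counting. -/
def select (anti comm : Bool) (a b c : ℕ) : ℕ := if comm then c else if anti then b else a

set_option maxRecDepth 100000 in
theorem countP_good₁_none : ∀ b anti comm : Bool, (List.range 512).countP
    (good₁ false false false false b false false anti comm) = if b then 2 else 1 := by
  decide +kernel

set_option maxRecDepth 100000 in
theorem countP_good₁_first : ∀ b anti comm : Bool, (List.range 512).countP
    (good₁ false false false false b true false anti comm) = if b then 2 else 1 := by
  decide +kernel

-- Five bits are free and the two generators of weight 1 may be exchanged: by Burnside (32 + 8) / 2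
-- = 20 isomorphism types.
set_option maxRecDepth 100000 in
theorem countP_good₁_first_top : ∀ anti comm : Bool, (List.range 512).countP
    (good₁ false true false true true true false anti comm) = select anti comm 20 14 6 := by
  decide +kernel

set_option maxRecDepth 100000 in
theorem countP_good₁_mixed : ∀ b anti comm : Bool, (List.range 512).countP
    (good₁ false false b true true false false anti comm) =
      select anti comm 8 6 4 * if b then 2 else 1 := by
  decide +kernel

set_option maxRecDepth 100000 in
theorem countP_good₁_top : ∀ b anti comm : Bool, (List.range 512).countP
    (good₁ false true b true true false false anti comm) =
      select anti comm 32 20 8 * if b then 2 else 1 := by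
  decide +kernel

-- If everything between the two equal generators is free, these are Boolean 2 × 2 matrices up to
-- simultaneous relabelling: (16 + 4) / 2 = 10.
set_option maxRecDepth 100000 in
theorem countP_good₁_diag : ∀ b anti comm : Bool, (List.range 512).countP
    (good₁ false false b b b false true anti comm) =
      if b then select anti comm 10 9 6 else 1 := by
  decide +kernel

-- All bits but the one for a^2 are free and one exchange acts: (256 + 16) / 2 = 136.
set_option maxRecDepth 100000 in
theorem countP_good₁_all : ∀ anti comm : Bool, (List.range 512).countP
    (good₁ true true true true true false true anti comm) = select anti comm 136 84 20 := by
  decide +kernel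

variable {m p q β : ℕ}

/-- These weights have all permutations as symmetries and are not covered by `num₁_eq`, but all sums
are 2 < m, so no bit is free. -/
theorem num₁_one_one (hm : 4 ≤ m) (anti comm : Bool) : num₁ m anti comm 1 1 = 1 := by
  classical
  have key : ∀ k, Good₁ m anti comm 1 1 k ↔ k = 0 := by
    intro k
    constructor
    · rintro ⟨h, -⟩
      apply bits_injOn h.lt' (by norm_num)
      funext x y
      have h1 : wts 1 1 x + wts 1 1 y = 2 := by
        revert x y
        decide
      have := h.mask x y
      rw [h1] at this
      simp only [bits, Nat.zero_testBit] at this ⊢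
      by_contra hne
      exact absurd (this (by simpa using hne)) (by omega)
    · rintro rfl
      have ht : transp 0 = 0 := bits_injOn (transp_lt _) (by norm_num) (by
        rw [bits_transp]; funext x y; simp [bits])
      exact ⟨⟨le_rfl, le_rfl, by omega, by norm_num, by simp [bits]⟩,
        fun _ _ => ⟨zero_le, fun _ => zero_le⟩, fun _ => ht⟩
  unfold num₁
  rw [Finset.card_eq_one]
  refine ⟨0, ?_⟩
  ext k
  simp only [Finset.mem_filter, Finset.mem_range, key, Finset.mem_singleton]
  omega

theorem num₁_one (hm : 4 ≤ m) (anti comm : Bool) (hq : 2 ≤ q) (hqm : q + 1 < m) :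
    num₁ m anti comm q 1 = if m ≤ 2 * q then 2 else 1 := by
  rw [num₁_eq hm anti comm le_rfl (by omega) (by omega) (by omega),
    decide_eq_false (p := m ≤ 1 + 1) (by omega), decide_eq_false (p := m ≤ 1 + q) (by omega),
    decide_eq_true (p := 1 = 1) rfl, decide_eq_false (p := 1 = q) (by omega), countP_good₁_first, two_mul]
  simp

theorem num₁_one_top (hm : 4 ≤ m) (anti comm : Bool) :
    num₁ m anti comm (m - 1) 1 = select anti comm 20 14 6 := by
  rw [num₁_eq hm anti comm le_rfl (by omega) (by omega) (by omega),
    decide_eq_false (p := m ≤ 1 + 1) (by omega), decide_eq_true (p := m ≤ 1 + (m - 1)) (by omega),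
    decide_eq_true (p := m ≤ m - 1 + (m - 1)) (by omega), decide_eq_true (p := 1 = 1) rfl,
    decide_eq_false (p := 1 = m - 1) (by omega), countP_good₁_first_top]

theorem num₁_low (hm : 4 ≤ m) (anti comm : Bool) (hp : 2 ≤ p) (hpq : p < q) (h : p + q < m) :
    num₁ m anti comm q p = if m ≤ 2 * q then 2 else 1 := by
  rw [num₁_eq hm anti comm (by omega) (by omega) (by omega) (by omega),
    decide_eq_false (p := m ≤ 1 + p) (by omega), decide_eq_false (p := m ≤ 1 + q) (by omega),
    decide_eq_false (p := m ≤ p + p) (by omega), decide_eq_false (p := m ≤ p + q) (by omega),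
    decide_eq_false (p := p = 1) (by omega),
    decide_eq_false (p := p = q) (by omega), countP_good₁_none, two_mul]
  simp

theorem num₁_mixed (hm : 4 ≤ m) (anti comm : Bool) (hp : 2 ≤ p) (hpq : p < q) (h : m ≤ p + q)
    (hq : q + 1 < m) :
    num₁ m anti comm q p = select anti comm 8 6 4 * if m ≤ 2 * p then 2 else 1 := by
  rw [num₁_eq hm anti comm (by omega) (by omega) (by omega) (by omega),
    decide_eq_false (p := m ≤ 1 + p) (by omega), decide_eq_false (p := m ≤ 1 + q) (by omega),
    decide_eq_true (p := m ≤ q + q) (by omega), decide_eq_true (p := m ≤ p + q) (by omega),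
    decide_eq_false (p := p = 1) (by omega),
    decide_eq_false (p := p = q) (by omega), countP_good₁_mixed, two_mul]
  simp

theorem num₁_top (hm : 4 ≤ m) (anti comm : Bool) (hp : 2 ≤ p) (hpq : p + 1 < m) :
    num₁ m anti comm (m - 1) p = select anti comm 32 20 8 * if m ≤ 2 * p then 2 else 1 := by
  rw [num₁_eq hm anti comm (by omega) (by omega) (by omega) (by omega),
    decide_eq_false (p := m ≤ 1 + p) (by omega), decide_eq_true (p := m ≤ 1 + (m - 1)) (by omega),
    decide_eq_true (p := m ≤ m - 1 + (m - 1)) (by omega),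
    decide_eq_true (p := m ≤ p + (m - 1)) (by omega), decide_eq_false (p := p = 1) (by omega),
    decide_eq_false (p := p = m - 1) (by omega), countP_good₁_top, two_mul]
  simp

theorem num₁_diag (hm : 4 ≤ m) (anti comm : Bool) (hq : 2 ≤ q) (hqm : q + 1 < m) :
    num₁ m anti comm q q = if m ≤ 2 * q then select anti comm 10 9 6 else 1 := by
  rw [num₁_eq hm anti comm (by omega) (by omega) (by omega) (by omega),
    decide_eq_false (p := m ≤ 1 + q) (by omega), decide_eq_false (p := q = 1) (by omega),
    decide_eq_true (p := q = q) rfl, countP_good₁_diag, two_mul]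
  simp

theorem num₁_all (hm : 4 ≤ m) (anti comm : Bool) :
    num₁ m anti comm (m - 1) (m - 1) = select anti comm 136 84 20 := by
  rw [num₁_eq hm anti comm (by omega) (by omega) (by omega) (by omega),
    decide_eq_true (p := m ≤ 1 + (m - 1)) (by omega),
    decide_eq_true (p := m ≤ m - 1 + (m - 1)) (by omega),
    decide_eq_false (p := m - 1 = 1) (by omega),
    decide_eq_true (p := m - 1 = m - 1) rfl, countP_good₁_all]

/-- The conditions on counted codes with two generators in terms of the comparisons that they
depend on. -/
def Good₂' (one top sq' sq cube anti comm : Bool) (d : ℕ × ℕ × ℕ × ℕ) : Prop :=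
  (d.1 = 0 ∨ d.2.1 = 0 ∨ d.2.2.1 = 0) ∧ (2 ≤ d.1 → top = true) ∧ (2 ≤ d.2.1 → top = true) ∧
  (2 ≤ d.2.2.1 → sq' = true) ∧ (one = true → d.2.2.2 = 0) ∧
  (d.1 ≠ 0 → d.2.1 ≠ 0 → (d.1 = 1 ↔ d.2.1 = 1) ∧ (d.2.2.2 = 1 → cube = true)) ∧
  (d.1 = 0 → d.2.1 ≠ 0 → d.2.2.1 ≠ 0 → (sq = false → d.2.2.1 = 1) ∧ (sq = true → 2 ≤ d.2.2.1) ∧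
    (d.2.2.2 = 1 → top = true)) ∧
  (d.2.1 = 0 → d.1 ≠ 0 → d.2.2.1 ≠ 0 → (sq = false → d.2.2.1 = 1) ∧ (sq = true → 2 ≤ d.2.2.1) ∧
    (d.2.2.2 = 1 → top = true)) ∧
  (d.1 = 0 → d.2.1 = 0 → d.2.2.2 = 1 → top = true) ∧
  (d.1 = 0 → d.2.1 = 0 → d.2.2.1 = 0 → one = false → top = true) ∧
  (d.1 = 0 → d.2.1 ≠ 0 → d.2.2.1 = 0 → one = false → top = true ∧ 2 ≤ d.2.1 ∧ d.2.2.2 = 1) ∧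
  (d.2.1 = 0 → d.1 ≠ 0 → d.2.2.1 = 0 → one = false → top = true ∧ 2 ≤ d.1 ∧ d.2.2.2 = 1) ∧
  ¬(one = true ∧ d.1 = 1 ∧ ((d.2.1 = 1 ∧ d.2.2.1 = 0) ∨ (d.2.1 = 0 ∧ d.2.2.1 = 1))) ∧
  (anti = true → d.1 ≤ d.2.1) ∧ (comm = true → d.1 = d.2.1)

set_option synthInstance.maxSize 2000 in
set_option synthInstance.maxHeartbeats 400000 in
instance (one top sq' sq cube anti comm : Bool) :
    DecidablePred (Good₂' one top sq' sq cube anti comm) := fun _ => by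
  unfold Good₂'; infer_instance

theorem num₂_eq (hβ : 1 ≤ β) (hβm : β + 2 ≤ m) (anti comm : Bool) : num₂ m anti comm β =
    ((Finset.range 4 ×ˢ Finset.range 4 ×ˢ Finset.range 4 ×ˢ Finset.range 2).filter
      (Good₂' (β = 1) (β + 2 = m) (m ≤ 2 * β + 1) (m ≤ 2 * β) (m ≤ 3 * β) anti comm)).card := by
  classical
  unfold num₂
  congr 1
  ext ⟨x, y, u, t⟩
  simp only [Finset.mem_filter, Finset.mem_product, Finset.mem_range, Good₂, Least₂, Good₂',
    decide_eq_true_eq, decide_eq_false_iff_not]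
  refine and_congr_right fun hd => ?_
  have h1 : 2 ≤ β ↔ ¬ β = 1 := by omega
  have h2 : 2 * β < m ↔ ¬ m ≤ 2 * β := by omega
  constructor
  · rintro ⟨⟨-, -, -, -, -, -, a1, a2, a3, a4, a5, a6, a7, a8, a9, b1, b2, b3⟩, ⟨c1, c2⟩, c3⟩
    rw [h1] at b1 b2 b3
    rw [h2] at a7 a8
    exact ⟨a1, a2, a3, a4, a5, a6, a7, a8, a9, b1, b2, b3, c1, c2, c3⟩
  · rintro ⟨a1, a2, a3, a4, a5, a6, a7, a8, a9, b1, b2, b3, c1, c2, c3⟩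
    rw [← h1] at b1 b2 b3
    rw [← h2] at a7 a8
    exact ⟨⟨by omega, by omega, by omega, by omega, hβ, hβm, a1, a2, a3, a4, a5, a6, a7, a8, a9,
      b1, b2, b3⟩, ⟨c1, c2⟩, c3⟩

theorem num₂_one (hm : 4 ≤ m) (anti comm : Bool) :
    num₂ m anti comm 1 = select anti comm 5 4 2 := by
  rw [num₂_eq le_rfl (by omega), decide_eq_true (p := 1 = 1) rfl,
    decide_eq_false (p := 1 + 2 = m) (by omega), decide_eq_false (p := m ≤ 2 * 1 + 1) (by omega),
    decide_eq_false (p := m ≤ 2 * 1) (by omega)]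
  revert anti comm
  decide +kernel

/-- The summands belong to bb = W, where b^3 is free once 3β ≥ m; to exactly one of ab, ba being W,
where u has two values once 2β ≥ m; and to ab = ba = W, where u has three values once 2β + 1 ≥ m. -/
theorem num₂_mid (anti comm : Bool) (hβ : 2 ≤ β) (hβm : β + 2 < m) :
    num₂ m anti comm β = (if m ≤ 3 * β then 2 else 1) +
      select anti comm 2 1 0 * (if m ≤ 2 * β then 2 else 1) +
      (if m ≤ 2 * β + 1 then 3 else 1) := by
  have key : ∀ b b' b'' anti comm : Bool, (b' = true → b = true) → ((Finset.range 4 ×ˢ Finset.range 4 ×ˢ Finset.range 4 ×ˢ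
      Finset.range 2).filter (Good₂' false false b b' b'' anti comm)).card =
      (if b'' then 2 else 1) + select anti comm 2 1 0 * (if b' then 2 else 1) +
        (if b then 3 else 1) := by
    decide +kernel
  rw [num₂_eq (by omega) (by omega), decide_eq_false (p := β = 1) (by omega),
    decide_eq_false (p := β + 2 = m) (by omega), key]
  · simp
  · simp only [decide_eq_true_eq]
    omega

theorem num₂_top (hm : 4 ≤ m) (anti comm : Bool) :
    num₂ m anti comm (m - 2) = select anti comm 46 30 14 := by
  rw [num₂_eq (by omega) (by omega), decide_eq_false (p := m - 2 = 1) (by omega),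
    decide_eq_true (p := m - 2 + 2 = m) (by omega),
    decide_eq_true (p := m ≤ 2 * (m - 2) + 1) (by omega),
    decide_eq_true (p := m ≤ 2 * (m - 2)) (by omega),
    decide_eq_true (p := m ≤ 3 * (m - 2)) (by omega)]
  revert anti comm
  decide +kernel

end Counting

/-! ### Summation over all weights. -/

section Summation

theorem two_mul_sum_Ico_linear {a b : ℕ} (hab : a ≤ b) (c d : ℤ) :
    2 * ∑ i ∈ Finset.Ico a b, (c + d * i) = (b - a) * (2 * c + d * (a + b - 1)) := by
  induction b, hab using Nat.le_induction with
  | base => simp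
  | succ b hab ih =>
    rw [Finset.sum_Ico_succ_top hab, mul_add, ih]
    push_cast
    ring

theorem sum_Ico_ite {a b c : ℕ} (hac : a ≤ c) (hcb : c ≤ b) (P : ℕ → Prop) [DecidablePred P]
    (hP : ∀ i, P i ↔ c ≤ i) (u v : ℕ) :
    ∑ i ∈ Finset.Ico a b, (if P i then v else u) = (c - a) * u + (b - c) * v := by
  rw [← Finset.sum_Ico_consecutive _ hac hcb]
  congr 1
  · rw [Finset.sum_congr rfl (g := fun _ => u)]
    · simp
    · intro i hi
      rw [if_neg]
      rw [hP]
      simp at hi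
      omega
  · rw [Finset.sum_congr rfl (g := fun _ => v)]
    · simp
    · intro i hi
      rw [if_pos]
      rw [hP]
      simp at hi
      omega

variable {m q : ℕ}

theorem sum_num₁_split (f : ℕ → ℕ) (hq : 2 ≤ q) :
    ∑ p ∈ Finset.Ico 1 (q + 1), f p = f 1 + ∑ p ∈ Finset.Ico 2 q, f p + f q := by
  rw [Finset.sum_Ico_succ_top (by omega), Finset.sum_eq_sum_Ico_succ_bot (by omega)]

theorem sum_num₁_of_lt (hm : 4 ≤ m) (anti comm : Bool) (hq : 2 ≤ q) (hqm : 2 * q < m) :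
    ∑ p ∈ Finset.Ico 1 (q + 1), num₁ m anti comm q p = q := by
  rw [sum_num₁_split _ hq, num₁_one hm _ _ hq (by omega), num₁_diag hm _ _ hq (by omega),
    if_neg (by omega), if_neg (by omega), Finset.sum_congr rfl (g := fun _ => 1)]
  · simp
    omega
  · intro p hp
    rw [Finset.mem_Ico] at hp
    rw [num₁_low hm _ _ hp.1 hp.2 (by omega), if_neg (by omega)]

/-- The count jumps at p = m - q, where the products of the second and third generators become free,
and at p = ⌈m/2⌉, where the square of the second does. -/
theorem sum_num₁_of_le (hm : 4 ≤ m) (anti comm : Bool) (hqm : q + 1 < m) (h : m ≤ 2 * q) :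
    ∑ p ∈ Finset.Ico 1 (q + 1), num₁ m anti comm q p =
      2 + ((m - q - 2) * 2 + select anti comm 8 6 4 *
        (((m + 1) / 2 - (m - q)) * 1 + (q - (m + 1) / 2) * 2)) + select anti comm 10 9 6 := by
  rw [sum_num₁_split _ (by omega), num₁_one hm _ _ (by omega) hqm,
    num₁_diag hm _ _ (by omega) hqm, if_pos h, if_pos h,
    ← Finset.sum_Ico_consecutive _ (show 2 ≤ m - q by omega) (show m - q ≤ q by omega),
    Finset.sum_congr rfl (g := fun _ => 2),
    Finset.sum_congr (s₁ := Finset.Ico (m - q) q) rfl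
      (g := fun p => select anti comm 8 6 4 * if m ≤ 2 * p then 2 else 1),
    ← Finset.mul_sum, sum_Ico_ite (c := (m + 1) / 2) (by omega) (by omega) _ (fun i => by omega)]
  · simp
  · intro p hp
    rw [Finset.mem_Ico] at hp
    rw [num₁_mixed hm _ _ (by omega) hp.2 (by omega) hqm]
  · intro p hp
    rw [Finset.mem_Ico] at hp
    rw [num₁_low hm _ _ hp.1 (by omega) (by omega), if_pos h]

theorem sum_num₁_top (hm : 4 ≤ m) (anti comm : Bool) :
    ∑ p ∈ Finset.Ico 1 (m - 1 + 1), num₁ m anti comm (m - 1) p =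
      select anti comm 20 14 6 + select anti comm 32 20 8 *
        (((m + 1) / 2 - 2) * 1 + (m - 1 - (m + 1) / 2) * 2) + select anti comm 136 84 20 := by
  rw [sum_num₁_split _ (by omega), num₁_one_top hm, num₁_all hm,
    Finset.sum_congr rfl (g := fun p => select anti comm 32 20 8 * if m ≤ 2 * p then 2 else 1),
    ← Finset.mul_sum, sum_Ico_ite (c := (m + 1) / 2) (by omega) (by omega) _ (fun i => by omega)]
  intro p hp
  rw [Finset.mem_Ico] at hp
  rw [num₁_top hm _ _ hp.1 (by omega)]

theorem sum_num₂ (hm : 4 ≤ m) (anti comm : Bool) :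
    ∑ β ∈ Finset.Ico 1 (m - 1), num₂ m anti comm β =
      select anti comm 5 4 2 +
        (((m + 2) / 3 - 2) * 1 + (m - 2 - (m + 2) / 3) * 2 + select anti comm 2 1 0 *
          (((m + 1) / 2 - 2) * 1 + (m - 2 - (m + 1) / 2) * 2) +
          ((m / 2 - 2) * 1 + (m - 2 - m / 2) * 3)) + select anti comm 46 30 14 := by
  obtain ⟨q, rfl⟩ : ∃ q, m = q + 2 := ⟨m - 2, by omega⟩
  have h1 := num₂_one hm anti comm
  have h2 := num₂_top hm anti comm
  rw [Nat.add_sub_cancel] at h2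
  rw [show q + 2 - 1 = q + 1 by omega, sum_num₁_split _ (by omega), h1, h2,
    Finset.sum_congr rfl (fun β hβ => num₂_mid anti comm (Finset.mem_Ico.1 hβ).1
      (Nat.add_lt_add_right (Finset.mem_Ico.1 hβ).2 2)), Finset.sum_add_distrib,
    Finset.sum_add_distrib, ← Finset.mul_sum,
    -- With m = q + 2, the cut points ⌈m/3⌉, ⌈m/2⌉ and ⌊m/2⌋ express m ≤ 3β, m ≤ 2β and m ≤ 2β + 1.
    sum_Ico_ite (c := (q + 2 + 2) / 3) (by omega) (by omega) _ (fun i => by omega),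
    sum_Ico_ite (c := (q + 2 + 1) / 2) (by omega) (by omega) _ (fun i => by omega),
    sum_Ico_ite (c := (q + 2) / 2) (by omega) (by omega) _ (fun i => by omega)]
  simp only [Nat.add_sub_cancel]

/-- For fixed q the number of codes with three generators is q below h and an affine function of q
from h to m - 2, so arithmetic series remain; the factor 2 avoids their halves. -/
theorem two_mul_card_codes {h f c : ℕ} (hm : 4 ≤ m) (hh : h = (m + 1) / 2) (hf : f = m / 2)
    (hc : c = (m + 2) / 3) (anti comm : Bool) : 2 * ((codes m anti comm).card : ℤ) =
      2 * (1 + select anti comm 20 14 6 + select anti comm 32 20 8 * (2 * m - 4 - h) +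
        select anti comm 136 84 20 + select anti comm 5 4 2 + select anti comm 46 30 14) +
      (h - 2) * (h + 1) +
      (m - 1 - h) * (2 * (2 * m - 2 - select anti comm 8 6 4 * (m + h) + select anti comm 10 9 6) +
        (3 * select anti comm 8 6 4 - 2) * (h + m - 2)) +
      2 * ((2 * m - 6 - c) + select anti comm 2 1 0 * (2 * m - 6 - h) + (3 * m - 8 - 2 * f)) := by
  have hh' : 2 ≤ h := by omega
  have hhm : h ≤ m - 1 := by omega
  have e1 : ((∑ q ∈ Finset.Ico 2 h, ∑ p ∈ Finset.Ico 1 (q + 1), num₁ m anti comm q p : ℕ) : ℤ) =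
      ∑ q ∈ Finset.Ico 2 h, (0 + 1 * (q : ℤ)) := by
    rw [Nat.cast_sum]
    refine Finset.sum_congr rfl fun q hq => ?_
    rw [Finset.mem_Ico] at hq
    rw [sum_num₁_of_lt hm _ _ hq.1 (by omega)]
    ring
  have e2 : ((∑ q ∈ Finset.Ico h (m - 1), ∑ p ∈ Finset.Ico 1 (q + 1),
      num₁ m anti comm q p : ℕ) : ℤ) = ∑ q ∈ Finset.Ico h (m - 1),
      ((2 * m - 2 - select anti comm 8 6 4 * (m + h) + select anti comm 10 9 6) +
        (3 * select anti comm 8 6 4 - 2) * (q : ℤ)) := by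
    rw [Nat.cast_sum]
    refine Finset.sum_congr rfl fun q hq => ?_
    rw [Finset.mem_Ico] at hq
    rw [sum_num₁_of_le hm _ _ (by omega) (by omega), ← hh]
    obtain ⟨a, rfl⟩ := Nat.exists_eq_add_of_le hq.1
    have b1 : ((m - (h + a) - 2 : ℕ) : ℤ) = m - (h + a) - 2 := by omega
    have b2 : ((h - (m - (h + a)) : ℕ) : ℤ) = h - (m - (h + a)) := by omega
    have b3 : ((h + a - h : ℕ) : ℤ) = a := by omega
    push_cast [b1, b2, b3]
    ring
  have e3 := two_mul_sum_Ico_linear hh' 0 1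
  have e4 := two_mul_sum_Ico_linear hhm
    (2 * m - 2 - select anti comm 8 6 4 * (m + h) + select anti comm 10 9 6)
    (3 * select anti comm 8 6 4 - 2)
  have e5 : ∑ q ∈ Finset.Ico 1 m, ∑ p ∈ Finset.Ico 1 (q + 1), num₁ m anti comm q p =
      1 + (∑ q ∈ Finset.Ico 2 h, ∑ p ∈ Finset.Ico 1 (q + 1), num₁ m anti comm q p +
        ∑ q ∈ Finset.Ico h (m - 1), ∑ p ∈ Finset.Ico 1 (q + 1), num₁ m anti comm q p) +
      (select anti comm 20 14 6 + select anti comm 32 20 8 *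
        ((h - 2) * 1 + (m - 1 - h) * 2) + select anti comm 136 84 20) := by
    rw [Finset.sum_Ico_consecutive _ hh' hhm, hh, ← sum_num₁_top hm]
    have := sum_num₁_split (q := m - 1)
      (fun q => ∑ p ∈ Finset.Ico 1 (q + 1), num₁ m anti comm q p) (by omega)
    rw [show m - 1 + 1 = m by omega] at this ⊢
    rw [this]
    simp [num₁_one_one hm]
  -- Since m ≥ 4, none of these natural subtractions is truncated.
  have c1 : ((h - 2 : ℕ) : ℤ) = h - 2 := by omega
  have c2 : ((m - 1 - h : ℕ) : ℤ) = m - 1 - h := by omega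
  have c3 : ((c - 2 : ℕ) : ℤ) = c - 2 := by omega
  have c4 : ((m - 2 - c : ℕ) : ℤ) = m - 2 - c := by omega
  have c5 : ((m - 2 - h : ℕ) : ℤ) = m - 2 - h := by omega
  have c6 : ((f - 2 : ℕ) : ℤ) = f - 2 := by omega
  have c7 : ((m - 2 - f : ℕ) : ℤ) = m - 2 - f := by omega
  have c8 : ((m - 1 : ℕ) : ℤ) = m - 1 := by omega
  rw [card_codes, e5, sum_num₂ hm, ← hh, ← hf, ← hc, Nat.cast_add, Nat.cast_add, Nat.cast_add,
    Nat.cast_add (∑ q ∈ Finset.Ico 2 h, _), e1, e2]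
  rw [c8] at e4
  push_cast [c1, c2, c3, c4, c5, c6, c7] at e3 e4 ⊢
  linear_combination e3 + e4

theorem ceil_div_three (m : ℕ) : (⌈((m + 3 : ℕ) : ℚ) / 3⌉ : ℤ) = ((m + 2) / 3 + 1 : ℕ) := by
  rw [Int.ceil_eq_iff]
  obtain ⟨k, hk | hk | hk⟩ : ∃ k, m = 3 * k ∨ m = 3 * k + 1 ∨ m = 3 * k + 2 :=
    ⟨m / 3, by omega⟩
  · rw [show (m + 2) / 3 = k by omega, hk]
    push_cast
    constructor <;> linarith
  · rw [show (m + 2) / 3 = k + 1 by omega, hk]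
    push_cast
    constructor <;> linarith
  · rw [show (m + 2) / 3 = k + 1 by omega, hk]
    push_cast
    constructor <;> linarith

theorem two_mul_card_codes_odd {k : ℕ} (hk : 2 ≤ k) (anti comm : Bool) :
    2 * ((codes (2 * k + 1) anti comm).card : ℚ) =
      2 * (1 + select anti comm 20 14 6 + select anti comm 32 20 8 * (3 * k - 3) +
        select anti comm 136 84 20 + select anti comm 5 4 2 + select anti comm 46 30 14) +
      (k - 1) * (k + 2) +
      (k - 1) * (2 * (4 * k - select anti comm 8 6 4 * (3 * k + 2) + select anti comm 10 9 6) +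
        (3 * select anti comm 8 6 4 - 2) * (3 * k)) +
      2 * ((4 * k - 3 - ⌈((2 * k + 1 + 3 : ℕ) : ℚ) / 3⌉) + select anti comm 2 1 0 * (3 * k - 5) +
        (4 * k - 5)) := by
  have := two_mul_card_codes (m := 2 * k + 1) (h := k + 1) (f := k) (by omega) (by omega)
    (by omega) rfl anti comm
  rw [ceil_div_three]
  push_cast [← @Int.cast_inj ℚ] at this ⊢
  linear_combination this

theorem two_mul_card_codes_even {k : ℕ} (hk : 2 ≤ k) (anti comm : Bool) :
    2 * ((codes (2 * k) anti comm).card : ℚ) =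
      2 * (1 + select anti comm 20 14 6 + select anti comm 32 20 8 * (3 * k - 4) +
        select anti comm 136 84 20 + select anti comm 5 4 2 + select anti comm 46 30 14) +
      (k - 2) * (k + 1) +
      (k - 1) * (2 * (4 * k - 2 - select anti comm 8 6 4 * (3 * k) + select anti comm 10 9 6) +
        (3 * select anti comm 8 6 4 - 2) * (3 * k - 2)) +
      2 * ((4 * k - 5 - ⌈((2 * k + 3 : ℕ) : ℚ) / 3⌉) + select anti comm 2 1 0 * (3 * k - 6) +
        (4 * k - 8)) := by
  have := two_mul_card_codes (m := 2 * k) (h := k) (f := k) (by omega) (by omega)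
    (by omega) rfl anti comm
  rw [ceil_div_three]
  push_cast [← @Int.cast_inj ℚ] at this ⊢
  linear_combination this

end Summation

theorem mainTheorem9 (n : ℕ) (hn : 7 ≤ n) :
    ((Even n → (numIsoOrAntiIso n 2 : ℚ) =
        1 / 8 * (21 * (n : ℚ) ^ 2 + 66 * (n : ℚ) - 104) - (⌈(n : ℚ) / 3⌉ : ℚ)) ∧
      (Odd n → (numIsoOrAntiIso n 2 : ℚ) =
        1 / 8 * (21 * (n : ℚ) ^ 2 + 80 * (n : ℚ) - 93) - (⌈(n : ℚ) / 3⌉ : ℚ))) ∧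
    ((Even n → (numIso n 2 : ℚ) =
        1 / 8 * (27 * (n : ℚ) ^ 2 + 150 * (n : ℚ) - 240) - (⌈(n : ℚ) / 3⌉ : ℚ)) ∧
      (Odd n → (numIso n 2 : ℚ) =
        1 / 8 * (27 * (n : ℚ) ^ 2 + 168 * (n : ℚ) - 203) - (⌈(n : ℚ) / 3⌉ : ℚ))) ∧
    ((Even n → (numCommIso n 2 : ℚ) =
        1 / 8 * (15 * (n : ℚ) ^ 2 - 26 * (n : ℚ) - 40) - (⌈(n : ℚ) / 3⌉ : ℚ)) ∧
      (Odd n → (numCommIso n 2 : ℚ) =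
        1 / 8 * (15 * (n : ℚ) ^ 2 - 16 * (n : ℚ) - 63) - (⌈(n : ℚ) / 3⌉ : ℚ))) := by
  obtain ⟨m, rfl⟩ : ∃ m, n = m + 3 := ⟨n - 3, by omega⟩
  have hm : 4 ≤ m := by omega
  rw [numIso_eq_card_codes hm, numIsoOrAntiIso_eq_card_codes hm, numCommIso_eq_card_codes hm]
  -- As n = m + 3, an even m belongs to the formulas for odd n and conversely.
  obtain ⟨k, rfl | rfl⟩ := Nat.even_or_odd' m
  · have h₁ := two_mul_card_codes_even (k := k) (by omega) true false
    have h₂ := two_mul_card_codes_even (k := k) (by omega) false false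
    have h₃ := two_mul_card_codes_even (k := k) (by omega) false true
    have hne : ¬ Even (2 * k + 3) := by rw [Nat.even_iff]; omega
    simp only [select] at h₁ h₂ h₃
    refine ⟨⟨fun h => absurd h hne, fun _ => ?_⟩, ⟨fun h => absurd h hne, fun _ => ?_⟩,
      ⟨fun h => absurd h hne, fun _ => ?_⟩⟩ <;> push_cast at h₁ h₂ h₃ ⊢ <;> simp at h₁ h₂ h₃
    · linear_combination h₁ / 2
    · linear_combination h₂ / 2
    · linear_combination h₃ / 2
  · have h₁ := two_mul_card_codes_odd (k := k) (by omega) true false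
    have h₂ := two_mul_card_codes_odd (k := k) (by omega) false false
    have h₃ := two_mul_card_codes_odd (k := k) (by omega) false true
    have hne : ¬ Odd (2 * k + 1 + 3) := by rw [Nat.odd_iff]; omega
    simp only [select] at h₁ h₂ h₃
    refine ⟨⟨fun _ => ?_, fun h => absurd h hne⟩, ⟨fun _ => ?_, fun h => absurd h hne⟩,
      ⟨fun _ => ?_, fun h => absurd h hne⟩⟩ <;> push_cast at h₁ h₂ h₃ ⊢ <;> simp at h₁ h₂ h₃
    · linear_combination h₁ / 2
    · linear_combination h₂ / 2
    · linear_combination h₃ / 2
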